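/- Let $(M,g)$ be an oriented smooth $n$-dimensional Riemannian manifold (Hausdorff, second countable, without boundary; no completeness or connectedness is assumed) and let $0\le k\le n$. Notation. $L^p(M,\Lambda^k)$ is the Banach space of measurable $k$-forms $\omega$, modulo equality almost everywhere, with $\|\omega\|_p=\big(\int_M|\omega|^p\,d\mathrm{vol}_g\big)^{1/p}<\infty$; $\mathcal D^k$ is the space of smooth $k$-forms with compact support. A form $\theta$ of degree $k+1$ is the weak differential $d\omega$ of a $k$-form $\omega$ if $\int_M\theta\wedge\eta=(-1)^{k+1}\int_M\omega\wedge d\eta$ for all $\eta\in\mathcal D^{n-k-1}$. Put $\Omega^k_{q,p}(M)=\{\omega\in L^q(M,\Lambda^k): d\omega\in L^p(M,\Lambda^{k+1})\}$ with norm $\|\omega\|_q+\|d\omega\|_p$, and let $\Omega^k_{q,p;0}(M)$ be the closure of $\mathcal D^k$ in $\Omega^k_{q,p}(M)$. Spaces of forms of degree $-1$ or $n+1$ are $0$. Define $$\overline H^k_{q,p}(M)=Z^k_p(M)\big/\overline{d\,\Omega^{k-1}_{q,p}(M)}^{L^p},\qquad \overline H^k_{r,s;0}(M)=Z^k_{r,s;0}(M)\big/\overline{d\mathcal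 D^{k-1}}^{L^r},$$ where $Z^k_p(M)\subset L^p(M,\Lambda^k)$ is the space of weakly closed forms and $Z^k_{r,s;0}(M)=\{\omega\in\Omega^k_{r,s;0}(M): d\omega=0\}$, normed by $\|\cdot\|_r$. For a tuple $\pi=(p_0,\dots,p_n)$ of exponents in $[1,\infty]$ put $\Omega^k_\pi(M)=\Omega^k_{p_k,p_{k+1}}(M)$ and $\Omega^k_{\pi;0}(M)=\Omega^k_{p_k,p_{k+1};0}(M)$ (for $k=n$ the exponent $p_{n+1}$ plays no role). With the weak differential $d$ these form Banach complexes; $\overline H^k_\pi(M)$ and $\overline H^k_{\pi;0}(M)$ denote their reduced cohomology spaces (kernel of $d$ modulo the closure of the image of $d$). The dual tuple of $\pi$ is $\pi'=(r_0,\dots,r_n)$ with $\frac1{r_j}+\frac1{p_{n-j}}=1$. Theorem. (1) Let $1<p,q<\infty$ and $\frac1p+\frac1{p'}=\frac1q+\frac1{q'}=1$. For $\omega\in Z^k_p(M)$ and $\varphi\in Z^{n-k}_{p',q';0}(M)$ the integral $\int_M\omega\wedge\varphi$ converges, and $$\langle[\omega],[\varphi]\rangle=\int_M\omega\wedge\varphi$$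 is a well-defined pairing $\overline H^k_{q,p}(M)\times\overline H^{n-k}_{p',q';0}(M)\to\mathbb R$ that puts the two spaces in duality: it induces isomorphisms of topological vector spaces of $\overline H^k_{q,p}(M)$ onto the dual of $\overline H^{n-k}_{p',q';0}(M)$, and of $\overline H^{n-k}_{p',q';0}(M)$ onto the dual of $\overline H^k_{q,p}(M)$. (2) Let $\pi=(p_0,\dots,p_n)$ with $1<p_j<\infty$ for all $j$, and let $\pi'$ be its dual tuple. Then $\overline H^k_\pi(M)$ and $\overline H^{n-k}_{\pi';0}(M)$ are in duality, in the same sense, for the pairing $\langle[\beta],[\varphi]\rangle=\int_M\beta\wedge\varphi$, where $\beta$ and $\varphi$ are cocycles of $\Omega^*_\pi(M)$ and $\Omega^*_{\pi';0}(M)$ of degrees $k$ and $n-k$. -/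

import Mathlib

open MeasureTheory Set Filter Topology
open scoped Manifold ContDiff ENNReal

noncomputable section

/-! ## Linear algebra of a Euclidean scalar product in an arbitrary frame -/

/-- The wedge product of a `k`-form and an `l`-form on a vector space, as a form of degree
`n = k + l`, normalised by `(α ∧ φ)(v) = ∑ sign(σ) α(v_{σ 1}, …, v_{σ k}) φ(v_{σ (k+1)}, …)`,
the sum running over the `(k, l)`-shuffles. -/
def wedge {V : Type*} [AddCommGroup V] [Module ℝ V] [TopologicalSpace V] {k l n : ℕ}
    (h : k + l = n) (α : V [⋀^Fin k]→L[ℝ] ℝ) (φ : V [⋀^Fin l]→L[ℝ] ℝ) : V [⋀^Fin n]→ₗ[ℝ] ℝ :=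
  ((LinearMap.mul' ℝ ℝ).compAlternatingMap
    (α.toAlternatingMap.domCoprod φ.toAlternatingMap)).domDomCongr
      (finSumFinEquiv.trans (finCongr h))

/-- The Gram matrix `g_{ij} = B(b_i, b_j)` of a frame. -/
def gramMatrix {V : Type*} [AddCommGroup V] [Module ℝ V] [TopologicalSpace V] {n : ℕ}
    (B : V →L[ℝ] V →L[ℝ] ℝ) (b : Fin n → V) : Matrix (Fin n) (Fin n) ℝ :=
  Matrix.of fun i j => B (b i) (b j)

/-- The squared length `(1 / k!) ∑ g^{i₁ j₁} ⋯ g^{i_k j_k} α_{i₁ … i_k} α_{j₁ … j_k}` of a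
`k`-form, computed in the frame `b`. -/
def frameNormSq {V : Type*} [AddCommGroup V] [Module ℝ V] [TopologicalSpace V] {n k : ℕ}
    (B : V →L[ℝ] V →L[ℝ] ℝ) (b : Fin n → V) (α : V [⋀^Fin k]→L[ℝ] ℝ) : ℝ :=
  (k.factorial : ℝ)⁻¹ * ∑ I : Fin k → Fin n, ∑ J : Fin k → Fin n,
    (∏ a, (gramMatrix B b)⁻¹ (I a) (J a)) * (α (fun a => b (I a)) * α (fun a => b (J a)))

/-- The squared length is `(1 / k!) ∑ α(e_{i₁}, …, e_{i_k})²` in any orthonormal frame `e`. -/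
theorem frameNormSq_eq {V : Type*} [AddCommGroup V] [Module ℝ V] [TopologicalSpace V]
    {n k : ℕ} (B : V →L[ℝ] V →L[ℝ] ℝ) (b e : Fin n → V) (Q : Matrix (Fin n) (Fin n) ℝ)
    (he : ∀ i, e i = ∑ j, Q j i • b j) (ho : gramMatrix B e = 1) (α : V [⋀^Fin k]→L[ℝ] ℝ) :
    frameNormSq B b α = (k.factorial : ℝ)⁻¹ * ∑ I : Fin k → Fin n, α (fun a => e (I a)) ^ 2 := by
  have h1 : Q.transpose * (gramMatrix B b * Q) = 1 := by
    rw [← ho]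
    ext i j
    simp only [Matrix.mul_apply, Matrix.transpose_apply, gramMatrix, Matrix.of_apply, he,
      map_sum, map_smul, sum_apply, smul_apply,
      smul_eq_mul, Finset.mul_sum]
    rw [Finset.sum_comm]
    refine Finset.sum_congr rfl fun a _ => Finset.sum_congr rfl fun c _ => by ring
  have h2 : gramMatrix B b * (Q * Q.transpose) = 1 := by
    rw [← Matrix.mul_assoc]
    exact mul_eq_one_comm.mp h1
  have h3 : (gramMatrix B b)⁻¹ = Q * Q.transpose := Matrix.inv_eq_right_inv h2
  have h4 : ∀ f : Fin k → Fin n, α (fun a => e (f a)) =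
      ∑ I : Fin k → Fin n, (∏ a, Q (I a) (f a)) * α (fun a => b (I a)) := by
    intro f
    have := (α.toMultilinearMap).map_sum (fun (a : Fin k) (j : Fin n) => Q j (f a) • b j)
    simp only [he]
    refine Eq.trans this (Finset.sum_congr rfl fun I _ => ?_)
    exact (α.toMultilinearMap).map_smul_univ (fun a => Q (I a) (f a)) (fun a => b (I a))
  unfold frameNormSq
  congr 1
  rw [h3]
  have h5 : ∀ I J : Fin k → Fin n, ∏ a, (Q * Q.transpose) (I a) (J a) =
      ∑ f : Fin k → Fin n, (∏ a, Q (I a) (f a)) * ∏ a, Q (J a) (f a) := by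
    intro I J
    simp only [Matrix.mul_apply, Matrix.transpose_apply, Finset.prod_univ_sum,
      Fintype.piFinset_univ, Finset.prod_mul_distrib]
  simp only [h5, h4, sq, Finset.sum_mul, Finset.mul_sum]
  rw [Finset.sum_comm]
  have h6 : ∀ J I f : Fin k → Fin n, (∏ a, Q (I a) (f a)) * (∏ a, Q (J a) (f a)) *
      (α (fun a => b (I a)) * α (fun a => b (J a))) =
      (∏ a, Q (I a) (f a)) * α (fun a => b (I a)) *
        ((∏ a, Q (J a) (f a)) * α (fun a => b (J a))) := fun J I f => by ring
  simp only [h6]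
  rw [Finset.sum_congr rfl fun J _ => Finset.sum_comm]
  rw [Finset.sum_comm]

theorem wedge_add {V : Type*} [AddCommGroup V] [Module ℝ V] [TopologicalSpace V] {k l n : ℕ}
    (h : k + l = n) (α β : V [⋀^Fin k]→L[ℝ] ℝ) (φ : V [⋀^Fin l]→L[ℝ] ℝ) :
    wedge h (α + β) φ = wedge h α φ + wedge h β φ := by
  have : (α + β).toAlternatingMap.domCoprod φ.toAlternatingMap =
      α.toAlternatingMap.domCoprod φ.toAlternatingMap +
        β.toAlternatingMap.domCoprod φ.toAlternatingMap := by
    rw [← AlternatingMap.domCoprod'_apply, ← AlternatingMap.domCoprod'_apply,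
      ← AlternatingMap.domCoprod'_apply, ← map_add, ← TensorProduct.add_tmul]
    rfl
  rw [wedge, this]
  ext v
  exact map_add (LinearMap.mul' ℝ ℝ) _ _

theorem wedge_smul {V : Type*} [AddCommGroup V] [Module ℝ V] [TopologicalSpace V] {k l n : ℕ}
    (h : k + l = n) (c : ℝ) (α : V [⋀^Fin k]→L[ℝ] ℝ) (φ : V [⋀^Fin l]→L[ℝ] ℝ) :
    wedge h (c • α) φ = c • wedge h α φ := by
  have : (c • α).toAlternatingMap.domCoprod φ.toAlternatingMap =
      c • α.toAlternatingMap.domCoprod φ.toAlternatingMap := by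
    rw [← AlternatingMap.domCoprod'_apply, ← AlternatingMap.domCoprod'_apply,
      ← map_smul, TensorProduct.smul_tmul']
    rfl
  rw [wedge, this]
  ext v
  exact map_smul (LinearMap.mul' ℝ ℝ) c _

/-! ## Riemannian metrics, orientations, differential forms -/

/-- The model space `ℝⁿ`. -/
abbrev Model (n : ℕ) : Type := EuclideanSpace ℝ (Fin n)

/-- A smooth Riemannian metric on the `n`-manifold `M`. -/
abbrev Metric (n : ℕ) (M : Type*) [TopologicalSpace M] [ChartedSpace (Model n) M]
    [IsManifold (𝓡 n) ∞ M] : Type _ :=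
  Bundle.ContMDiffRiemannianMetric (𝓡 n) ∞ (Model n) (fun x : M => TangentSpace (𝓡 n) x)

/-- An orientation of the `n`-manifold `M`: an orientation of every tangent space which is locally
constant when read in a local trivialization of the tangent bundle. -/
structure ManifoldOrientation (n : ℕ) (M : Type*) [TopologicalSpace M]
    [ChartedSpace (Model n) M] [IsManifold (𝓡 n) ∞ M] where
  /-- The orientation of the tangent space at `x`. -/
  at' (x : M) : Orientation ℝ (TangentSpace (𝓡 n) x) (Fin n)
  locally_constant (x₀ : M) : ∃ ε : Orientation ℝ (Model n) (Fin n), ∀ᶠ x in 𝓝 x₀,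
    ∀ hx : x ∈ (trivializationAt (Model n) (TangentSpace (𝓡 n) (M := M)) x₀).baseSet,
      Orientation.map (Fin n)
        ((trivializationAt (Model n) (TangentSpace (𝓡 n) (M := M)) x₀).continuousLinearEquivAt
          ℝ x hx).toLinearEquiv (at' x) = ε

/-- A (not necessarily continuous) differential `k`-form on `M`. -/
abbrev FormField (n : ℕ) (M : Type*) [TopologicalSpace M] [ChartedSpace (Model n) M]
    (k : ℕ) : Type _ :=
  ∀ x : M, (TangentSpace (𝓡 n) x) [⋀^Fin k]→L[ℝ] ℝ

section Geometry

variable {n : ℕ} {M : Type*} [TopologicalSpace M] [ChartedSpace (Model n) M]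

/-- A frame of the tangent space at `x`: the coordinate basis of the preferred chart at `x`. -/
def stdFrame (x : M) : Module.Basis (Fin n) ℝ (TangentSpace (𝓡 n) x) :=
  (EuclideanSpace.basisFun (Fin n) ℝ).toBasis

/-- The derivative at `y` of the inverse of the chart at `x₀`; it sends the standard basis of `ℝⁿ`
to the coordinate vector fields `∂/∂yⁱ`. -/
def coordMap (x₀ : M) (y : Model n) :
    Model n →L[ℝ] TangentSpace (𝓡 n) ((extChartAt (𝓡 n) x₀).symm y) :=
  mfderiv 𝓘(ℝ, Model n) (𝓡 n) (extChartAt (𝓡 n) x₀).symm y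

/-- The frame of coordinate vector fields of the chart at `x₀`. -/
def coordFrame (x₀ : M) (y : Model n) (i : Fin n) :
    TangentSpace (𝓡 n) ((extChartAt (𝓡 n) x₀).symm y) :=
  coordMap x₀ y (EuclideanSpace.basisFun (Fin n) ℝ i)

/-- The coordinate expression of a form in the chart at `x₀` (meaningful on the target of that
chart): its pullback by the inverse of the chart. -/
def chartRep {k : ℕ} (x₀ : M) (α : FormField n M k) (y : Model n) :
    (Model n) [⋀^Fin k]→L[ℝ] ℝ :=
  (α ((extChartAt (𝓡 n) x₀).symm y)).compContinuousLinearMap (coordMap x₀ y)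

/-- A form is smooth if its coefficients in every chart are. -/
def IsSmoothForm {k : ℕ} (α : FormField n M k) : Prop :=
  ∀ x₀ : M, ContDiffOn ℝ ∞ (chartRep x₀ α) (extChartAt (𝓡 n) x₀).target

/-- A smooth form with compact support, i.e. an element of `𝒟ᵏ`. -/
def IsTestForm {k : ℕ} (α : FormField n M k) : Prop :=
  IsSmoothForm α ∧ IsCompact (closure {x | α x ≠ 0})

/-- The exterior differential of a smooth form, computed at `x` in the chart at `x`. -/
def extD {k : ℕ} (α : FormField n M k) : FormField n M (k + 1) := fun x =>
  (extDeriv (chartRep x α) (extChartAt (𝓡 n) x x)).compContinuousLinearMap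
    (mfderiv (𝓡 n) 𝓘(ℝ, Model n) (extChartAt (𝓡 n) x) x)

/-- A form is measurable if its coefficients in every chart are Borel measurable. (Every form with
Lebesgue measurable coefficients agrees almost everywhere with one of these.) -/
def IsMeasurableForm {k : ℕ} (α : FormField n M k) : Prop :=
  ∀ (x₀ : M) (v : Fin k → Model n),
    Measurable ((extChartAt (𝓡 n) x₀).target.domRestrict fun y => chartRep x₀ α y v)

theorem chartRep_add {k : ℕ} (x₀ : M) (α η : FormField n M k) :
    chartRep x₀ (α + η) = chartRep x₀ α + chartRep x₀ η := by
  ext y v; rfl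

theorem chartRep_smul {k : ℕ} (x₀ : M) (c : ℝ) (α : FormField n M k) :
    chartRep x₀ (c • α) = c • chartRep x₀ α := by
  ext y v; rfl

theorem IsMeasurableForm.add {k : ℕ} {α η : FormField n M k} (h : IsMeasurableForm α)
    (h' : IsMeasurableForm η) : IsMeasurableForm (α + η) := fun x₀ v => by
  rw [chartRep_add]
  exact (h x₀ v).add (h' x₀ v)

theorem IsMeasurableForm.smul {k : ℕ} {α : FormField n M k} (c : ℝ) (h : IsMeasurableForm α) :
    IsMeasurableForm (c • α) := fun x₀ v => by
  rw [chartRep_smul]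
  exact (h x₀ v).const_mul c

theorem IsMeasurableForm.zero {k : ℕ} : IsMeasurableForm (0 : FormField n M k) := fun _ _ =>
  (measurable_const (a := (0 : ℝ)))

theorem IsTestForm.zero {k : ℕ} : IsTestForm (0 : FormField n M k) := by
  refine ⟨fun x₀ => ?_, by simp⟩
  exact (contDiffOn_const (c := 0))

theorem IsTestForm.add {k : ℕ} {α η : FormField n M k} (h : IsTestForm α)
    (h' : IsTestForm η) : IsTestForm (α + η) := by
  refine ⟨fun x₀ => ?_, ?_⟩
  · rw [chartRep_add]
    exact (h.1 x₀).add (h'.1 x₀)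
  · refine (h.2.union h'.2).of_isClosed_subset isClosed_closure ?_
    rw [← closure_union]
    refine closure_mono fun x hx => ?_
    by_contra hc
    simp only [mem_union, mem_ofPred_eq, not_or, not_not] at hc
    exact hx (by simp [hc.1, hc.2])

theorem IsTestForm.smul {k : ℕ} {α : FormField n M k} (c : ℝ) (h : IsTestForm α) :
    IsTestForm (c • α) := by
  refine ⟨fun x₀ => ?_, ?_⟩
  · rw [chartRep_smul]
    exact contDiffOn_const.smul (h.1 x₀)
  · refine h.2.of_isClosed_subset isClosed_closure (closure_mono fun x hx hc => ?_)
    exact hx (by simp [hc])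

theorem IsSmoothForm.differentiableAt {k : ℕ} {α : FormField n M k} (h : IsSmoothForm α)
    (x : M) : DifferentiableAt ℝ (chartRep x α) (extChartAt (𝓡 n) x x) :=
  ((h x).contDiffAt (extChartAt_target_mem_nhds x)).differentiableAt (by simp)

theorem extD_add {k : ℕ} {α η : FormField n M k} (h : IsSmoothForm α) (h' : IsSmoothForm η) :
    extD (α + η) = extD α + extD η := by
  funext x
  simp only [extD, Pi.add_apply]
  rw [chartRep_add, extDeriv_add (h.differentiableAt x) (h'.differentiableAt x)]
  rfl

theorem extD_smul {k : ℕ} (c : ℝ) (α : FormField n M k) : extD (c • α) = c • extD α := by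
  funext x
  simp only [extD, Pi.smul_apply]
  rw [chartRep_smul, extDeriv_smul]
  rfl

theorem extD_zero {k : ℕ} : extD (0 : FormField n M k) = 0 := by
  have := extD_smul (0 : ℝ) (0 : FormField n M k)
  simpa using this

theorem mem_source_of_target (x₀ : M) {y : Model n} (hy : y ∈ (extChartAt (𝓡 n) x₀).target) :
    (extChartAt (𝓡 n) x₀).symm y ∈ (chartAt (Model n) x₀).source := by
  rw [← extChartAt_source (𝓡 n)]
  exact (extChartAt (𝓡 n) x₀).map_target hy

variable [IsManifold (𝓡 n) ∞ M]

/-- The pointwise length `|α|ₓ` of a `k`-covector at `x` for the metric `g`. -/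
def formNorm (g : Metric n M) {k : ℕ} (x : M) (α : (TangentSpace (𝓡 n) x) [⋀^Fin k]→L[ℝ] ℝ) : ℝ :=
  √(frameNormSq (g.inner x) (stdFrame x) α)

/-- The Riemannian measure as seen in the chart at `x₀`: the image under the inverse of the chart
of `√(det g_{ij}) dy`. -/
def chartMeasure [MeasurableSpace M] (g : Metric n M) (x₀ : M) : Measure M :=
  ((volume.restrict (extChartAt (𝓡 n) x₀).target).withDensity fun y =>
    ENNReal.ofReal (√(gramMatrix (g.inner ((extChartAt (𝓡 n) x₀).symm y))
      (coordFrame x₀ y)).det)).map (extChartAt (𝓡 n) x₀).symm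

/-- The Riemannian measure `dvol_g`. The measures `chartMeasure g x₀` agree on the intersections of
the chart domains, and the measure that restricts to them is their least upper bound. -/
def riemannianMeasure [MeasurableSpace M] (g : Metric n M) : Measure M :=
  ⨆ x₀ : M, chartMeasure g x₀

/-- The function `f` with `η = f · vol` at `x`, where `η` is an `n`-covector and `vol` is the
Riemannian volume form, whose value on the frame `b` is `±√(det g_{ij})`. -/
def topDensity (g : Metric n M) (o : ManifoldOrientation n M) (x : M)
    (η : (TangentSpace (𝓡 n) x) [⋀^Fin n]→ₗ[ℝ] ℝ) : ℝ :=
  open Classical in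
  (if (stdFrame x).orientation = o.at' x then 1 else -1) * η (stdFrame x) /
    √(gramMatrix (g.inner x) (stdFrame x)).det

/-- The function `f` with `α ∧ φ = f · vol`, for forms of complementary degrees. -/
def wedgeDensity (g : Metric n M) (o : ManifoldOrientation n M) {k l : ℕ} (h : k + l = n)
    (α : FormField n M k) (φ : FormField n M l) (x : M) : ℝ :=
  topDensity g o x (wedge h (α x) (φ x))

/-- The integral `∫_M α ∧ φ`, for forms of complementary degrees. -/
def wedgeIntegral [MeasurableSpace M] (g : Metric n M) (o : ManifoldOrientation n M) {k l : ℕ}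
    (h : k + l = n) (α : FormField n M k) (φ : FormField n M l) : ℝ :=
  ∫ x, wedgeDensity g o h α φ x ∂(riemannianMeasure g)

theorem wedgeDensity_add (g : Metric n M) (o : ManifoldOrientation n M) {k l : ℕ} (h : k + l = n)
    (α β : FormField n M k) (η : FormField n M l) :
    wedgeDensity g o h (α + β) η = wedgeDensity g o h α η + wedgeDensity g o h β η := by
  funext x
  simp only [wedgeDensity, Pi.add_apply, wedge_add, topDensity, AlternatingMap.add_apply]
  ring

theorem wedgeDensity_smul (g : Metric n M) (o : ManifoldOrientation n M) {k l : ℕ}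
    (h : k + l = n) (c : ℝ) (α : FormField n M k) (η : FormField n M l) :
    wedgeDensity g o h (c • α) η = c • wedgeDensity g o h α η := by
  funext x
  simp only [wedgeDensity, Pi.smul_apply, wedge_smul, topDensity, AlternatingMap.smul_apply,
    smul_eq_mul]
  ring

end Geometry

section Norms

variable {n : ℕ} {M : Type*} [TopologicalSpace M] [ChartedSpace (Model n) M]
  [IsManifold (𝓡 n) ∞ M]

theorem exists_orthonormal_frame (g : Metric n M) (x : M) :
    ∃ e : Fin n → TangentSpace (𝓡 n) x, gramMatrix (g.inner x) e = 1 := by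
  let c : InnerProductSpace.Core ℝ (TangentSpace (𝓡 n) x) := g.toRiemannianMetric.toCore x
  let _ : NormedAddCommGroup (TangentSpace (𝓡 n) x) := c.toNormedAddCommGroup
  let _ : InnerProductSpace ℝ (TangentSpace (𝓡 n) x) := InnerProductSpace.ofCore c.toCore
  have : FiniteDimensional ℝ (TangentSpace (𝓡 n) x) := (stdFrame x).finiteDimensional_of_finite
  have hn : Module.finrank ℝ (TangentSpace (𝓡 n) x) = n := by
    rw [Module.finrank_eq_card_basis (stdFrame x), Fintype.card_fin]
  let e := (stdOrthonormalBasis ℝ (TangentSpace (𝓡 n) x)).reindex (finCongr hn)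
  refine ⟨e, ?_⟩
  ext i j
  have := orthonormal_iff_ite.mp e.orthonormal i j
  rw [Matrix.one_apply, ← this]
  rfl

theorem frameNormSq_basis (g : Metric n M) {k : ℕ} (x : M)
    (b : Module.Basis (Fin n) ℝ (TangentSpace (𝓡 n) x)) (e : Fin n → TangentSpace (𝓡 n) x)
    (he : gramMatrix (g.inner x) e = 1) (α : (TangentSpace (𝓡 n) x) [⋀^Fin k]→L[ℝ] ℝ) :
    frameNormSq (g.inner x) b α =
      (k.factorial : ℝ)⁻¹ * ∑ I : Fin k → Fin n, α (fun a => e (I a)) ^ 2 :=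
  frameNormSq_eq (g.inner x) b e (Matrix.of fun j i => b.repr (e i) j)
    (fun i => (b.sum_repr (e i)).symm) he α

theorem exists_formNorm_eq (g : Metric n M) (k : ℕ) (x : M) :
    ∃ T : ((TangentSpace (𝓡 n) x) [⋀^Fin k]→L[ℝ] ℝ) →ₗ[ℝ] EuclideanSpace ℝ (Fin k → Fin n),
      ∀ α, formNorm g x α = √((k.factorial : ℝ)⁻¹) * ‖T α‖ := by
  obtain ⟨e, he⟩ := exists_orthonormal_frame g x
  refine ⟨⟨⟨fun α => WithLp.toLp 2 fun I => α fun a => e (I a), fun α β => rfl⟩,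
    fun c α => rfl⟩, fun α => ?_⟩
  rw [formNorm, frameNormSq_basis g x (stdFrame x) e he, Real.sqrt_mul (by positivity),
    EuclideanSpace.norm_eq]
  congr 2
  exact Finset.sum_congr rfl fun I _ => (sq_abs _).symm

theorem formNorm_nonneg (g : Metric n M) {k : ℕ} (x : M)
    (α : (TangentSpace (𝓡 n) x) [⋀^Fin k]→L[ℝ] ℝ) : 0 ≤ formNorm g x α := Real.sqrt_nonneg _

theorem formNorm_zero (g : Metric n M) {k : ℕ} (x : M) :
    formNorm g x (0 : (TangentSpace (𝓡 n) x) [⋀^Fin k]→L[ℝ] ℝ) = 0 := by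
  obtain ⟨T, hT⟩ := exists_formNorm_eq g k x
  simp [hT]

theorem formNorm_smul (g : Metric n M) {k : ℕ} (x : M) (c : ℝ)
    (α : (TangentSpace (𝓡 n) x) [⋀^Fin k]→L[ℝ] ℝ) :
    formNorm g x (c • α) = |c| * formNorm g x α := by
  obtain ⟨T, hT⟩ := exists_formNorm_eq g k x
  rw [hT, hT, map_smul, norm_smul, Real.norm_eq_abs]
  ring

theorem formNorm_add_le (g : Metric n M) {k : ℕ} (x : M)
    (α β : (TangentSpace (𝓡 n) x) [⋀^Fin k]→L[ℝ] ℝ) :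
    formNorm g x (α + β) ≤ formNorm g x α + formNorm g x β := by
  obtain ⟨T, hT⟩ := exists_formNorm_eq g k x
  rw [hT, hT, hT, map_add, ← mul_add]
  exact mul_le_mul_of_nonneg_left (norm_add_le _ _) (Real.sqrt_nonneg _)

theorem coordMap_eq_symmL (x₀ : M) {y : Model n} (hy : y ∈ (extChartAt (𝓡 n) x₀).target)
    (v : Model n) :
    coordMap x₀ y v = (trivializationAt (Model n) (TangentSpace (𝓡 n) (M := M)) x₀).symmL ℝ
      ((extChartAt (𝓡 n) x₀).symm y) v := by
  have h := TangentBundle.symmL_trivializationAt (𝕜 := ℝ) (I := 𝓡 n)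
    (mem_source_of_target x₀ hy)
  have h' := (extChartAt (𝓡 n) x₀).right_inv hy
  have h2 := congrArg (fun L : Model n →L[ℝ] Model n => L v) h
  refine Eq.trans ?_ h2.symm
  have h3 : ∀ z : Model n, z = y →
      (mfderiv 𝓘(ℝ, Model n) (𝓡 n) (extChartAt (𝓡 n) x₀).symm y : Model n →L[ℝ] Model n) v =
      (mfderivWithin 𝓘(ℝ, Model n) (𝓡 n) (extChartAt (𝓡 n) x₀).symm (range (𝓡 n)) z :
        Model n →L[ℝ] Model n) v := by
    rintro z rfl
    have : range (𝓡 n) = univ := ModelWithCorners.range_eq_univ _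
    rw [this, mfderivWithin_univ]
  exact h3 _ h'

theorem mem_baseSet_of_target (x₀ : M) {y : Model n} (hy : y ∈ (extChartAt (𝓡 n) x₀).target) :
    (extChartAt (𝓡 n) x₀).symm y ∈
      (trivializationAt (Model n) (TangentSpace (𝓡 n) (M := M)) x₀).baseSet := by
  rw [TangentBundle.trivializationAt_baseSet]
  exact mem_source_of_target x₀ hy

theorem exists_coordFrame_basis (x₀ : M) {y : Model n}
    (hy : y ∈ (extChartAt (𝓡 n) x₀).target) :
    ∃ b : Module.Basis (Fin n) ℝ (TangentSpace (𝓡 n) ((extChartAt (𝓡 n) x₀).symm y)),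
      ∀ i, b i = coordFrame x₀ y i := by
  refine ⟨(EuclideanSpace.basisFun (Fin n) ℝ).toBasis.map
    ((trivializationAt (Model n) (TangentSpace (𝓡 n) (M := M)) x₀).continuousLinearEquivAt
      ℝ _ (mem_baseSet_of_target x₀ hy)).symm.toLinearEquiv, fun i => ?_⟩
  rw [coordFrame, coordMap_eq_symmL x₀ hy,
    ← Bundle.Trivialization.symm_continuousLinearEquivAt_eq _ (mem_baseSet_of_target x₀ hy)]
  rw [Module.Basis.map_apply, OrthonormalBasis.coe_toBasis]
  rfl

theorem continuousOn_gram (g : Metric n M) (x₀ : M) :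
    ContinuousOn (fun y => gramMatrix (g.inner ((extChartAt (𝓡 n) x₀).symm y))
      (coordFrame x₀ y)) (extChartAt (𝓡 n) x₀).target := by
  refine continuousOn_pi.2 fun i => continuousOn_pi.2 fun j => ?_
  let t := trivializationAt (Model n) (TangentSpace (𝓡 n) (M := M)) x₀
  have hsec : ∀ v : Model n, ContinuousOn
      (fun p : M => (Bundle.TotalSpace.mk' (Model n) p (t.symm p v) :
        Bundle.TotalSpace (Model n) (TangentSpace (𝓡 n) (M := M)))) t.baseSet := fun v =>
    t.continuousOn_symm.comp (f := fun p : M => (p, v)) (by fun_prop) (fun p hp => ⟨hp, trivial⟩)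
  have hg : ContinuousOn (fun p : M => g.inner p (t.symm p (EuclideanSpace.basisFun (Fin n) ℝ i))
      (t.symm p (EuclideanSpace.basisFun (Fin n) ℝ j))) t.baseSet := by
    intro p hp
    have := (g.contMDiff.continuous.continuousAt (x := p)).continuousWithinAt (s := t.baseSet)
      |>.clm_bundle_apply₂ (F₁ := Model n) (F₂ := Model n) (F₃ := ℝ)
        (E₃ := Bundle.Trivial M ℝ) (b := fun p : M => p) (hsec (EuclideanSpace.basisFun (Fin n) ℝ i) p hp)
        (hsec (EuclideanSpace.basisFun (Fin n) ℝ j) p hp)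
    simp only [FiberBundle.continuousWithinAt_totalSpace] at this
    exact this.2
  refine ((hg.comp (continuousOn_extChartAt_symm x₀)
    fun y hy => mem_baseSet_of_target x₀ hy)).congr fun y hy => ?_
  simp only [gramMatrix, Matrix.of_apply, Function.comp_apply, coordFrame,
    coordMap_eq_symmL x₀ hy]
  rw [t.symmL_apply (mem_baseSet_of_target x₀ hy), t.symmL_apply (mem_baseSet_of_target x₀ hy)]

theorem gram_det_ne_zero (g : Metric n M) (x : M)
    (b : Module.Basis (Fin n) ℝ (TangentSpace (𝓡 n) x)) :
    (gramMatrix (g.inner x) b).det ≠ 0 := by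
  intro h
  obtain ⟨v, hv, h0⟩ := Matrix.exists_mulVec_eq_zero_iff.2 h
  have hw : ∑ i, v i • b i ≠ 0 := fun hz =>
    hv (funext fun i => Fintype.linearIndependent_iff.1 b.linearIndependent v hz i)
  have hp := g.pos x _ hw
  have hz : g.inner x (∑ i, v i • b i) (∑ i, v i • b i) = ∑ i, v i *
      (Matrix.mulVec (gramMatrix (g.inner x) b) v) i := by
    simp only [map_sum, map_smul, sum_apply, smul_apply, smul_eq_mul, Matrix.mulVec, dotProduct,
      gramMatrix, Matrix.of_apply, Finset.mul_sum]
    rw [Finset.sum_comm]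
    exact Finset.sum_congr rfl fun a _ => Finset.sum_congr rfl fun c _ => by ring
  rw [hz, h0] at hp
  simp at hp

variable [SecondCountableTopology M] [MeasurableSpace M] [BorelSpace M]

theorem measurable_formNorm (g : Metric n M) {k : ℕ} {α : FormField n M k}
    (h : IsMeasurableForm α) : Measurable fun x => formNorm g x (α x) := by
  -- measurability in each chart
  have hchart : ∀ x₀ : M, Measurable ((extChartAt (𝓡 n) x₀).target.domRestrict fun y =>
      formNorm g ((extChartAt (𝓡 n) x₀).symm y) (α ((extChartAt (𝓡 n) x₀).symm y))) := by
    intro x₀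
    have heq : ((extChartAt (𝓡 n) x₀).target.domRestrict fun y =>
        formNorm g ((extChartAt (𝓡 n) x₀).symm y) (α ((extChartAt (𝓡 n) x₀).symm y))) =
        fun y : (extChartAt (𝓡 n) x₀).target => √((k.factorial : ℝ)⁻¹ *
          ∑ I : Fin k → Fin n, ∑ J : Fin k → Fin n,
          (∏ a, (gramMatrix (g.inner ((extChartAt (𝓡 n) x₀).symm y))
            (coordFrame x₀ (y : Model n)))⁻¹ (I a) (J a)) *
          (chartRep x₀ α y (fun a => EuclideanSpace.basisFun (Fin n) ℝ (I a)) *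
            chartRep x₀ α y (fun a => EuclideanSpace.basisFun (Fin n) ℝ (J a)))) := by
      funext y
      obtain ⟨e, he⟩ := exists_orthonormal_frame g ((extChartAt (𝓡 n) x₀).symm y)
      obtain ⟨b, hb⟩ := exists_coordFrame_basis x₀ y.2
      have hb' : (b : Fin n → _) = coordFrame x₀ (y : Model n) := funext hb
      rw [domRestrict_apply, formNorm, frameNormSq_basis g _ (stdFrame _) e he,
        ← frameNormSq_basis g _ b e he, hb']
      rfl
    rw [heq]
    have hG : Continuous fun y : (extChartAt (𝓡 n) x₀).target =>
        gramMatrix (g.inner ((extChartAt (𝓡 n) x₀).symm y)) (coordFrame x₀ (y : Model n)) :=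
      continuousOn_iff_continuous_domRestrict.1 (continuousOn_gram g x₀)
    have hdet : ∀ y : (extChartAt (𝓡 n) x₀).target,
        (gramMatrix (g.inner ((extChartAt (𝓡 n) x₀).symm y))
          (coordFrame x₀ (y : Model n))).det ≠ 0 := fun y => by
      obtain ⟨b, hb⟩ := exists_coordFrame_basis x₀ y.2
      have hb' : (b : Fin n → _) = coordFrame x₀ (y : Model n) := funext hb
      rw [← hb']
      exact gram_det_ne_zero g _ b
    have hGi : ∀ i j, Measurable fun y : (extChartAt (𝓡 n) x₀).target =>
        (gramMatrix (g.inner ((extChartAt (𝓡 n) x₀).symm y))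
          (coordFrame x₀ (y : Model n)))⁻¹ i j := fun i j => by
      refine Continuous.measurable ?_
      simp only [Matrix.inv_def, Ring.inverse_eq_inv', Matrix.smul_apply, smul_eq_mul]
      exact (hG.matrix_det.inv₀ hdet).mul (hG.matrix_adjugate.matrix_elem i j)
    refine Measurable.sqrt (measurable_const.mul (Finset.measurable_fun_sum _ fun I _ =>
      Finset.measurable_fun_sum _ fun J _ => ?_))
    exact (Finset.measurable_fun_prod _ fun a _ => hGi _ _).mul ((h x₀ _).mul (h x₀ _))
  -- gluing over a countable cover by chart domains
  have hsource : ∀ x₀ : M, Measurable ((extChartAt (𝓡 n) x₀).source.domRestrict fun x =>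
      formNorm g x (α x)) := by
    intro x₀
    have hm : Measurable fun x : (extChartAt (𝓡 n) x₀).source =>
        (⟨extChartAt (𝓡 n) x₀ x, (extChartAt (𝓡 n) x₀).map_source x.2⟩ :
          (extChartAt (𝓡 n) x₀).target) :=
      (continuousOn_iff_continuous_domRestrict.1
        (continuousOn_extChartAt x₀)).measurable.subtype_mk
    convert! (hchart x₀).comp hm using 1
    funext x
    simp only [domRestrict_apply, Function.comp_apply]
    rw [(extChartAt (𝓡 n) x₀).left_inv x.2]
  obtain ⟨s, hs, hcov⟩ := TopologicalSpace.countable_cover_nhds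
    (fun x : M => extChartAt_source_mem_nhds (I := 𝓡 n) x)
  intro A hA
  have : (fun x => formNorm g x (α x)) ⁻¹' A = ⋃ x₀ ∈ s,
      ((↑) : (extChartAt (𝓡 n) x₀).source → M) ''
        (((extChartAt (𝓡 n) x₀).source.domRestrict fun x => formNorm g x (α x)) ⁻¹' A) := by
    ext x
    have hx : x ∈ ⋃ x₀ ∈ s, (extChartAt (𝓡 n) x₀).source := hcov ▸ mem_univ x
    simp only [mem_iUnion] at hx ⊢
    constructor
    · intro hxA
      obtain ⟨x₀, h1, h2⟩ := hx
      exact ⟨x₀, h1, ⟨x, h2⟩, hxA, rfl⟩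
    · rintro ⟨x₀, h1, ⟨z, h2⟩, h3, rfl⟩
      exact h3
  rw [this]
  exact MeasurableSet.biUnion hs fun x₀ _ => MeasurableSet.subtype_image
    (isOpen_extChartAt_source x₀).measurableSet (hsource x₀ hA)

end Norms

/-! ## Weak exterior differentials -/

section WeakDifferential

variable {n : ℕ} {M : Type*} [TopologicalSpace M] [ChartedSpace (Model n) M]
  [IsManifold (𝓡 n) ∞ M] [MeasurableSpace M]

/-- `β` is the weak exterior differential of `α`: for all test forms `η` of complementary degree,
`∫ β ∧ η = (-1)^{k+1} ∫ α ∧ dη` (both integrals being convergent, which is automatic for the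
forms of the spaces `LpForm`). -/
def IsWeakD (g : Metric n M) (o : ManifoldOrientation n M) {k : ℕ} (α : FormField n M k)
    (β : FormField n M (k + 1)) : Prop :=
  ∀ (m : ℕ) (h : (k + 1) + m = n) (h' : k + (m + 1) = n) (η : FormField n M m), IsTestForm η →
    Integrable (wedgeDensity g o h β η) (riemannianMeasure g) ∧
    Integrable (wedgeDensity g o h' α (extD η)) (riemannianMeasure g) ∧
    wedgeIntegral g o h β η = (-1) ^ (k + 1) * wedgeIntegral g o h' α (extD η)

theorem IsWeakD.add {g : Metric n M} {o : ManifoldOrientation n M} {k : ℕ}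
    {α α' : FormField n M k} {β β' : FormField n M (k + 1)} (H : IsWeakD g o α β)
    (H' : IsWeakD g o α' β') : IsWeakD g o (α + α') (β + β') := by
  intro m h h' η hη
  obtain ⟨h1, h2, h3⟩ := H m h h' η hη
  obtain ⟨h4, h5, h6⟩ := H' m h h' η hη
  rw [wedgeIntegral, wedgeIntegral, wedgeDensity_add, wedgeDensity_add]
  refine ⟨h1.add h4, h2.add h5, ?_⟩
  rw [integral_add' h1 h4, integral_add' h2 h5, mul_add]
  exact congrArg₂ _ h3 h6

theorem IsWeakD.smul {g : Metric n M} {o : ManifoldOrientation n M} {k : ℕ} (c : ℝ)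
    {α : FormField n M k} {β : FormField n M (k + 1)} (H : IsWeakD g o α β) :
    IsWeakD g o (c • α) (c • β) := by
  intro m h h' η hη
  obtain ⟨h1, h2, h3⟩ := H m h h' η hη
  rw [wedgeIntegral, wedgeIntegral, wedgeDensity_smul, wedgeDensity_smul]
  refine ⟨h1.smul c, h2.smul c, ?_⟩
  simp only [wedgeIntegral] at h3
  have e1 := integral_const_mul (μ := riemannianMeasure g) c (wedgeDensity g o h β η)
  have e2 := integral_const_mul (μ := riemannianMeasure g) c (wedgeDensity g o h' α (extD η))
  refine e1.trans (Eq.trans ?_ (congrArg _ e2.symm))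
  rw [h3]
  ring

theorem IsWeakD.zero (g : Metric n M) (o : ManifoldOrientation n M) (k : ℕ) :
    IsWeakD g o (0 : FormField n M k) 0 := by
  intro m h h' η hη
  have e1 : ∀ {a b : ℕ} (h : a + b = n) (η : FormField n M b),
      wedgeDensity g o h (0 : FormField n M a) η = 0 := fun h η => by
    have := wedgeDensity_smul g o h 0 0 η
    simpa using this
  simp only [wedgeIntegral, e1]
  exact ⟨integrable_zero _ _ _, integrable_zero _ _ _, by simp⟩

end WeakDifferential

/-! ## Integrable forms -/

/-- An exponent in `[1, ∞]`. -/
abbrev Exponent : Type := {p : ℝ≥0∞ // 1 ≤ p}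

section Spaces

variable {n : ℕ} {M : Type*} [TopologicalSpace M] [ChartedSpace (Model n) M]
  [IsManifold (𝓡 n) ∞ M] [SecondCountableTopology M] [MeasurableSpace M] [BorelSpace M]

/-- The measurable `k`-forms `α` with `‖α‖_p < ∞`, where `‖α‖_p` is the `L^p`-norm of the function
`|α|` for the Riemannian measure. -/
def pIntegrableForms (g : Metric n M) (p : Exponent) (k : ℕ) : Submodule ℝ (FormField n M k) where
  carrier := {α | IsMeasurableForm α ∧
    eLpNorm (fun x => formNorm g x (α x)) p (riemannianMeasure g) < ⊤}
  zero_mem' := ⟨IsMeasurableForm.zero, by simp [formNorm_zero]⟩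
  add_mem' := by
    rintro α β ⟨h1, h2⟩ ⟨h3, h4⟩
    refine ⟨h1.add h3, lt_of_le_of_lt ?_ (ENNReal.add_lt_top.2 ⟨h2, h4⟩)⟩
    refine le_trans (eLpNorm_mono_real (g := fun x => formNorm g x (α x) + formNorm g x (β x))
      fun x => ?_) (eLpNorm_add_le (measurable_formNorm g h1).aestronglyMeasurable
        (measurable_formNorm g h3).aestronglyMeasurable p.2)
    rw [Real.norm_of_nonneg (formNorm_nonneg _ _ _)]
    exact formNorm_add_le _ _ _ _
  smul_mem' := by
    rintro c α ⟨h1, h2⟩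
    refine ⟨h1.smul c, ?_⟩
    have : (fun x => formNorm g x ((c • α) x)) = |c| • fun x => formNorm g x (α x) :=
      funext fun x => formNorm_smul g x c (α x)
    change eLpNorm (fun x => formNorm g x ((c • α) x)) p (riemannianMeasure g) < ⊤
    rw [this, eLpNorm_const_smul]
    exact ENNReal.mul_lt_top (by simp) h2

/-- The space of `p`-integrable `k`-forms, with the seminorm `‖·‖_p`. Forms are not identified when
they agree almost everywhere, so that `L^p(M, Λᵏ)` is the Hausdorff quotient of this space; this
identification takes place in the quotient by a closed subspace that defines any reduced
cohomology below, since a closed subspace contains all forms that vanish almost everywhere. -/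
def LpForm (g : Metric n M) (p : Exponent) (k : ℕ) : Type _ := pIntegrableForms g p k

namespace LpForm

variable {g : Metric n M} {p : Exponent} {k : ℕ}

instance : AddCommGroup (LpForm g p k) := inferInstanceAs (AddCommGroup (pIntegrableForms g p k))

instance : Module ℝ (LpForm g p k) := inferInstanceAs (Module ℝ (pIntegrableForms g p k))

/-- The underlying differential form. -/
def form (α : LpForm g p k) : FormField n M k := α.1

@[simp] theorem form_add (α β : LpForm g p k) : (α + β).form = α.form + β.form := rfl

@[simp] theorem form_smul (c : ℝ) (α : LpForm g p k) : (c • α).form = c • α.form := rfl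

@[simp] theorem form_zero : (0 : LpForm g p k).form = 0 := rfl

@[simp] theorem form_neg (α : LpForm g p k) : (-α).form = -α.form := rfl

/-- The seminorm `‖α‖_p`. -/
def seminorm (g : Metric n M) (p : Exponent) (k : ℕ) : Seminorm ℝ (LpForm g p k) :=
  Seminorm.of
    (fun α => (eLpNorm (fun x => formNorm g x (α.form x)) p (riemannianMeasure g)).toReal)
    (fun α β => by
      have hα : eLpNorm (fun x => formNorm g x (α.form x)) p (riemannianMeasure g) < ⊤ := α.2.2
      have hβ : eLpNorm (fun x => formNorm g x (β.form x)) p (riemannianMeasure g) < ⊤ := β.2.2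
      rw [← ENNReal.toReal_add hα.ne hβ.ne]
      refine ENNReal.toReal_mono (ENNReal.add_ne_top.2 ⟨hα.ne, hβ.ne⟩) ?_
      refine le_trans (eLpNorm_mono_real
        (g := fun x => formNorm g x (α.form x) + formNorm g x (β.form x))
        fun x => ?_) (eLpNorm_add_le (measurable_formNorm g α.2.1).aestronglyMeasurable
          (measurable_formNorm g β.2.1).aestronglyMeasurable p.2)
      rw [Real.norm_of_nonneg (formNorm_nonneg _ _ _)]
      exact formNorm_add_le _ _ _ _)
    (fun c α => by
      have : (fun x => formNorm g x ((c • α).form x)) = |c| • fun x => formNorm g x (α.form x) :=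
        funext fun x => formNorm_smul g x c (α.form x)
      rw [this, eLpNorm_const_smul, ENNReal.toReal_mul]
      simp)

instance : SeminormedAddCommGroup (LpForm g p k) :=
  (seminorm g p k).toAddGroupSeminorm.toSeminormedAddCommGroup

theorem norm_def (α : LpForm g p k) :
    ‖α‖ = (eLpNorm (fun x => formNorm g x (α.form x)) p (riemannianMeasure g)).toReal := rfl

instance : NormedSpace ℝ (LpForm g p k) where
  norm_smul_le c α := (map_smul_eq_mul (seminorm g p k) c α).le

end LpForm

/-! ## Spaces of forms with a weak differential -/

/-- The space `Ω_{q,p}^k` of `q`-integrable `k`-forms with a `p`-integrable weak differential, as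
the space of pairs `(α, dα)` in `L^q × L^p`; the norm of the product is equivalent to
`‖α‖_q + ‖dα‖_p`. -/
def Omega (g : Metric n M) (o : ManifoldOrientation n M) (q p : Exponent) (k : ℕ) :
    Submodule ℝ (LpForm g q k × LpForm g p (k + 1)) where
  carrier := {z | IsWeakD g o z.1.form z.2.form}
  zero_mem' := IsWeakD.zero g o k
  add_mem' h h' := IsWeakD.add h h'
  smul_mem' c _ h := IsWeakD.smul c h

/-- The space `𝒟ᵏ` of smooth forms with compact support, as a space of pairs `(η, dη)`. -/
def testPairs (g : Metric n M) (q p : Exponent) (k : ℕ) :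
    Submodule ℝ (LpForm g q k × LpForm g p (k + 1)) where
  carrier := {z | IsTestForm z.1.form ∧ z.2.form = extD z.1.form}
  zero_mem' := ⟨IsTestForm.zero, extD_zero.symm⟩
  add_mem' h h' := ⟨h.1.add h'.1, by
    rw [Prod.snd_add, Prod.fst_add, LpForm.form_add, LpForm.form_add, extD_add h.1.1 h'.1.1,
      h.2, h'.2]⟩
  smul_mem' c _ h := ⟨h.1.smul c, by
    rw [Prod.smul_snd, Prod.smul_fst, LpForm.form_smul, LpForm.form_smul, extD_smul, h.2]⟩

/-- The closure `Ω_{q,p;0}^k` of `𝒟ᵏ` in `Ω_{q,p}^k`. -/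
def Omega₀ (g : Metric n M) (o : ManifoldOrientation n M) (q p : Exponent) (k : ℕ) :
    Submodule ℝ (LpForm g q k × LpForm g p (k + 1)) :=
  Omega g o q p k ⊓ (testPairs g q p k).topologicalClosure

/-! ## `L_{q,p}`-cohomology -/

/-- The space `Z_p^k` of weakly closed forms in `L^p`. -/
def closedForms (g : Metric n M) (o : ManifoldOrientation n M) (p : Exponent) (k : ℕ) :
    Submodule ℝ (LpForm g p k) where
  carrier := {α | IsWeakD g o α.form 0}
  zero_mem' := IsWeakD.zero g o k
  add_mem' h h' := by simpa using IsWeakD.add h h'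
  smul_mem' c _ h := by simpa using IsWeakD.smul c h

/-- The space `d Ω_{q,p}^{k-1}` of weakly exact `k`-forms in `L^p` with a primitive in `L^q`;
it is `0` for `k = 0`. -/
def exactForms (g : Metric n M) (o : ManifoldOrientation n M) (q p : Exponent) :
    (k : ℕ) → Submodule ℝ (LpForm g p k)
  | 0 => ⊥
  | k + 1 => (Omega g o q p k).map (LinearMap.snd ℝ _ _)

/-- The reduced `L_{q,p}`-cohomology of `M` in degree `k`. -/
abbrev ReducedCohomology (g : Metric n M) (o : ManifoldOrientation n M) (q p : Exponent)
    (k : ℕ) : Type _ :=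
  closedForms g o p k ⧸ (exactForms g o q p k).topologicalClosure.submoduleOf (closedForms g o p k)

/-- The space `Z_{r,s;0}^k` of weakly closed forms in `Ω_{r,s;0}^k`. -/
def interiorClosedForms (g : Metric n M) (o : ManifoldOrientation n M) (r s : Exponent) (k : ℕ) :
    Submodule ℝ (LpForm g r k) :=
  (Omega₀ g o r s k).comap (LinearMap.inl ℝ _ _)

/-- The space `d 𝒟^{k-1}`, as a subspace of `L^r`; it is `0` for `k = 0`. -/
def testExactForms (g : Metric n M) (r : Exponent) : (k : ℕ) → Submodule ℝ (LpForm g r k)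
  | 0 => ⊥
  | k + 1 => (testPairs g r r k).map (LinearMap.snd ℝ _ _)

/-- The interior reduced `L_{r,s}`-cohomology of `M` in degree `k`. -/
abbrev InteriorReducedCohomology (g : Metric n M) (o : ManifoldOrientation n M) (r s : Exponent)
    (k : ℕ) : Type _ :=
  interiorClosedForms g o r s k ⧸
    (testExactForms g r k).topologicalClosure.submoduleOf (interiorClosedForms g o r s k)

/-! ## `L_π`-cohomology -/

/-- The entry `p_k` of the tuple `π = (p_0, …, p_n)`. (For `k > n`, where all `k`-forms vanish, the
value plays no role.) -/
def entry (π : Fin (n + 1) → Exponent) (k : ℕ) : Exponent := π ⟨min k n, by omega⟩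

/-- `π'` is the dual of `π`: `1 / π'_k + 1 / π_{n-k} = 1` for `0 ≤ k ≤ n`. -/
def IsDualTuple (π π' : Fin (n + 1) → Exponent) : Prop :=
  ∀ k : Fin (n + 1), ((π' k : ℝ≥0∞))⁻¹ + ((π k.rev : ℝ≥0∞))⁻¹ = 1

/-- The space of pairs of forms that contains the degree `k` part of the complexes below. -/
abbrev PairSpace (g : Metric n M) (π : Fin (n + 1) → Exponent) (k : ℕ) : Type _ :=
  LpForm g (entry π k) k × LpForm g (entry π (k + 1)) (k + 1)

/-- The Banach complex `Ω_π^*`, with the differential `(α, dα) ↦ (dα, 0)`. -/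
def OmegaPi (g : Metric n M) (o : ManifoldOrientation n M) (π : Fin (n + 1) → Exponent) (k : ℕ) :
    Submodule ℝ (PairSpace g π k) := Omega g o (entry π k) (entry π (k + 1)) k

/-- The Banach complex `Ω_{π;0}^*`, with the differential `(α, dα) ↦ (dα, 0)`. -/
def OmegaPi₀ (g : Metric n M) (o : ManifoldOrientation n M) (π : Fin (n + 1) → Exponent)
    (k : ℕ) : Submodule ℝ (PairSpace g π k) := Omega₀ g o (entry π k) (entry π (k + 1)) k

/-- The cocycles of degree `k` of a complex of pairs `(α, dα)`: the pairs `(α, 0)`. (A pair whose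
second entry vanishes almost everywhere is equivalent to such a pair.) -/
def cocycles {g : Metric n M} {π : Fin (n + 1) → Exponent}
    (C : (k : ℕ) → Submodule ℝ (PairSpace g π k)) (k : ℕ) : Submodule ℝ (PairSpace g π k) :=
  C k ⊓ LinearMap.ker (LinearMap.snd ℝ _ _)

/-- The coboundaries of degree `k` of a complex of pairs `(α, dα)`: the pairs `(dγ, 0)` with
`(γ, dγ)` in the complex. -/
def coboundaries {g : Metric n M} {π : Fin (n + 1) → Exponent}
    (C : (k : ℕ) → Submodule ℝ (PairSpace g π k)) : (k : ℕ) → Submodule ℝ (PairSpace g π k)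
  | 0 => ⊥
  | k + 1 => (C k).map (LinearMap.inl ℝ _ _ ∘ₗ LinearMap.snd ℝ _ _)

/-- The reduced cohomology in degree `k` of a complex of pairs `(α, dα)`: the cocycles modulo the
closure of the coboundaries. -/
abbrev ComplexReducedCohomology {g : Metric n M} {π : Fin (n + 1) → Exponent}
    (C : (k : ℕ) → Submodule ℝ (PairSpace g π k)) (k : ℕ) : Type _ :=
  cocycles C k ⧸ (coboundaries C k).topologicalClosure.submoduleOf (cocycles C k)

end Spaces

end

noncomputable section

/-! ## Annihilators and quotients -/
section AbstractDuality
variable {X Y : Type*} [SeminormedAddCommGroup X] [NormedSpace ℝ X]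
  [SeminormedAddCommGroup Y] [NormedSpace ℝ Y]
-- Let E = d Ω_{q,p}^{k-1} in L^p(Λ^k) and A = d 𝒟^{l-1} in L^{p'}(Λ^l), with k + l = n, paired by ∫
-- α ∧ φ. The theorem is a statement about annihilators. The pairing is perfect: each of the two
-- spaces represents all continuous functionals on the other. Moreover A^⊥ = Z_p^k and E^⊥ =
-- Z_{p',q';0}^l. For orthogonal subspaces of a perfect pairing, A^⊥ / closure E is the dual of E^⊥
-- / closure A and conversely: by Hahn–Banach an element of A^⊥ that kills E^⊥ lies in the closure
-- of E, and a functional on E^⊥ that kills A extends to the whole space, where it is represented by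
-- an element of A^⊥. This is `exists_annihilator_quotient_equiv_dual`.
--
-- The equality A^⊥ = Z_p^k is the definition of the weak differential (`mem_closedForms_iff`). The
-- equality E^⊥ = Z_{p',q';0}^l is the heart of the matter (`mem_interiorClosedForms_iff`). If γ has
-- weak differential dγ, then (u, v) ↦ ∫ dγ ∧ u - (-1)^k ∫ γ ∧ v, for γ of degree k - 1, is
-- continuous on L^{p'} × L^{q'} and vanishes at all (η, dη) with η a test form, hence at (φ, 0) for
-- φ in Z_{p',q';0}^l. Conversely, if (φ, 0) is not a limit of pairs (η, dη), a separating
-- functional is given by a pair (α, γ); its vanishing on test pairs says that α is, up to sign, the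
-- weak differential of γ. So α lies in E, and φ in E^⊥ contradicts the separation. In degree k = 0
-- there is no γ; then α is a function that annihilates all test forms of top degree, so it vanishes
-- almost everywhere (`ae_eq_zero_of_forall_isTestForm`).
--
-- Stokes' theorem for test forms (`integral_dWedgeDensity`) gives d 𝒟^{k-1} ⊆ E, from which
-- elements of E^⊥ are weakly closed; d² = 0 gives the orthogonality of E and A.
--
-- Perfectness of the pairing (`exists_representing_form`) is the scalar Riesz theorem applied to
-- coefficients. A measurable, almost orthonormal frame of the tangent bundle
-- (`exists_adaptedFrame`) turns forms into tuples of functions with equivalent norms, and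
-- nondegeneracy of the wedge product (`exists_dual_forms`) turns a functional on coefficients into
-- a form.
--
-- For a tuple π, cocycles of degree k are isometric to closed forms and coboundaries have the same
-- closure as the spaces above, with q = p_{k-1}; so the second statement is another instance of
-- `exists_reduced_duality`.
/-- A point outside the closure of a subspace is separated from it by a continuous functional. -/
theorem exists_functional_of_notMem_closure (E : Submodule ℝ X) {x : X}
    (hx : x ∉ E.topologicalClosure) :
    ∃ f : StrongDual ℝ X, (∀ a ∈ E, f a = 0) ∧ f x ≠ 0 := by
  obtain ⟨f, u, hu, hux⟩ := geometric_hahn_banach_closed_point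
    (E.topologicalClosure.convex) E.isClosed_topologicalClosure hx
  have h0 : 0 < u := by simpa using hu 0 (zero_mem _)
  refine ⟨f, fun a ha => ?_, fun h => by linarith⟩
  by_contra hne
  -- A linear functional bounded above on a subspace vanishes there: otherwise a multiple of a takes
  -- exactly the excluded value u.
  have := hu ((u / f a) • a) (E.le_topologicalClosure (E.smul_mem _ ha))
  rw [map_smul, smul_eq_mul, div_mul_cancel₀ _ hne] at this
  exact lt_irrefl _ this
theorem map_eq_zero_of_mem_closure (E : Submodule ℝ X) (f : StrongDual ℝ X)
    (hf : ∀ a ∈ E, f a = 0) {x : X} (hx : x ∈ E.topologicalClosure) : f x = 0 := by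
  have h : E ≤ LinearMap.ker (f : X →ₗ[ℝ] ℝ) := fun a ha => hf a ha
  exact Submodule.topologicalClosure_minimal E h f.isClosed_ker hx
/-- For a perfect pairing of `X` and `Y` and orthogonal subspaces `E` of `X` and `A` of `Y`, the
pairing identifies `A^⊥ / closure E` with the dual of `E^⊥ / closure A`. The annihilators are
presented as isometric images of given spaces. -/
theorem exists_annihilator_quotient_equiv_dual (B : X →L[ℝ] StrongDual ℝ Y) (C : ℝ) (hC : 0 ≤ C)
    (hY : ∀ f : StrongDual ℝ Y, ∃ x, ‖x‖ ≤ C * ‖f‖ ∧ B x = f)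
    (hX : ∀ f : StrongDual ℝ X, ∃ y, ∀ x, B x y = f x)
    (E : Submodule ℝ X) (A : Submodule ℝ Y) (hEA : ∀ x ∈ E, ∀ y ∈ A, B x y = 0)
    {Z W : Type*} [SeminormedAddCommGroup Z] [NormedSpace ℝ Z]
    [SeminormedAddCommGroup W] [NormedSpace ℝ W] (jZ : Z →ₗᵢ[ℝ] X) (jW : W →ₗᵢ[ℝ] Y)
    (hZ : ∀ x, (∃ z, jZ z = x) ↔ ∀ a ∈ A, B x a = 0)
    (hW : ∀ y, (∃ w, jW w = y) ↔ ∀ e ∈ E, B e y = 0)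
    (N : Submodule ℝ Z) (N' : Submodule ℝ W)
    (hN : ∀ z, z ∈ N ↔ jZ z ∈ E.topologicalClosure)
    (hN' : ∀ w, w ∈ N' ↔ jW w ∈ A.topologicalClosure) :
    ∃ Φ : (Z ⧸ N) ≃L[ℝ] StrongDual ℝ (W ⧸ N'), ∀ z w,
      Φ (Submodule.Quotient.mk z) (Submodule.Quotient.mk w) = B (jZ z) (jW w) := by
  have hkill : ∀ z, N' ≤ ((B (jZ z)).comp jW.toContinuousLinearMap).ker := by
    intro z w hw
    exact map_eq_zero_of_mem_closure A (B (jZ z)) ((hZ _).1 ⟨z, rfl⟩) ((hN' w).1 hw)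
  let F : Z → StrongDual ℝ (W ⧸ N') := fun z =>
    N'.liftQL ((B (jZ z)).comp jW.toContinuousLinearMap) (hkill z)
  have hF : ∀ z w, F z (Submodule.Quotient.mk w) = B (jZ z) (jW w) := fun z w => rfl
  have hext : ∀ f f' : StrongDual ℝ (W ⧸ N'),
      (∀ w, f (Submodule.Quotient.mk w) = f' (Submodule.Quotient.mk w)) → f = f' := by
    intro f f' h
    ext q
    obtain ⟨w, rfl⟩ := Submodule.Quotient.mk_surjective _ q
    exact h w
  let FL : Z →ₗ[ℝ] StrongDual ℝ (W ⧸ N') :=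
    { toFun := F
      map_add' := fun z z' => hext _ _ fun w => by
        rw [add_apply, hF, hF, hF, map_add, map_add, add_apply]
      map_smul' := fun c z => hext _ _ fun w => by
        rw [RingHom.id_apply, smul_apply, hF, hF, map_smul, map_smul,
          smul_apply] }
  have hbound : ∀ z, ‖FL z‖ ≤ ‖B‖ * ‖z‖ := by
    intro z
    refine ContinuousLinearMap.opNorm_le_bound _ (by positivity) fun q => ?_
    refine le_of_forall_pos_le_add fun ε hε => ?_
    have hpos : 0 < ‖B‖ * ‖z‖ + 1 := by positivity
    -- The quotient norm is an infimum over representatives. The tolerance is chosen so that after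
    -- multiplication by ‖B‖‖z‖ the error is at most ε; the summand 1 avoids a division by zero.
    obtain ⟨w, rfl, hw⟩ := Submodule.Quotient.norm_mk_lt q (div_pos hε hpos)
    calc ‖FL z (Submodule.Quotient.mk w)‖ = ‖B (jZ z) (jW w)‖ := by rw [← hF]; rfl
      _ ≤ ‖B‖ * ‖jZ z‖ * ‖jW w‖ := B.le_opNorm₂ _ _
      _ = ‖B‖ * ‖z‖ * ‖w‖ := by rw [jZ.norm_map, jW.norm_map]
      _ ≤ ‖B‖ * ‖z‖ * (‖(Submodule.Quotient.mk w : W ⧸ N')‖ + ε / (‖B‖ * ‖z‖ + 1)) := by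
          gcongr
      _ ≤ ‖B‖ * ‖z‖ * ‖(Submodule.Quotient.mk w : W ⧸ N')‖ + ε := by
          rw [mul_add]
          gcongr
          rw [mul_div_assoc', div_le_iff₀ hpos]
          nlinarith
  let FC : Z →L[ℝ] StrongDual ℝ (W ⧸ N') := ⟨FL, AddMonoidHomClass.continuous_of_bound FL ‖B‖ hbound⟩
  have hker : N ≤ FC.ker := by
    intro z hz
    change F z = 0
    refine hext _ _ fun w => ?_
    rw [hF, zero_apply]
    exact map_eq_zero_of_mem_closure E (B.flip (jW w))
      (fun e he => (hW _).1 ⟨w, rfl⟩ e he) ((hN z).1 hz)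
  let Φ : (Z ⧸ N) →L[ℝ] StrongDual ℝ (W ⧸ N') := N.liftQL FC hker
  have hΦ : ∀ z w, Φ (Submodule.Quotient.mk z) (Submodule.Quotient.mk w) = B (jZ z) (jW w) :=
    fun z w => rfl
  -- Bipolar argument: a functional that separates jZ z from E is represented by some y, which lies
  -- in E^⊥ and so comes from W, where z was supposed to vanish.
  have hinj : Function.Injective Φ := by
    rw [injective_iff_map_eq_zero]
    intro q hq
    obtain ⟨z, rfl⟩ := Submodule.Quotient.mk_surjective _ q
    rw [Submodule.Quotient.mk_eq_zero, hN]
    by_contra hne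
    obtain ⟨f, hf, hfz⟩ := exists_functional_of_notMem_closure E hne
    obtain ⟨y, hy⟩ := hX f
    obtain ⟨w, rfl⟩ := (hW y).2 fun e he => (hy e).trans (hf e he)
    refine hfz ?_
    rw [← hy, ← hΦ z w, hq, zero_apply]
  -- The bound on q makes the inverse continuous without the open mapping theorem, so no
  -- completeness of the spaces is needed.
  have hsurj : ∀ f : StrongDual ℝ (W ⧸ N'), ∃ q, Φ q = f ∧ ‖q‖ ≤ C * ‖f‖ := by
    intro f
    let r := jW.toLinearMap.range
    have hmem : ∀ y : r, ∃ w, jW w = y := fun y => y.2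
    choose s hs using hmem
    -- For seminorms an isometry need not be injective. Two preimages of y differ by an element that
    -- jW sends to 0, which belongs to N'.
    have hval : ∀ (w : W) (y : r), jW w = y → f (Submodule.Quotient.mk (s y)) =
        f (Submodule.Quotient.mk w) := by
      intro w y hwy
      congr 1
      rw [Submodule.Quotient.eq, hN', map_sub, hs, hwy, sub_self]
      exact zero_mem _
    let f₀ : r →ₗ[ℝ] ℝ :=
      { toFun := fun y => f (Submodule.Quotient.mk (s y))
        map_add' := fun y y' => by
          rw [hval (s y + s y') (y + y') (by rw [map_add, hs, hs]; rfl),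
            Submodule.Quotient.mk_add, map_add]
        map_smul' := fun c y => by
          rw [hval (c • s y) (c • y) (by rw [map_smul, hs]; rfl),
            Submodule.Quotient.mk_smul, map_smul, RingHom.id_apply] }
    have hf₀ : ∀ y, ‖f₀ y‖ ≤ ‖f‖ * ‖y‖ := by
      intro y
      refine (f.le_opNorm _).trans ?_
      gcongr
      refine le_trans (Submodule.Quotient.norm_mk_le N' (s y)) ?_
      rw [← jW.norm_map, hs]
      rfl
    obtain ⟨h, hh, hnorm⟩ := exists_extension_norm_eq r (f₀.mkContinuous ‖f‖ hf₀)
    obtain ⟨x, hx, hBx⟩ := hY h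
    have hw : ∀ w, h (jW w) = f (Submodule.Quotient.mk w) := fun w =>
      (hh ⟨jW w, w, rfl⟩).trans (hval w ⟨jW w, w, rfl⟩ rfl)
    -- The representing x annihilates A: by orthogonality A lies in E^⊥, where h is f on classes,
    -- and the class of an element of A is zero.
    obtain ⟨z, rfl⟩ := (hZ x).2 fun a ha => by
      obtain ⟨w, rfl⟩ := (hW a).2 fun e he => hEA e he a ha
      rw [hBx, hw, (Submodule.Quotient.mk_eq_zero _).2 ((hN' w).2 (A.le_topologicalClosure ha)),
        map_zero]
    refine ⟨Submodule.Quotient.mk z, hext _ _ fun w => by rw [hΦ, hBx, hw], ?_⟩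
    have hle : ‖h‖ ≤ ‖f‖ := hnorm.trans_le
      (LinearMap.mkContinuous_norm_le f₀ (norm_nonneg f) hf₀)
    refine (Submodule.Quotient.norm_mk_le N z).trans ?_
    rw [← jZ.norm_map]
    exact hx.trans (mul_le_mul_of_nonneg_left hle hC)
  let e : (Z ⧸ N) ≃ₗ[ℝ] StrongDual ℝ (W ⧸ N') :=
    LinearEquiv.ofBijective (Φ : (Z ⧸ N) →ₗ[ℝ] StrongDual ℝ (W ⧸ N'))
      ⟨hinj, fun f => (hsurj f).imp fun q hq => hq.1⟩
  refine ⟨⟨e, Φ.continuous, ?_⟩, hΦ⟩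
  refine AddMonoidHomClass.continuous_of_bound e.symm C fun f => ?_
  obtain ⟨q, rfl, hq⟩ := hsurj f
  change ‖e.symm (e q)‖ ≤ _
  rw [e.symm_apply_apply]
  exact hq
end AbstractDuality

/-! ## The dual of a scalar `L^p` space -/
section ScalarDual
variable {α : Type*} [MeasurableSpace α]
/-- The measurable functions in `L^p`, not identified when they agree almost everywhere. -/
def measMemLp (p : ℝ≥0∞) (μ : Measure α) : Submodule ℝ (α → ℝ) where
  carrier := {u | Measurable u ∧ MemLp u p μ}
  zero_mem' := ⟨measurable_const, MemLp.zero⟩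
  add_mem' h h' := ⟨h.1.add h'.1, h.2.add h'.2⟩
  smul_mem' c _ h := ⟨h.1.const_smul c, h.2.const_smul c⟩
/-- An additive function of measurable sets that is small on sets of small measure `ρ` is a signed
measure. -/
theorem exists_signedMeasure_of_additive (ρ : Measure α) [IsFiniteMeasure ρ] (ν : Set α → ℝ)
    (hadd : ∀ s t, MeasurableSet s → MeasurableSet t → Disjoint s t → ν (s ∪ t) = ν s + ν t)
    (b : ℝ≥0∞ → ℝ) (hb : Tendsto b (𝓝 0) (𝓝 0)) (hν : ∀ s, MeasurableSet s → |ν s| ≤ b (ρ s)) :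
    ∃ τ : SignedMeasure α, ∀ s, MeasurableSet s → τ s = ν s := by
  have h0 : ν ∅ = 0 := by
    have := hadd ∅ ∅ MeasurableSet.empty MeasurableSet.empty (disjoint_empty _)
    rw [union_empty] at this
    linarith
  classical
  refine ⟨⟨fun s => if MeasurableSet s then ν s else 0, by simp [h0], fun s hs => by simp [hs],
    fun f hf hd => ?_⟩, fun s hs => if_pos hs⟩
  have hfin : ∀ S : Finset ℕ, ν (⋃ i ∈ S, f i) = ∑ i ∈ S, ν (f i) := by
    intro S
    induction S using Finset.induction_on with
    | empty => simpa using h0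
    | insert i S hi ih =>
      rw [Finset.sum_insert hi, Finset.set_biUnion_insert, hadd _ _ (hf i)
        (S.measurableSet_biUnion fun j _ => hf j), ih]
      rw [disjoint_iUnion₂_right]
      exact fun j hj => hd fun hij => hi (hij ▸ hj)
  simp only [hf, MeasurableSet.iUnion hf, if_true]
  -- Finite additivity makes the difference between the measure of the union and a partial sum equal
  -- to ν of the tail. The tail has small ρ-measure, since the total ρ-mass is finite.
  have htail : Tendsto (fun S : Finset ℕ => ρ (⋃ i : {i // i ∉ S}, f i)) atTop (𝓝 0) := by
    have hsum : ∑' i, ρ (f i) ≠ ⊤ := by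
      rw [← measure_iUnion hd hf]
      exact measure_ne_top _ _
    refine (ENNReal.tendsto_tsum_compl_atTop_zero hsum).congr fun S => ?_
    exact (measure_iUnion (f := fun i : {i // i ∉ S} => f i)
      (fun i j hij => hd fun h => hij (Subtype.ext h)) fun i => hf i).symm
  rw [HasSum, tendsto_iff_norm_sub_tendsto_zero]
  refine squeeze_zero (fun _ => norm_nonneg _) (fun S => ?_) (hb.comp htail)
  have hm : MeasurableSet (⋃ i : {i // i ∉ S}, f i) := MeasurableSet.iUnion fun i => hf i
  have hunion : (⋃ i, f i) = (⋃ i ∈ S, f i) ∪ ⋃ i : {i // i ∉ S}, f i := by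
    ext x
    simp only [mem_iUnion, mem_union, Subtype.exists, exists_prop]
    constructor
    · rintro ⟨i, hi⟩
      by_cases hS : i ∈ S
      · exact Or.inl ⟨i, hS, hi⟩
      · exact Or.inr ⟨i, hS, hi⟩
    · rintro (⟨i, -, hi⟩ | ⟨i, -, hi⟩) <;> exact ⟨i, hi⟩
  have hdisj : Disjoint (⋃ i ∈ S, f i) (⋃ i : {i // i ∉ S}, f i) := by
    rw [disjoint_iUnion₂_left]
    intro i hi
    rw [disjoint_iUnion_right]
    exact fun j => hd fun h => j.2 (h ▸ hi)
  rw [hunion, hadd _ _ (S.measurableSet_biUnion fun j _ => hf j) hm hdisj, hfin]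
  rw [Real.norm_eq_abs, sub_add_cancel_left, abs_neg]
  exact hν _ hm
-- The function is the power 1/p of a positive integrable function, which exists by σ-finiteness. As
-- a weight it replaces μ by the finite measure w^p μ, to which indicator functions are integrable.
theorem exists_pos_measurable_memLp (μ : Measure α) [SigmaFinite μ] {p : ℝ} (hp : 0 < p) :
    ∃ w : α → ℝ, Measurable w ∧ (∀ x, 0 < w x) ∧ MemLp w (ENNReal.ofReal p) μ := by
  obtain ⟨g, hg, hgm, hgi⟩ := exists_pos_lintegral_lt_of_sigmaFinite μ one_ne_zero
  have hm : Measurable fun x => ((g x : ℝ)) ^ p⁻¹ := hgm.coe_nnreal_real.pow_const _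
  have hpos : ∀ x, 0 < ((g x : ℝ)) ^ p⁻¹ := fun x => Real.rpow_pos_of_pos (hg x) _
  refine ⟨_, hm, hpos, hm.aestronglyMeasurable, ?_⟩
  rw [eLpNorm_lt_top_iff_lintegral_rpow_enorm_lt_top (by simpa using hp) ENNReal.ofReal_ne_top,
    ENNReal.toReal_ofReal hp.le]
  refine lt_of_le_of_lt (lintegral_mono fun x => ?_) (hgi.trans ENNReal.one_lt_top)
  rw [Real.enorm_eq_ofReal (hpos x).le, ENNReal.ofReal_rpow_of_nonneg (hpos x).le hp.le,
    Real.rpow_inv_rpow (NNReal.coe_nonneg _) hp.ne', ENNReal.ofReal_coe_nnreal]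
theorem memLp_mul_of_bounded {p : ℝ≥0∞} {μ : Measure α} {w s : α → ℝ} (hw : Measurable w)
    (hwp : MemLp w p μ) (hs : Measurable s) {K : ℝ} (hK : ∀ x, |s x| ≤ K) :
    MemLp (fun x => s x * w x) p μ := by
  refine (hwp.const_mul K).mono (hs.mul hw).aestronglyMeasurable (.of_forall fun x => ?_)
  rw [norm_mul, norm_mul]
  gcongr
  exact (hK x).trans (le_abs_self K)
-- Multiplication by w is an isometry of L^p(|w|^p μ) into L^p(μ), which transports functionals to a
-- measure that is finite when w is in L^p.
theorem eLpNorm_mul_eq_withDensity {p : ℝ} (hp : 0 < p) {μ : Measure α} {w s : α → ℝ}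
    (hw : Measurable w) (hs : Measurable s) :
    eLpNorm (fun x => s x * w x) (ENNReal.ofReal p) μ =
      eLpNorm s (ENNReal.ofReal p) (μ.withDensity fun x => ‖w x‖ₑ ^ p) := by
  rw [eLpNorm_eq_lintegral_rpow_enorm_toReal (by simpa using hp) ENNReal.ofReal_ne_top,
    eLpNorm_eq_lintegral_rpow_enorm_toReal (by simpa using hp) ENNReal.ofReal_ne_top,
    ENNReal.toReal_ofReal hp.le, lintegral_withDensity_eq_lintegral_mul _
      (hw.enorm.pow_const _) (hs.enorm.pow_const _)]
  congr 1
  refine lintegral_congr fun x => ?_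
  rw [Pi.mul_apply, enorm_mul, ENNReal.mul_rpow_of_nonneg _ _ hp.le, mul_comm]
/-- A bounded functional on `L^p` has an integrable density on the multiples of a positive
function of `L^p`. -/
theorem exists_density_of_bounded_functional {μ : Measure α} [SigmaFinite μ] {p : ℝ} (hp : 1 ≤ p)
    (F : measMemLp (ENNReal.ofReal p) μ →ₗ[ℝ] ℝ) (C : ℝ)
    (hF : ∀ u, |F u| ≤ C * (eLpNorm u.1 (ENNReal.ofReal p) μ).toReal)
    {w : α → ℝ} (hw : Measurable w) (hw0 : ∀ x, 0 < w x) (hwp : MemLp w (ENNReal.ofReal p) μ) :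
    ∃ r : α → ℝ, Measurable r ∧ Integrable r μ ∧
      ∀ (u : measMemLp (ENNReal.ofReal p) μ) (K : ℝ), (∀ x, |u.1 x| ≤ K * w x) →
        F u = ∫ x, u.1 x / w x * r x ∂μ := by
  have hp0 : 0 < p := by linarith
  set ρ : Measure α := μ.withDensity fun x => ‖w x‖ₑ ^ p with hρ
  have hfin : ∫⁻ x, ‖w x‖ₑ ^ p ∂μ < ⊤ := by
    have := (eLpNorm_lt_top_iff_lintegral_rpow_enorm_lt_top (by simpa using hp0)
      ENNReal.ofReal_ne_top).1 hwp.2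
    rwa [ENNReal.toReal_ofReal hp0.le] at this
  have : IsFiniteMeasure ρ := isFiniteMeasure_withDensity hfin.ne
  classical
  -- multiples of `w`
  let m : ∀ s : α → ℝ, Measurable s → (∃ K, ∀ x, |s x| ≤ K) → measMemLp (ENNReal.ofReal p) μ :=
    fun s hs hK => ⟨fun x => s x * w x, hs.mul hw, memLp_mul_of_bounded hw hwp hs hK.choose_spec⟩
  have hm : ∀ s hs hK, |F (m s hs hK)| ≤ C * (eLpNorm s (ENNReal.ofReal p) ρ).toReal := by
    intro s hs hK
    rw [hρ, ← eLpNorm_mul_eq_withDensity hp0 hw hs]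
    exact hF _
  have hadd : ∀ s t v hs ht hv hK hK' hK'', (∀ x, v x = s x + t x) →
      F (m v hv hK'') = F (m s hs hK) + F (m t ht hK') := by
    intro s t v hs ht hv hK hK' hK'' h
    rw [← map_add]
    congr 1
    exact Subtype.ext (funext fun x => by
      change v x * w x = s x * w x + t x * w x
      rw [h, add_mul])
  have hind : ∀ s : Set α, ∃ K, ∀ x, |s.indicator (1 : α → ℝ) x| ≤ K := fun s => ⟨1, fun x => by
    by_cases hx : x ∈ s <;> simp [hx]⟩
  have hindm : ∀ s : Set α, MeasurableSet s → Measurable (s.indicator (1 : α → ℝ)) :=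
    fun s hs => measurable_one.indicator hs
  -- The set function s ↦ F(1_s w) is additive and at most C ρ(s)^{1/p} in absolute value, hence
  -- countably additive.
  let ν : Set α → ℝ := fun s => if h : MeasurableSet s then F (m _ (hindm s h) (hind s)) else 0
  have hνdef : ∀ s (h : MeasurableSet s), ν s = F (m _ (hindm s h) (hind s)) :=
    fun s h => dif_pos h
  obtain ⟨τ, hτ⟩ := exists_signedMeasure_of_additive ρ ν (by
    intro s t hs ht hd
    rw [hνdef s hs, hνdef t ht, hνdef _ (hs.union ht)]
    exact hadd _ _ _ (hindm s hs) (hindm t ht) (hindm _ (hs.union ht)) (hind s) (hind t) (hind _)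
      fun x => congrFun (indicator_union_of_disjoint hd _) x)
    (fun a => C * (a ^ p⁻¹).toReal) (by
      have h1 : Tendsto (fun a : ℝ≥0∞ => a ^ p⁻¹) (𝓝 0) (𝓝 0) := by
        have := (ENNReal.continuous_rpow_const (y := p⁻¹)).tendsto 0
        rwa [ENNReal.zero_rpow_of_pos (by positivity)] at this
      have h2 := (ENNReal.tendsto_toReal ENNReal.zero_ne_top).comp h1
      simpa using h2.const_mul C)
    (by
      intro s hs
      rw [hνdef s hs]
      refine le_trans (hm _ (hindm s hs) (hind s)) (le_of_eq ?_)
      have := eLpNorm_indicator_const (μ := ρ) (c := (1 : ℝ)) hs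
        (by simpa using hp0 : ENNReal.ofReal p ≠ 0) ENNReal.ofReal_ne_top
      change C * (eLpNorm (s.indicator fun _ => (1 : ℝ)) _ ρ).toReal = _
      rw [this, ENNReal.toReal_ofReal hp0.le, one_div]
      simp)
  -- A μ-null set makes 1_s w vanish almost everywhere, so F kills it; Radon–Nikodym then produces
  -- the density r.
  have hac : τ ≪ᵥ μ.toENNRealVectorMeasure := by
    refine VectorMeasure.AbsolutelyContinuous.mk fun s hs h0 => ?_
    rw [Measure.toENNRealVectorMeasure_apply_measurable hs] at h0
    rw [hτ s hs, hνdef s hs]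
    have : (m _ (hindm s hs) (hind s)).1 =ᵐ[μ] 0 := by
      have hns : ∀ᵐ x ∂μ, x ∉ s := measure_eq_zero_iff_ae_notMem.1 h0
      filter_upwards [hns] with x hx
      simp [m, hx]
    have h2 := hF (m _ (hindm s hs) (hind s))
    rw [eLpNorm_congr_ae this] at h2
    simpa using h2
  refine ⟨τ.rnDeriv μ, SignedMeasure.measurable_rnDeriv _ _, SignedMeasure.integrable_rnDeriv _ _,
    fun u K hK => ?_⟩
  set r := τ.rnDeriv μ with hr
  have hri : Integrable r μ := SignedMeasure.integrable_rnDeriv _ _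
  have hset : ∀ s (hs : MeasurableSet s), F (m _ (hindm s hs) (hind s)) = ∫ x in s, r x ∂μ := by
    intro s hs
    rw [← hνdef s hs, ← hτ s hs, ← withDensityᵥ_apply hri hs, hr,
      SignedMeasure.withDensityᵥ_rnDeriv_eq τ μ hac]
  have hsb : ∀ s : SimpleFunc α ℝ, ∃ K, ∀ x, |s x| ≤ K := fun s =>
    (s.exists_forall_norm_le).imp fun K h => h
  have hsimple : ∀ s : SimpleFunc α ℝ, F (m s s.measurable (hsb s)) = ∫ x, s x * r x ∂μ := by
    intro s
    induction s using SimpleFunc.induction with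
    | const c hs =>
      rename_i s
      have e1 : m _ (SimpleFunc.measurable (SimpleFunc.piecewise s hs (SimpleFunc.const α c)
          (SimpleFunc.const α 0)))
          (hsb (SimpleFunc.piecewise s hs (SimpleFunc.const α c) (SimpleFunc.const α 0))) = c • m _ (hindm s hs) (hind s) := by
        refine Subtype.ext (funext fun x => ?_)
        by_cases hx : x ∈ s <;> simp [m, hx]
      rw [e1, map_smul, hset s hs, smul_eq_mul, ← integral_const_mul, ← integral_indicator hs]
      refine integral_congr_ae (.of_forall fun x => ?_)
      by_cases hx : x ∈ s <;> simp [hx]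
    | add hd hf hg =>
      rename_i f g
      have hfi : ∀ f : SimpleFunc α ℝ, Integrable (fun x => f x * r x) μ := fun f =>
        hri.bdd_mul f.measurable.aestronglyMeasurable (.of_forall (hsb f).choose_spec)
      have : F (m _ (f + g).measurable (hsb (f + g))) =
          F (m _ f.measurable (hsb f)) + F (m _ g.measurable (hsb g)) :=
        hadd _ _ _ f.measurable g.measurable (f + g).measurable (hsb f) (hsb g) (hsb _) fun x => rfl
      rw [this, hf, hg, ← integral_add (hfi f) (hfi g)]
      refine integral_congr_ae (.of_forall fun x => ?_)
      simp [add_mul]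
  -- approximation by simple functions
  have hs : Measurable fun x => u.1 x / w x := u.2.1.div hw
  have hsK : ∀ x, |u.1 x / w x| ≤ K := fun x => by
    rw [abs_div, abs_of_pos (hw0 x), div_le_iff₀ (hw0 x)]
    exact hK x
  set s : α → ℝ := fun x => u.1 x / w x with hsdef
  have hus : u = m s hs ⟨K, hsK⟩ := Subtype.ext (funext fun x =>
    (div_mul_cancel₀ _ (hw0 x).ne').symm)
  let a : ℕ → SimpleFunc α ℝ := fun N => SimpleFunc.approxOn s hs (range s ∪ {0}) 0 (by simp) N
  have hsρ : eLpNorm s (ENNReal.ofReal p) ρ < ⊤ := by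
    rw [hρ, ← eLpNorm_mul_eq_withDensity hp0 hw hs]
    exact (m s hs ⟨K, hsK⟩).2.2.2
  -- Simple functions approximate the quotient u / w in L^p(ρ), and the bound on F is a bound in
  -- L^p(ρ).
  have hlim1 : Tendsto (fun N => F (m (a N) (a N).measurable (hsb (a N)))) atTop (𝓝 (F u)) := by
    rw [tendsto_iff_norm_sub_tendsto_zero]
    have h1 := SimpleFunc.tendsto_approxOn_range_Lp_eLpNorm (p := ENNReal.ofReal p) (μ := ρ)
      ENNReal.ofReal_ne_top hs hsρ
    have h2 := ((ENNReal.tendsto_toReal ENNReal.zero_ne_top).comp h1).const_mul C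
    simp only [ENNReal.toReal_zero, mul_zero] at h2
    refine squeeze_zero (fun _ => norm_nonneg _) (fun N => ?_) h2
    have hb : ∃ K, ∀ x, |(⇑(a N) - s) x| ≤ K := by
      obtain ⟨K', hK'⟩ := hsb (a N)
      exact ⟨K' + K, fun x => (abs_sub _ _).trans (add_le_add (hK' x) (hsK x))⟩
    refine le_trans (le_of_eq ?_) (hm (⇑(a N) - s) ((a N).measurable.sub hs) hb)
    rw [Real.norm_eq_abs, hus, ← map_sub]
    congr 2
    exact Subtype.ext (funext fun x => (sub_mul _ _ _).symm)
  have hlim2 : Tendsto (fun N => F (m (a N) (a N).measurable (hsb (a N)))) atTop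
      (𝓝 (∫ x, s x * r x ∂μ)) := by
    simp only [hsimple]
    -- The approximating simple functions are bounded by twice |s|, hence by 2K.
    refine tendsto_integral_of_dominated_convergence (fun x => (K + K) * ‖r x‖)
      (fun N => ((a N).measurable.mul (SignedMeasure.measurable_rnDeriv _ _)).aestronglyMeasurable)
      (hri.norm.const_mul _) (fun N => .of_forall fun x => ?_) (.of_forall fun x => ?_)
    · rw [norm_mul]
      gcongr
      exact (SimpleFunc.norm_approxOn_zero_le hs (by simp) x N).trans
        (add_le_add (hsK x) (hsK x))
    · exact (SimpleFunc.tendsto_approxOn hs (by simp) (subset_closure (by simp))).mul_const _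
  exact tendsto_nhds_unique hlim1 hlim2
end ScalarDual

/-! ### Riesz representation on L^p: the conjugate norm of the density -/

section ScalarDual
variable {α : Type*} [MeasurableSpace α]
/-- **Riesz representation**: a bounded functional on `L^p`, `1 < p < ∞`, is the integral against
a function of `L^q`, where `q` is the conjugate exponent. -/
theorem exists_dual_function {μ : Measure α} [SigmaFinite μ] {p q : ℝ} (hpq : p.HolderConjugate q)
    (F : measMemLp (ENNReal.ofReal p) μ →ₗ[ℝ] ℝ) (C : ℝ) (hC : 0 ≤ C)
    (hF : ∀ u, |F u| ≤ C * (eLpNorm u.1 (ENNReal.ofReal p) μ).toReal) :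
    ∃ h : α → ℝ, Measurable h ∧ eLpNorm h (ENNReal.ofReal q) μ ≤ ENNReal.ofReal C ∧
      ∀ u, F u = ∫ x, u.1 x * h x ∂μ := by
  have hp0 : 0 < p := hpq.pos
  have hq0 : 0 < q := hpq.symm.pos
  have hq1 : 0 < q - 1 := by linarith [hpq.symm.lt]
  have hpq' : (q - 1) * p = q := by rw [mul_comm, mul_sub, mul_one, hpq.mul_eq_add]; ring
  obtain ⟨w, hw, hw0, hwp⟩ := exists_pos_measurable_memLp μ hp0
  obtain ⟨r, hr, hri, hFr⟩ := exists_density_of_bounded_functional hpq.lt.le F C hF hw hw0 hwp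
  set h : α → ℝ := fun x => r x / w x with hh
  have hhm : Measurable h := hr.div hw
  have hFh : ∀ (u : measMemLp (ENNReal.ofReal p) μ) (K : ℝ), (∀ x, |u.1 x| ≤ K * w x) →
      F u = ∫ x, u.1 x * h x ∂μ := fun u K hK => by
    rw [hFr u K hK]
    refine integral_congr_ae (.of_forall fun x => ?_)
    change _ / _ * _ = _ * (_ / _)
    ring
  -- the norm of `h`
  let E : ℕ → Set α := fun N => {x | |h x| ^ (q - 1) ≤ N * w x}
  have hE : ∀ N, MeasurableSet (E N) := fun N =>
    measurableSet_le (hhm.abs.pow_const _) (hw.const_mul _)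
  have hEmono : Monotone E := fun N N' hN x hx => le_trans hx
    (mul_le_mul_of_nonneg_right (Nat.cast_le.2 hN) (hw0 x).le)
  have hEunion : ⋃ N, E N = univ := by
    refine eq_univ_of_forall fun x => mem_iUnion.2 ?_
    obtain ⟨N, hN⟩ := exists_nat_ge (|h x| ^ (q - 1) / w x)
    exact ⟨N, (div_le_iff₀ (hw0 x)).1 hN⟩
  have hI : ∀ N, ∫⁻ x in E N, ‖h x‖ₑ ^ q ∂μ ≤ ENNReal.ofReal C ^ q := by
    intro N
    -- This is the extremal function of Hölder's inequality: v h and |v|^p both equal |h|^q, as (q -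
    -- 1) p = q. On E N it is dominated by N w, which puts it in L^p and within reach of the
    -- integral formula.
    let v : α → ℝ := (E N).indicator fun x => h x * |h x| ^ (q - 2)
    have hvm : Measurable v :=
      (hhm.mul (hhm.abs.pow_const _)).indicator (hE N)
    have hsgn : ∀ y : ℝ, |y * |y| ^ (q - 2)| = |y| ^ (q - 1) := by
      intro y
      rcases eq_or_ne y 0 with rfl | hy
      · simp [Real.zero_rpow hq1.ne']
      · rw [abs_mul, abs_of_nonneg (Real.rpow_nonneg (abs_nonneg y) _),
          ← Real.rpow_one_add' (abs_nonneg _) (by linarith)]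
        ring_nf
    have hvw : ∀ x, |v x| ≤ N * w x := by
      intro x
      by_cases hx : x ∈ E N
      · simp only [v, indicator_of_mem hx, hsgn]
        exact hx
      · simp only [v, indicator_of_notMem hx, abs_zero]
        have := hw0 x
        positivity
    have hvp : MemLp v (ENNReal.ofReal p) μ := (hwp.const_mul (N : ℝ)).mono
      hvm.aestronglyMeasurable (.of_forall fun x => (hvw x).trans (le_abs_self _))
    have hvnorm : eLpNorm v (ENNReal.ofReal p) μ = (∫⁻ x in E N, ‖h x‖ₑ ^ q ∂μ) ^ (1 / p) := by
      rw [eLpNorm_eq_lintegral_rpow_enorm_toReal (by simpa using hp0) ENNReal.ofReal_ne_top,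
        ENNReal.toReal_ofReal hp0.le, ← lintegral_indicator (hE N)]
      congr 1
      refine lintegral_congr fun x => ?_
      by_cases hx : x ∈ E N
      · simp only [v, indicator_of_mem hx]
        rw [Real.enorm_eq_ofReal_abs, hsgn, Real.enorm_eq_ofReal_abs,
          ENNReal.ofReal_rpow_of_nonneg (by positivity) hp0.le,
          ENNReal.ofReal_rpow_of_nonneg (by positivity) hq0.le, ← Real.rpow_mul (abs_nonneg _),
          hpq']
      · simp [v, hx, hp0]
    set I := ∫⁻ x in E N, ‖h x‖ₑ ^ q ∂μ with hIdef
    -- Finiteness of I comes from v being in L^p and is needed before a factor I^{1/p} can be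
    -- cancelled.
    have hIfin : I ≠ ⊤ := by
      intro htop
      have := hvp.2
      rw [hvnorm, htop, ENNReal.top_rpow_of_pos (by positivity)] at this
      exact lt_irrefl _ this
    have hFv := hFh ⟨v, hvm, hvp⟩ N hvw
    have hval : ∫ x, v x * h x ∂μ = I.toReal := by
      rw [hIdef, ← lintegral_indicator (hE N),
        ← integral_toReal ((hhm.enorm.pow_const _).indicator (hE N)).aemeasurable]
      · refine integral_congr_ae (.of_forall fun x => ?_)
        by_cases hx : x ∈ E N
        · simp only [v, indicator_of_mem hx]
          rw [Real.enorm_eq_ofReal_abs, ENNReal.ofReal_rpow_of_nonneg (by positivity) hq0.le,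
            ENNReal.toReal_ofReal (by positivity), mul_right_comm, ← abs_mul_abs_self, mul_assoc,
            ← Real.rpow_one_add' (abs_nonneg _) (by linarith),
            ← Real.rpow_one_add' (abs_nonneg _) (by linarith)]
          ring_nf
        · simp [v, hx]
      · refine .of_forall fun x => ?_
        by_cases hx : x ∈ E N
        · rw [indicator_of_mem hx]
          exact ENNReal.rpow_lt_top_of_nonneg hq0.le enorm_ne_top
        · simp [hx]
    have hle := hF ⟨v, hvm, hvp⟩
    rw [hFv, hval, abs_of_nonneg ENNReal.toReal_nonneg] at hle
    change I.toReal ≤ C * (eLpNorm v _ μ).toReal at hle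
    rw [hvnorm, ← ENNReal.toReal_rpow] at hle
    rcases eq_or_ne I 0 with h0 | h0
    · rw [h0]; exact zero_le
    have hI0 : 0 < I.toReal := ENNReal.toReal_pos h0 hIfin
    rw [← ENNReal.ofReal_toReal hIfin, ENNReal.ofReal_rpow_of_nonneg hC hq0.le]
    refine ENNReal.ofReal_le_ofReal ?_
    -- The bound on F at v reads I ≤ C I^{1/p}, and 1 - 1/p = 1/q.
    have h1 : I.toReal ^ (1 / q) ≤ C := by
      have e : I.toReal = I.toReal ^ (1 / q) * I.toReal ^ (1 / p) := by
        rw [← Real.rpow_add hI0, one_div, one_div, add_comm, hpq.inv_add_inv_eq_one, Real.rpow_one]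
      rw [e] at hle
      have hpos : 0 < I.toReal ^ (1 / p) := Real.rpow_pos_of_pos hI0 _
      rw [← e] at hle
      refine le_of_mul_le_mul_right ?_ hpos
      rw [← e]
      exact hle
    calc I.toReal = (I.toReal ^ (1 / q)) ^ q := by
          rw [← Real.rpow_mul hI0.le, one_div_mul_cancel hq0.ne', Real.rpow_one]
      _ ≤ C ^ q := Real.rpow_le_rpow (Real.rpow_nonneg hI0.le _) h1 hq0.le
  have hnorm : eLpNorm h (ENNReal.ofReal q) μ ≤ ENNReal.ofReal C := by
    rw [eLpNorm_eq_lintegral_rpow_enorm_toReal (by simpa using hq0) ENNReal.ofReal_ne_top,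
      ENNReal.toReal_ofReal hq0.le, one_div, ENNReal.rpow_inv_le_iff hq0]
    -- Monotone convergence along the exhausting sets E N removes the truncation, the bound being
    -- uniform in N.
    have := setLIntegral_iUnion_of_directed (μ := μ) (fun x => ‖h x‖ₑ ^ q) (hEmono.directed_le)
    rw [hEunion, Measure.restrict_univ] at this
    rw [this]
    exact iSup_le hI
  have hhq : MemLp h (ENNReal.ofReal q) μ :=
    ⟨hhm.aestronglyMeasurable, hnorm.trans_lt ENNReal.ofReal_lt_top⟩
  refine ⟨h, hhm, hnorm, fun u => ?_⟩
  -- truncation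
  let G : ℕ → Set α := fun N => {x | |u.1 x| ≤ N * w x}
  have hG : ∀ N, MeasurableSet (G N) := fun N =>
    measurableSet_le u.2.1.abs (hw.const_mul _)
  have hGev : ∀ x, ∀ᶠ N in atTop, x ∈ G N := by
    intro x
    obtain ⟨N, hN⟩ := exists_nat_ge (|u.1 x| / w x)
    filter_upwards [eventually_ge_atTop N] with N' hN'
    rw [div_le_iff₀ (hw0 x)] at hN
    refine hN.trans ?_
    have : (N : ℝ) ≤ N' := by exact_mod_cast hN'
    have := hw0 x
    gcongr
  let v : ℕ → measMemLp (ENNReal.ofReal p) μ := fun N =>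
    ⟨(G N).indicator u.1, u.2.1.indicator (hG N), u.2.2.indicator (hG N)⟩
  have hFv : ∀ N, F (v N) = ∫ x, (G N).indicator u.1 x * h x ∂μ := fun N => by
    refine hFh (v N) N fun x => ?_
    by_cases hx : x ∈ G N
    · simp only [v, indicator_of_mem hx]
      exact hx
    · simp only [v, indicator_of_notMem hx, abs_zero]
      have := hw0 x
      positivity
  have : (ENNReal.ofReal p).HolderConjugate (ENNReal.ofReal q) :=
    hpq.ennrealOfReal
  have hui : Integrable (fun x => u.1 x * h x) μ := u.2.2.integrable_mul hhq
  have hlim1 : Tendsto (fun N => F (v N)) atTop (𝓝 (∫ x, u.1 x * h x ∂μ)) := by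
    simp only [hFv]
    refine tendsto_integral_of_dominated_convergence (fun x => ‖u.1 x * h x‖)
      (fun N => ((u.2.1.indicator (hG N)).mul hhm).aestronglyMeasurable) hui.norm
      (fun N => .of_forall fun x => ?_) (.of_forall fun x => ?_)
    · rw [norm_mul, norm_mul]
      gcongr
      exact norm_indicator_le_norm_self _ _
    · refine tendsto_const_nhds.congr' ?_
      filter_upwards [hGev x] with N hN
      rw [indicator_of_mem hN]
  have hlim2 : Tendsto (fun N => F (v N)) atTop (𝓝 (F u)) := by
    rw [tendsto_iff_norm_sub_tendsto_zero]
    -- The truncations converge to u in L^p by dominated convergence, so the bound on F carries the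
    -- formula over to u.
    have h1 : Tendsto (fun N => eLpNorm (v N - u).1 (ENNReal.ofReal p) μ) atTop (𝓝 0) := by
      simp only [eLpNorm_eq_lintegral_rpow_enorm_toReal (by simpa using hp0 :
        ENNReal.ofReal p ≠ 0) ENNReal.ofReal_ne_top, ENNReal.toReal_ofReal hp0.le]
      have hint : Tendsto (fun N => ∫⁻ x, ‖(v N - u).1 x‖ₑ ^ p ∂μ) atTop
          (𝓝 (∫⁻ _, 0 ∂μ)) := by
        refine tendsto_lintegral_of_dominated_convergence (fun x => ‖u.1 x‖ₑ ^ p)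
          (fun N => ((v N - u).2.1.enorm.pow_const _)) (fun N => .of_forall fun x => ?_) ?_
          (.of_forall fun x => ?_)
        · refine ENNReal.rpow_le_rpow ?_ hp0.le
          change ‖(G N).indicator u.1 x - u.1 x‖ₑ ≤ _
          by_cases hx : x ∈ G N <;> simp [hx]
        · have := (eLpNorm_lt_top_iff_lintegral_rpow_enorm_lt_top (by simpa using hp0)
            ENNReal.ofReal_ne_top).1 u.2.2.2
          rw [ENNReal.toReal_ofReal hp0.le] at this
          exact this.ne
        · refine tendsto_const_nhds.congr' ?_
          filter_upwards [hGev x] with N hN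
          change _ = ‖(G N).indicator u.1 x - u.1 x‖ₑ ^ p
          simp [hN, hp0]
      rw [lintegral_zero] at hint
      have := (ENNReal.continuous_rpow_const (y := 1 / p)).tendsto 0 |>.comp hint
      rwa [ENNReal.zero_rpow_of_pos (by positivity)] at this
    have h2 := ((ENNReal.tendsto_toReal ENNReal.zero_ne_top).comp h1).const_mul C
    simp only [ENNReal.toReal_zero, mul_zero] at h2
    refine squeeze_zero (fun _ => norm_nonneg _) (fun N => ?_) h2
    rw [← map_sub, Real.norm_eq_abs]
    exact hF _
  exact tendsto_nhds_unique hlim2 hlim1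
end ScalarDual

/-! ## Algebra of the wedge product -/
section WedgeAlgebra
variable {V : Type*} [AddCommGroup V] [Module ℝ V] [TopologicalSpace V] {k l n : ℕ}
/-- The identification of two blocks of `k` and `l` indices with `n = k + l` indices. -/
def blockEquiv (h : k + l = n) : Fin k ⊕ Fin l ≃ Fin n := finSumFinEquiv.trans (finCongr h)
/-- The summand of the full antisymmetrization that computes a wedge product. -/
def wedgeSummand (h : k + l = n) (α : V [⋀^Fin k]→L[ℝ] ℝ) (φ : V [⋀^Fin l]→L[ℝ] ℝ)
    (v : Fin n → V) (σ : Equiv.Perm (Fin k ⊕ Fin l)) : ℝ :=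
  α (fun a => v (blockEquiv h (σ (Sum.inl a)))) * φ (fun b => v (blockEquiv h (σ (Sum.inr b))))
-- A shuffle is a class of permutations modulo those that preserve the two blocks, so the sum over
-- all permutations counts it k! l! times. Sums over the whole group can be reindexed by
-- translations, which is how signs are computed below.
theorem factorial_mul_wedge (h : k + l = n) (α : V [⋀^Fin k]→L[ℝ] ℝ) (φ : V [⋀^Fin l]→L[ℝ] ℝ)
    (v : Fin n → V) :
    ((k.factorial : ℝ) * l.factorial) * wedge h α φ v =
      ∑ σ : Equiv.Perm (Fin k ⊕ Fin l), ((Equiv.Perm.sign σ : ℤ) : ℝ) *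
        wedgeSummand h α φ v σ := by
  have h1 := MultilinearMap.domCoprod_alternization_eq α.toAlternatingMap φ.toAlternatingMap
  have h2 := congrArg (fun A => LinearMap.mul' ℝ ℝ (A fun i => v (blockEquiv h i))) h1
  simp only [MultilinearMap.alternatization_apply, map_sum, Fintype.card_fin] at h2
  have h3 : LinearMap.mul' ℝ ℝ (((k.factorial * l.factorial) •
      α.toAlternatingMap.domCoprod φ.toAlternatingMap) fun i => v (blockEquiv h i)) =
      ((k.factorial : ℝ) * l.factorial) * wedge h α φ v := by
    rw [AlternatingMap.smul_apply, map_nsmul, nsmul_eq_mul, Nat.cast_mul]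
    rfl
  rw [← h3, ← h2]
  refine Finset.sum_congr rfl fun σ _ => ?_
  rw [Units.smul_def, ← Int.cast_smul_eq_zsmul ℝ, map_smul, smul_eq_mul]
  rfl
theorem wedge_eq_sum (h : k + l = n) (α : V [⋀^Fin k]→L[ℝ] ℝ) (φ : V [⋀^Fin l]→L[ℝ] ℝ)
    (v : Fin n → V) :
    wedge h α φ v = ((k.factorial : ℝ) * l.factorial)⁻¹ *
      ∑ σ : Equiv.Perm (Fin k ⊕ Fin l), ((Equiv.Perm.sign σ : ℤ) : ℝ) *
        wedgeSummand h α φ v σ := by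
  rw [← factorial_mul_wedge, inv_mul_cancel_left₀]
  positivity
theorem wedge_compContinuousLinearMap {V' : Type*} [AddCommGroup V'] [Module ℝ V']
    [TopologicalSpace V'] (h : k + l = n) (α : V [⋀^Fin k]→L[ℝ] ℝ) (φ : V [⋀^Fin l]→L[ℝ] ℝ)
    (L : V' →L[ℝ] V) (v : Fin n → V') :
    wedge h (α.compContinuousLinearMap L) (φ.compContinuousLinearMap L) v =
      wedge h α φ (fun i => L (v i)) := by
  rw [wedge_eq_sum, wedge_eq_sum]
  rfl
theorem wedge_add_right (h : k + l = n) (α : V [⋀^Fin k]→L[ℝ] ℝ) (φ ψ : V [⋀^Fin l]→L[ℝ] ℝ)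
    (v : Fin n → V) : wedge h α (φ + ψ) v = wedge h α φ v + wedge h α ψ v := by
  have h1 : ∀ σ, wedgeSummand h α (φ + ψ) v σ = wedgeSummand h α φ v σ + wedgeSummand h α ψ v σ :=
    fun σ => mul_add _ _ _
  simp only [wedge_eq_sum, h1, mul_add, Finset.sum_add_distrib]
theorem wedge_smul_right (h : k + l = n) (c : ℝ) (α : V [⋀^Fin k]→L[ℝ] ℝ)
    (φ : V [⋀^Fin l]→L[ℝ] ℝ) (v : Fin n → V) : wedge h α (c • φ) v = c * wedge h α φ v := by
  have h1 : ∀ σ, wedgeSummand h α (c • φ) v σ = c * wedgeSummand h α φ v σ :=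
    fun σ => mul_left_comm _ _ _
  rw [wedge_eq_sum, wedge_eq_sum, mul_left_comm]
  refine congrArg _ (Eq.trans ?_ (Finset.mul_sum _ _ _).symm)
  refine Finset.sum_congr rfl fun σ _ => ?_
  rw [h1, mul_left_comm]
/-- The sign by which the wedge product of a `k`-form and an `l`-form fails to commute. -/
def wedgeSign (k l : ℕ) : ℤˣ :=
  Equiv.Perm.sign ((Equiv.sumComm (Fin k) (Fin l)).trans
    ((blockEquiv (add_comm l k)).trans (blockEquiv (rfl : k + l = k + l)).symm))
-- Exchanging the blocks reindexes the sum over permutations. The sign is left as the sign of the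
-- exchange, because only its being ±1 matters for the duality.
theorem wedge_comm (h : k + l = n) (h' : l + k = n) (α : V [⋀^Fin k]→L[ℝ] ℝ)
    (φ : V [⋀^Fin l]→L[ℝ] ℝ) (v : Fin n → V) :
    wedge h' φ α v = ((wedgeSign k l : ℤ) : ℝ) * wedge h α φ v := by
  subst h
  rw [wedge_eq_sum, wedge_eq_sum, mul_left_comm, mul_comm (l.factorial : ℝ)]
  refine congrArg _ (Eq.trans ?_ (Finset.mul_sum _ _ _).symm)
  set π : Equiv.Perm (Fin k ⊕ Fin l) := (Equiv.sumComm (Fin k) (Fin l)).trans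
    ((blockEquiv (add_comm l k)).trans (blockEquiv (rfl : k + l = k + l)).symm) with hπ
  have hs : wedgeSign k l = Equiv.Perm.sign π := rfl
  let s := Equiv.sumComm (Fin k) (Fin l)
  refine Fintype.sum_equiv ((s.permCongr.symm).trans (Equiv.mulLeft π)) _ _ fun σ => ?_
  have e1 : Equiv.Perm.sign (((s.permCongr.symm).trans (Equiv.mulLeft π)) σ) =
      Equiv.Perm.sign π * Equiv.Perm.sign σ := by
    simp [Equiv.Perm.sign_mul]
  rw [e1, ← hs, Units.val_mul, Int.cast_mul, ← mul_assoc, ← mul_assoc, ← Int.cast_mul,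
    ← Units.val_mul, Int.units_mul_self, Units.val_one, Int.cast_one, one_mul]
  congr 1
  have e2 : ∀ i, blockEquiv (rfl : k + l = k + l)
      (((s.permCongr.symm).trans (Equiv.mulLeft π)) σ i) = blockEquiv h' (σ (s i)) := by
    intro i
    simp [π, s, blockEquiv]
  simp only [wedgeSummand, e2]
  rw [mul_comm]
  rfl
end WedgeAlgebra

/-! ### Nondegeneracy of the wedge product -/

section WedgeDuality
variable {k l n : ℕ}
/-- The standard basis vectors of `ℝⁿ`. -/
def stdVec (n : ℕ) (i : Fin n) : Model n := EuclideanSpace.basisFun (Fin n) ℝ i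
theorem stdVec_apply (i j : Fin n) : stdVec n i j = if j = i then 1 else 0 := by
  simp [stdVec, EuclideanSpace.basisFun_apply, PiLp.single_apply]
theorem alternating_eq_zero_of_stdVec {α : Model n [⋀^Fin k]→L[ℝ] ℝ}
    (h : ∀ I : Fin k → Fin n, α (fun a => stdVec n (I a)) = 0) : α = 0 := by
  apply ContinuousAlternatingMap.toAlternatingMap_injective
  refine Module.Basis.ext_alternating (EuclideanSpace.basisFun (Fin n) ℝ).toBasis fun I _ => ?_
  have := h I
  simpa [stdVec] using this
/-- The components of a form in the standard basis. -/
def stdComponents (k n : ℕ) : (Model n [⋀^Fin k]→L[ℝ] ℝ) →ₗ[ℝ] ((Fin k → Fin n) → ℝ) where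
  toFun α I := α fun a => stdVec n (I a)
  map_add' _ _ := rfl
  map_smul' _ _ := rfl
theorem stdComponents_injective : Function.Injective (stdComponents k n) := by
  rw [← LinearMap.ker_eq_bot, LinearMap.ker_eq_bot']
  exact fun α h => alternating_eq_zero_of_stdVec fun I => congrFun h I
instance finiteDimensional_alternating : FiniteDimensional ℝ (Model n [⋀^Fin k]→L[ℝ] ℝ) :=
  FiniteDimensional.of_injective _ stdComponents_injective
/-- The form `w ↦ det (w_b)_{J b'}`. -/
def minorForm (J : Fin l → Fin n) : Model n [⋀^Fin l]→L[ℝ] ℝ where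
  toMultilinearMap := (Matrix.detRowAlternating.compLinearMap
    (LinearMap.pi fun b => (EuclideanSpace.proj (J b) : Model n →L[ℝ] ℝ).toLinearMap)
      : Model n [⋀^Fin l]→ₗ[ℝ] ℝ).toMultilinearMap
  cont := by
    change Continuous fun w : Fin l → Model n => Matrix.det (Matrix.of fun b b' => w b (J b'))
    refine Continuous.matrix_det (continuous_matrix fun b b' => ?_)
    change Continuous fun w : Fin l → Model n => w b (J b')
    fun_prop
  map_eq_zero_of_eq' := AlternatingMap.map_eq_zero_of_eq' _
theorem minorForm_apply (J : Fin l → Fin n) (w : Fin l → Model n) :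
    minorForm J w = Matrix.det (Matrix.of fun b b' => w b (J b')) := rfl
theorem minorForm_stdVec (J : Fin l → Fin n) (hJ : Function.Injective J) :
    minorForm J (fun b => stdVec n (J b)) = 1 := by
  rw [minorForm_apply]
  convert! Matrix.det_one (n := Fin l) (R := ℝ) using 2
  ext b b'
  simp [stdVec_apply, Matrix.one_apply, hJ.eq_iff, eq_comm]
theorem alternating_comp_perm {V : Type*} [AddCommGroup V] [Module ℝ V] [TopologicalSpace V]
    (α : V [⋀^Fin k]→L[ℝ] ℝ) (v : Fin k → V) (τ : Equiv.Perm (Fin k)) :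
    α (fun a => v (τ a)) = ((Equiv.Perm.sign τ : ℤ) : ℝ) * α v := by
  have := α.toAlternatingMap.map_perm v τ
  rw [Units.smul_def, ← Int.cast_smul_eq_zsmul ℝ, smul_eq_mul] at this
  exact this
-- The minor form detects only the basis vectors with indices J. So σ contributes only if it has the
-- same second block as ρ, that is σ = ρ (τ ⊕ τ'); then the signs of τ and τ' cancel against those
-- of the two alternating forms. All nonzero contributions agree, and no cancellation can occur
-- between them.
theorem wedgeSummand_minorForm (h : k + l = n) (α : Model n [⋀^Fin k]→L[ℝ] ℝ)
    (ρ σ : Equiv.Perm (Fin k ⊕ Fin l)) :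
    ((Equiv.Perm.sign σ : ℤ) : ℝ) *
      wedgeSummand h α (minorForm fun b => blockEquiv h (ρ (Sum.inr b))) (stdVec n) σ = 0 ∨
    ((Equiv.Perm.sign σ : ℤ) : ℝ) *
      wedgeSummand h α (minorForm fun b => blockEquiv h (ρ (Sum.inr b))) (stdVec n) σ =
      ((Equiv.Perm.sign ρ : ℤ) : ℝ) * α fun a => stdVec n (blockEquiv h (ρ (Sum.inl a))) := by
  set J : Fin l → Fin n := fun b => blockEquiv h (ρ (Sum.inr b)) with hJdef
  have hJ : Function.Injective J := fun b b' hb =>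
    Sum.inr_injective (ρ.injective ((blockEquiv h).injective hb))
  by_cases hmem : ∀ b, ∃ b', σ (Sum.inr b) = ρ (Sum.inr b')
  · right
    have hmap : Set.MapsTo (ρ⁻¹ * σ) (Set.range (Sum.inl : Fin k → Fin k ⊕ Fin l))
        (Set.range Sum.inl) := by
      rw [Equiv.Perm.perm_mapsTo_inl_iff_mapsTo_inr]
      rintro _ ⟨b, rfl⟩
      obtain ⟨b', hb'⟩ := hmem b
      exact ⟨b', by simp [hb']⟩
    obtain ⟨⟨τ, τ'⟩, hτ⟩ := Equiv.Perm.mem_sumCongrHom_range_of_perm_mapsTo_inl hmap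
    have hσ : σ = ρ * Equiv.Perm.sumCongrHom _ _ (τ, τ') := by rw [hτ, mul_inv_cancel_left]
    have hl : ∀ a, σ (Sum.inl a) = ρ (Sum.inl (τ a)) := fun a => by simp [hσ]
    have hr : ∀ b, σ (Sum.inr b) = ρ (Sum.inr (τ' b)) := fun b => by simp [hσ]
    have hsign : Equiv.Perm.sign σ =
        Equiv.Perm.sign ρ * (Equiv.Perm.sign τ * Equiv.Perm.sign τ') := by
      rw [hσ, Equiv.Perm.sign_mul]
      simp
    simp only [wedgeSummand, hl, hr]
    rw [alternating_comp_perm α (fun a => stdVec n (blockEquiv h (ρ (Sum.inl a)))) τ,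
      alternating_comp_perm (minorForm J) (fun b => stdVec n (J b)) τ', minorForm_stdVec J hJ,
      hsign]
    have h1 : ((Equiv.Perm.sign τ : ℤ) : ℝ) * ((Equiv.Perm.sign τ : ℤ) : ℝ) = 1 := by
      rw [← Int.cast_mul, ← Units.val_mul, Int.units_mul_self]; simp
    have h2 : ((Equiv.Perm.sign τ' : ℤ) : ℝ) * ((Equiv.Perm.sign τ' : ℤ) : ℝ) = 1 := by
      rw [← Int.cast_mul, ← Units.val_mul, Int.units_mul_self]; simp
    push_cast
    linear_combination ((Equiv.Perm.sign ρ : ℤ) : ℝ) *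
      (α fun a => stdVec n (blockEquiv h (ρ (Sum.inl a)))) *
      (((Equiv.Perm.sign τ' : ℤ) : ℝ) * ((Equiv.Perm.sign τ' : ℤ) : ℝ) * h1 + h2)
  · left
    push Not at hmem
    obtain ⟨b, hb⟩ := hmem
    have : minorForm J (fun b => stdVec n (blockEquiv h (σ (Sum.inr b)))) = 0 := by
      rw [minorForm_apply]
      refine Matrix.det_eq_zero_of_row_eq_zero b fun b' => ?_
      rw [Matrix.of_apply, stdVec_apply, if_neg]
      exact fun heq => hb b' ((blockEquiv h).injective heq.symm)
    rw [wedgeSummand, this, mul_zero, mul_zero]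
-- Some component α_I is nonzero, with distinct indices; the minor on the complementary indices
-- detects it. The multi-index I is extended to a permutation ρ whose second block lists the
-- complement.
theorem exists_wedge_stdVec_ne_zero (h : k + l = n) {α : Model n [⋀^Fin k]→L[ℝ] ℝ} (hα : α ≠ 0) :
    ∃ φ : Model n [⋀^Fin l]→L[ℝ] ℝ, wedge h α φ (stdVec n) ≠ 0 := by
  obtain ⟨I, hI⟩ : ∃ I : Fin k → Fin n, α (fun a => stdVec n (I a)) ≠ 0 := by
    by_contra hc
    push Not at hc
    exact hα (alternating_eq_zero_of_stdVec hc)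
  have hinj : Function.Injective I := by
    intro a b hab
    by_contra hne
    exact hI (α.map_eq_zero_of_eq _ (by rw [hab]) hne)
  obtain ⟨ρ, hρ⟩ : ∃ ρ : Equiv.Perm (Fin k ⊕ Fin l), ∀ a, blockEquiv h (ρ (Sum.inl a)) = I a := by
    obtain ⟨ρ, hρ⟩ := Equiv.Perm.exists_extending_pair (Sum.inl : Fin k → Fin k ⊕ Fin l)
      (fun a => (blockEquiv h).symm (I a)) Sum.inl_injective
      ((blockEquiv h).symm.injective.comp hinj)
    exact ⟨ρ, fun a => by rw [hρ]; simp⟩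
  refine ⟨minorForm fun b => blockEquiv h (ρ (Sum.inr b)), fun hz => ?_⟩
  have hsum := factorial_mul_wedge h α (minorForm fun b => blockEquiv h (ρ (Sum.inr b))) (stdVec n)
  rw [hz, mul_zero] at hsum
  set t := ((Equiv.Perm.sign ρ : ℤ) : ℝ) * α fun a => stdVec n (blockEquiv h (ρ (Sum.inl a)))
    with ht
  have ht0 : t ≠ 0 := by
    simp only [ht, hρ]
    exact mul_ne_zero (by simp) hI
  -- Every summand is 0 or t, so multiplication by t makes all of them nonnegative, and the one for
  -- ρ is t² > 0.
  have hpos : 0 < ∑ σ : Equiv.Perm (Fin k ⊕ Fin l), ((Equiv.Perm.sign σ : ℤ) : ℝ) *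
      wedgeSummand h α (minorForm fun b => blockEquiv h (ρ (Sum.inr b))) (stdVec n) σ * t := by
    refine Finset.sum_pos' (fun σ _ => ?_) ⟨ρ, Finset.mem_univ _, ?_⟩
    · rcases wedgeSummand_minorForm h α ρ σ with h1 | h1
      · rw [h1, zero_mul]
      · rw [h1]
        exact mul_self_nonneg t
    · have h1 : wedgeSummand h α (minorForm fun b => blockEquiv h (ρ (Sum.inr b))) (stdVec n) ρ =
          α fun a => stdVec n (blockEquiv h (ρ (Sum.inl a))) := by
        rw [wedgeSummand, minorForm_stdVec, mul_one]
        exact fun b b' hb => Sum.inr_injective (ρ.injective ((blockEquiv h).injective hb))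
      rw [h1, ← ht]
      exact mul_self_pos.2 ht0
  rw [← Finset.sum_mul, ← hsum, zero_mul] at hpos
  exact lt_irrefl _ hpos
/-- The pairing `α ∧ φ = ⟨α, φ⟩ dx¹ ∧ ⋯ ∧ dxⁿ` of forms on `ℝⁿ`. -/
def wedgePairing (h : k + l = n) :
    (Model n [⋀^Fin k]→L[ℝ] ℝ) →ₗ[ℝ] (Model n [⋀^Fin l]→L[ℝ] ℝ) →ₗ[ℝ] ℝ :=
  LinearMap.mk₂ ℝ (fun α φ => wedge h α φ (stdVec n))
    (fun α β φ => by rw [wedge_add]; rfl) (fun c α φ => by rw [wedge_smul]; rfl)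
    (fun α φ ψ => wedge_add_right h α φ ψ _) (fun c α φ => wedge_smul_right h c α φ _)
theorem wedgePairing_apply (h : k + l = n) (α : Model n [⋀^Fin k]→L[ℝ] ℝ)
    (φ : Model n [⋀^Fin l]→L[ℝ] ℝ) : wedgePairing h α φ = wedge h α φ (stdVec n) := rfl
theorem wedgePairing_injective (h : k + l = n) : Function.Injective (wedgePairing h) := by
  rw [← LinearMap.ker_eq_bot, LinearMap.ker_eq_bot']
  intro α hα
  by_contra hne
  obtain ⟨φ, hφ⟩ := exists_wedge_stdVec_ne_zero h hne
  exact hφ (LinearMap.congr_fun hα φ)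
theorem wedgePairing_flip_injective (h : k + l = n) :
    Function.Injective (wedgePairing h).flip := by
  rw [← LinearMap.ker_eq_bot, LinearMap.ker_eq_bot']
  intro φ hφ
  by_contra hne
  have h' : l + k = n := (add_comm l k).trans h
  obtain ⟨α, hα⟩ := exists_wedge_stdVec_ne_zero h' hne
  refine hα ?_
  rw [wedge_comm h h']
  have := LinearMap.congr_fun hφ α
  rw [LinearMap.flip_apply, wedgePairing_apply] at this
  rw [this]
  simp
-- In finite dimension a pairing that is nondegenerate on both sides is perfect, so the coordinates
-- of a basis of k-forms are wedge products with suitable l-forms. These l-forms later carry the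
-- coefficients of a representing form.
theorem exists_dual_forms (h : k + l = n) :
    ∃ (N : ℕ) (a : Module.Basis (Fin N) ℝ (Model n [⋀^Fin k]→L[ℝ] ℝ))
      (c : Fin N → Model n [⋀^Fin l]→L[ℝ] ℝ), ∀ α i, wedge h α (c i) (stdVec n) = a.repr α i := by
  have hp : (wedgePairing h).IsPerfPair :=
    LinearMap.IsPerfPair.of_injective (wedgePairing_injective h) (wedgePairing_flip_injective h)
  let a := Module.finBasis ℝ (Model n [⋀^Fin k]→L[ℝ] ℝ)
  have hs : ∀ i, ∃ φ, (wedgePairing h).flip φ = a.coord i := fun i =>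
    hp.bijective_right.2 (a.coord i)
  choose c hc using hs
  exact ⟨_, a, c, fun α i => LinearMap.congr_fun (hc i) α⟩
end WedgeDuality

/-! ### The antisymmetrized form of the Leibniz rule -/

section WedgeLeibniz
variable {V : Type*} [NormedAddCommGroup V] [NormedSpace ℝ V] {k m n : ℕ}
/-- The full antisymmetrization of a function of one vector, `k` vectors and `m` vectors, where
the distinguished vector belongs to the first block. -/
def antisymSum (h : (k + 1) + m = n) (F : V → (Fin k → V) → (Fin m → V) → ℝ) (v : Fin n → V) : ℝ :=
  ∑ σ : Equiv.Perm (Fin (k + 1) ⊕ Fin m), ((Equiv.Perm.sign σ : ℤ) : ℝ) *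
    F (v (blockEquiv h (σ (Sum.inl 0)))) (fun a => v (blockEquiv h (σ (Sum.inl a.succ))))
      (fun b => v (blockEquiv h (σ (Sum.inr b))))
-- Uncurrying is an alternating sum over the k + 1 positions of the distinguished vector. A cycle
-- brings each position to the front, and its sign is the sign of the term; after translation by the
-- cycle the k + 1 sums coincide, which accounts for the quotient (k + 1)! / k!.
theorem factorial_mul_wedge_alternatizeUncurryFin_left (h : (k + 1) + m = n)
    (A : V →L[ℝ] V [⋀^Fin k]→L[ℝ] ℝ) (η : V [⋀^Fin m]→L[ℝ] ℝ) (v : Fin n → V) :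
    ((k.factorial : ℝ) * m.factorial) *
      wedge h (ContinuousAlternatingMap.alternatizeUncurryFin A) η v =
      antisymSum h (fun x y z => A x y * η z) v := by
  have h0 : (0 : ℝ) < (k + 1 : ℕ) := by positivity
  refine mul_left_cancel₀ h0.ne' ?_
  have hf : ((k + 1 : ℕ) : ℝ) * (((k.factorial : ℝ) * m.factorial) *
      wedge h (ContinuousAlternatingMap.alternatizeUncurryFin A) η v) =
      (((k + 1).factorial : ℝ) * m.factorial) *
      wedge h (ContinuousAlternatingMap.alternatizeUncurryFin A) η v := by
    rw [Nat.factorial_succ]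
    push_cast
    ring
  rw [hf, factorial_mul_wedge]
  let T : Equiv.Perm (Fin (k + 1) ⊕ Fin m) → ℝ := fun σ =>
    A (v (blockEquiv h (σ (Sum.inl 0)))) (fun a => v (blockEquiv h (σ (Sum.inl a.succ)))) *
      η (fun b => v (blockEquiv h (σ (Sum.inr b))))
  let c : Fin (k + 1) → Equiv.Perm (Fin (k + 1) ⊕ Fin m) := fun i =>
    Equiv.Perm.sumCongr i.cycleRange.symm 1
  have hc : ∀ i, ((Equiv.Perm.sign (c i) : ℤ) : ℝ) = (-1) ^ (i : ℕ) := by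
    intro i
    simp [c, Equiv.Perm.sign_sumCongr, Fin.sign_cycleRange]
  have hexp : ∀ σ, wedgeSummand h (ContinuousAlternatingMap.alternatizeUncurryFin A) η v σ =
      ∑ i, ((Equiv.Perm.sign (c i) : ℤ) : ℝ) * T (σ * c i) := by
    intro σ
    rw [wedgeSummand, ContinuousAlternatingMap.alternatizeUncurryFin_apply, Finset.sum_mul]
    refine Finset.sum_congr rfl fun i _ => ?_
    have e0 : c i (Sum.inl 0) = Sum.inl i := by simp [c]
    have e1 : ∀ a : Fin k, c i (Sum.inl a.succ) = Sum.inl (i.succAbove a) := fun a => by simp [c]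
    have e2 : ∀ b : Fin m, c i (Sum.inr b) = Sum.inr b := fun b => by simp [c]
    rw [hc]
    simp only [T, Equiv.Perm.mul_apply, e0, e1, e2]
    rw [zsmul_eq_mul, Int.cast_pow, Int.cast_neg, Int.cast_one, mul_assoc]
    rfl
  simp only [hexp, Finset.mul_sum]
  rw [Finset.sum_comm]
  have hconst : ∀ i, ∑ σ : Equiv.Perm (Fin (k + 1) ⊕ Fin m), ((Equiv.Perm.sign σ : ℤ) : ℝ) *
      (((Equiv.Perm.sign (c i) : ℤ) : ℝ) * T (σ * c i)) =
      ∑ σ, ((Equiv.Perm.sign σ : ℤ) : ℝ) * T σ := by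
    intro i
    refine Fintype.sum_equiv (Equiv.mulRight (c i)) _ _ fun σ => ?_
    rw [Equiv.coe_mulRight, Equiv.Perm.sign_mul, Units.val_mul, Int.cast_mul, mul_assoc]
  rw [Finset.sum_congr rfl fun i _ => hconst i, Finset.sum_const, Finset.card_univ,
    Fintype.card_fin, nsmul_eq_mul]
  rfl
-- The argument with cycles is the same in the second block. The sign (-1)^k is the cost of carrying
-- the distinguished vector past the k arguments of α, so that both halves of the Leibniz rule
-- become sums of one shape.
theorem factorial_mul_wedge_alternatizeUncurryFin_right (h : (k + 1) + m = n)
    (h' : k + (m + 1) = n) (α : V [⋀^Fin k]→L[ℝ] ℝ) (A : V →L[ℝ] V [⋀^Fin m]→L[ℝ] ℝ)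
    (v : Fin n → V) :
    ((k.factorial : ℝ) * m.factorial) *
      wedge h' α (ContinuousAlternatingMap.alternatizeUncurryFin A) v =
      (-1) ^ k * antisymSum h (fun x y z => α y * A x z) v := by
  have h0 : (0 : ℝ) < (m + 1 : ℕ) := by positivity
  refine mul_left_cancel₀ h0.ne' ?_
  have hf : ((m + 1 : ℕ) : ℝ) * (((k.factorial : ℝ) * m.factorial) *
      wedge h' α (ContinuousAlternatingMap.alternatizeUncurryFin A) v) =
      ((k.factorial : ℝ) * (m + 1).factorial) *
      wedge h' α (ContinuousAlternatingMap.alternatizeUncurryFin A) v := by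
    rw [Nat.factorial_succ]
    push_cast
    ring
  rw [hf, factorial_mul_wedge]
  let T : Equiv.Perm (Fin k ⊕ Fin (m + 1)) → ℝ := fun σ =>
    α (fun a => v (blockEquiv h' (σ (Sum.inl a)))) *
      A (v (blockEquiv h' (σ (Sum.inr 0)))) (fun b => v (blockEquiv h' (σ (Sum.inr b.succ))))
  let c : Fin (m + 1) → Equiv.Perm (Fin k ⊕ Fin (m + 1)) := fun i =>
    Equiv.Perm.sumCongr 1 i.cycleRange.symm
  have hc : ∀ i, ((Equiv.Perm.sign (c i) : ℤ) : ℝ) = (-1) ^ (i : ℕ) := by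
    intro i
    simp [c, Equiv.Perm.sign_sumCongr, Fin.sign_cycleRange]
  have hexp : ∀ σ, wedgeSummand h' α (ContinuousAlternatingMap.alternatizeUncurryFin A) v σ =
      ∑ i, ((Equiv.Perm.sign (c i) : ℤ) : ℝ) * T (σ * c i) := by
    intro σ
    rw [wedgeSummand, ContinuousAlternatingMap.alternatizeUncurryFin_apply, Finset.mul_sum]
    refine Finset.sum_congr rfl fun i _ => ?_
    have e0 : c i (Sum.inr 0) = Sum.inr i := by simp [c]
    have e1 : ∀ a : Fin m, c i (Sum.inr a.succ) = Sum.inr (i.succAbove a) := fun a => by simp [c]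
    have e2 : ∀ b : Fin k, c i (Sum.inl b) = Sum.inl b := fun b => by simp [c]
    rw [hc]
    simp only [T, Equiv.Perm.mul_apply, e0, e1, e2]
    rw [zsmul_eq_mul, Int.cast_pow, Int.cast_neg, Int.cast_one, mul_left_comm]
    rfl
  simp only [hexp, Finset.mul_sum]
  rw [Finset.sum_comm]
  have hconst : ∀ i, ∑ σ : Equiv.Perm (Fin k ⊕ Fin (m + 1)), ((Equiv.Perm.sign σ : ℤ) : ℝ) *
      (((Equiv.Perm.sign (c i) : ℤ) : ℝ) * T (σ * c i)) =
      ∑ σ, ((Equiv.Perm.sign σ : ℤ) : ℝ) * T σ := by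
    intro i
    refine Fintype.sum_equiv (Equiv.mulRight (c i)) _ _ fun σ => ?_
    rw [Equiv.coe_mulRight, Equiv.Perm.sign_mul, Units.val_mul, Int.cast_mul, mul_assoc]
  rw [Finset.sum_congr rfl fun i _ => hconst i, Finset.sum_const, Finset.card_univ,
    Fintype.card_fin, nsmul_eq_mul]
  congr 1
  -- move the distinguished vector from the second block to the first one
  let χ : Fin (k + 1) ⊕ Fin m ≃ Fin k ⊕ Fin (m + 1) :=
    { toFun := Sum.elim (Fin.cons (Sum.inr 0) Sum.inl) (fun b => Sum.inr b.succ)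
      invFun := Sum.elim (fun a => Sum.inl a.succ) (Fin.cons (Sum.inl 0) Sum.inr)
      left_inv := by
        rintro (i | b)
        · refine Fin.cases ?_ (fun a => ?_) i <;> simp
        · simp
      right_inv := by
        rintro (a | i)
        · simp
        · refine Fin.cases ?_ (fun a => ?_) i <;> simp }
  let π : Equiv.Perm (Fin k ⊕ Fin (m + 1)) :=
    (χ.symm.trans (blockEquiv h)).trans (blockEquiv h').symm
  have hπ : ((Equiv.Perm.sign π : ℤ) : ℝ) = (-1) ^ k := by
    have hkn : k < n := by omega
    -- Read on the n indices, the relabelling sends j to j + 1 for j < k, sends k to 0 and fixes the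
    -- rest: a cycle of length k + 1, of sign (-1)^k.
    have e : (blockEquiv h').permCongr π = Fin.cycleRange ⟨k, hkn⟩ := by
      obtain _ | N := n
      · omega
      ext j
      obtain ⟨x, rfl⟩ := (blockEquiv h').surjective j
      rw [Equiv.permCongr_apply, Equiv.symm_apply_apply]
      have e1 : blockEquiv h' (π x) = blockEquiv h (χ.symm x) := by simp [π]
      rw [e1]
      rcases x with a | i
      · have h1 : (blockEquiv h' (Sum.inl a) : Fin (N + 1)) < ⟨k, hkn⟩ := by
          rw [Fin.lt_def]; simp [blockEquiv]
        rw [Fin.cycleRange_of_lt h1]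
        have h2 : (blockEquiv h' (Sum.inl a) : Fin (N + 1)) ≠ Fin.last N := by
          rw [Ne, Fin.ext_iff]
          have := a.2
          simp [blockEquiv]
          omega
        rw [Fin.val_add_one_of_lt (Fin.lt_last_iff_ne_last.2 h2)]
        simp [χ, blockEquiv]
      · refine Fin.cases ?_ (fun b => ?_) i
        · have h1 : (blockEquiv h' (Sum.inr 0) : Fin (N + 1)) = ⟨k, hkn⟩ := by
            ext; simp [blockEquiv]
          rw [h1, Fin.cycleRange_self]
          simp [χ, blockEquiv]
        · have h1 : (⟨k, hkn⟩ : Fin (N + 1)) < blockEquiv h' (Sum.inr b.succ) := by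
            rw [Fin.lt_def]; simp [blockEquiv]
          rw [Fin.cycleRange_of_gt h1]
          simp [χ, blockEquiv]
          omega
    have := congrArg Equiv.Perm.sign e
    rw [Equiv.Perm.sign_permCongr, Fin.sign_cycleRange] at this
    rw [this]
    simp
  rw [antisymSum]
  refine Eq.symm (Eq.trans (Finset.mul_sum _ _ _) ?_)
  refine Fintype.sum_equiv (χ.permCongr.trans (Equiv.mulLeft π)) _ _ fun σ => ?_
  have e1 : Equiv.Perm.sign ((χ.permCongr.trans (Equiv.mulLeft π)) σ) =
      Equiv.Perm.sign π * Equiv.Perm.sign σ := by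
    simp [Equiv.Perm.sign_mul]
  rw [e1, Units.val_mul, Int.cast_mul, hπ, mul_assoc]
  have e2 : ∀ x, blockEquiv h' ((χ.permCongr.trans (Equiv.mulLeft π)) σ (χ x)) =
      blockEquiv h (σ x) := fun x => by simp [π]
  have e3 : χ (Sum.inl 0) = Sum.inr 0 := rfl
  have e4 : ∀ a : Fin k, χ (Sum.inl a.succ) = Sum.inl a := fun a => rfl
  have e5 : ∀ b : Fin m, χ (Sum.inr b) = Sum.inr b.succ := fun b => rfl
  simp only [T, ← e3, ← e4, ← e5, e2]
end WedgeLeibniz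

/-! ## Changes of charts -/
section Charts
variable {n : ℕ} {M : Type*} [TopologicalSpace M] [ChartedSpace (Model n) M]
-- Class C² is what the symmetry of second derivatives requires, both for d² = 0 and for d to
-- commute with pullbacks.
theorem two_le_infty : minSmoothness ℝ 2 ≤ (∞ : WithTop ℕ∞) := by
  rw [minSmoothness_of_isRCLikeNormedField]
  exact WithTop.coe_le_coe.2 le_top
/-- The change of coordinates from the chart at `x₀` to the chart at `x₁`. -/
def transition (x₀ x₁ : M) : Model n → Model n := fun y =>
  extChartAt (𝓡 n) x₁ ((extChartAt (𝓡 n) x₀).symm y)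
/-- The domain of the change of coordinates from the chart at `x₀` to the chart at `x₁`. -/
def transitionDomain (x₀ x₁ : M) : Set (Model n) :=
  (extChartAt (𝓡 n) x₀).target ∩ (extChartAt (𝓡 n) x₀).symm ⁻¹' (extChartAt (𝓡 n) x₁).source
theorem isOpen_target (x₀ : M) : IsOpen (extChartAt (𝓡 n) x₀).target :=
  isOpen_extChartAt_target x₀
theorem isOpen_transitionDomain (x₀ x₁ : M) : IsOpen (transitionDomain (n := n) x₀ x₁) :=
  (continuousOn_extChartAt_symm x₀).isOpen_inter_preimage (isOpen_target x₀)
    (isOpen_extChartAt_source x₁)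
theorem transition_mem {x₀ x₁ : M} {y : Model n} (hy : y ∈ transitionDomain x₀ x₁) :
    transition x₀ x₁ y ∈ transitionDomain x₁ x₀ := by
  refine ⟨(extChartAt (𝓡 n) x₁).map_source hy.2, ?_⟩
  rw [mem_preimage, transition, (extChartAt (𝓡 n) x₁).left_inv hy.2]
  exact (extChartAt (𝓡 n) x₀).map_target hy.1
theorem symm_transition {x₀ x₁ : M} {y : Model n} (hy : y ∈ transitionDomain x₀ x₁) :
    (extChartAt (𝓡 n) x₁).symm (transition x₀ x₁ y) = (extChartAt (𝓡 n) x₀).symm y :=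
  (extChartAt (𝓡 n) x₁).left_inv hy.2
theorem transition_transition {x₀ x₁ : M} {y : Model n} (hy : y ∈ transitionDomain x₀ x₁) :
    transition x₁ x₀ (transition x₀ x₁ y) = y := by
  rw [transition, symm_transition hy, (extChartAt (𝓡 n) x₀).right_inv hy.1]
theorem transition_injOn (x₀ x₁ : M) :
    InjOn (transition (n := n) x₀ x₁) (transitionDomain x₀ x₁) := fun y hy z hz h => by
  rw [← transition_transition hy, h, transition_transition hz]
variable [IsManifold (𝓡 n) ∞ M]
theorem contDiffOn_transition (x₀ x₁ : M) :
    ContDiffOn ℝ ∞ (transition (n := n) x₀ x₁) (transitionDomain x₀ x₁) := by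
  rw [← contMDiffOn_iff_contDiffOn]
  have h1 := contMDiffOn_extChartAt (I := 𝓡 n) (n := ∞) (x := x₁)
  rw [← extChartAt_source (𝓡 n)] at h1
  exact h1.comp ((contMDiffOn_extChartAt_symm (I := 𝓡 n) (n := ∞) x₀).mono inter_subset_left)
    fun y hy => hy.2
theorem contDiffAt_transition {x₀ x₁ : M} {y : Model n} (hy : y ∈ transitionDomain x₀ x₁) :
    ContDiffAt ℝ ∞ (transition x₀ x₁) y :=
  (contDiffOn_transition x₀ x₁).contDiffAt ((isOpen_transitionDomain x₀ x₁).mem_nhds hy)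
theorem mdifferentiableAt_chart_symm (x₀ : M) {y : Model n}
    (hy : y ∈ (extChartAt (𝓡 n) x₀).target) :
    MDifferentiableAt 𝓘(ℝ, Model n) (𝓡 n) (extChartAt (𝓡 n) x₀).symm y :=
  ((contMDiffOn_extChartAt_symm (I := 𝓡 n) (n := ∞) x₀).contMDiffAt
    ((isOpen_target x₀).mem_nhds hy)).mdifferentiableAt (by simp)
theorem coordMap_eq_comp {x₀ x₁ : M} {y : Model n} (hy : y ∈ transitionDomain x₀ x₁) :
    (coordMap x₀ y : Model n →L[ℝ] Model n) =
      (coordMap x₁ (transition x₀ x₁ y) : Model n →L[ℝ] Model n).comp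
        (fderiv ℝ (transition x₀ x₁) y) := by
  have h1 : (extChartAt (𝓡 n) x₀).symm =ᶠ[𝓝 y]
      (extChartAt (𝓡 n) x₁).symm ∘ transition x₀ x₁ := by
    filter_upwards [(isOpen_transitionDomain x₀ x₁).mem_nhds hy] with z hz
    exact (symm_transition hz).symm
  have h2 := h1.mfderiv_eq (I := 𝓘(ℝ, Model n)) (I' := 𝓡 n)
  have h3 := mfderiv_comp (I := 𝓘(ℝ, Model n)) (I' := 𝓘(ℝ, Model n)) (I'' := 𝓡 n) y
    (mdifferentiableAt_chart_symm x₁ (transition_mem hy).1)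
    ((contDiffAt_transition hy).differentiableAt (by simp)).mdifferentiableAt
  rw [mfderiv_eq_fderiv] at h3
  exact h2.trans h3
/-- The derivative at `x` of the chart at `x₀`. -/
def chartDeriv (x₀ x : M) : Model n →L[ℝ] Model n :=
  mfderiv (𝓡 n) 𝓘(ℝ, Model n) (extChartAt (𝓡 n) x₀) x
theorem chartDeriv_comp_coordMap {x₀ x₁ : M} {y : Model n} (hy : y ∈ transitionDomain x₀ x₁) :
    (chartDeriv x₁ ((extChartAt (𝓡 n) x₀).symm y)).comp
      (coordMap x₀ y : Model n →L[ℝ] Model n) = fderiv ℝ (transition x₀ x₁) y := by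
  have hs : (extChartAt (𝓡 n) x₀).symm y ∈ (chartAt (Model n) x₁).source := by
    rw [← extChartAt_source (𝓡 n)]
    exact hy.2
  have h3 := mfderiv_comp (I := 𝓘(ℝ, Model n)) (I' := 𝓡 n) (I'' := 𝓘(ℝ, Model n)) y
    (g := extChartAt (𝓡 n) x₁)
    ((contMDiffAt_extChartAt' (I := 𝓡 n) (n := ∞) hs).mdifferentiableAt (by simp))
    (mdifferentiableAt_chart_symm x₀ hy.1)
  rw [mfderiv_eq_fderiv] at h3
  exact h3.symm
theorem chartDeriv_comp_coordMap_self {x₀ : M} {y : Model n}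
    (hy : y ∈ (extChartAt (𝓡 n) x₀).target) :
    (chartDeriv x₀ ((extChartAt (𝓡 n) x₀).symm y)).comp
      (coordMap x₀ y : Model n →L[ℝ] Model n) = ContinuousLinearMap.id ℝ (Model n) := by
  rw [chartDeriv_comp_coordMap (x₁ := x₀) ⟨hy, (extChartAt (𝓡 n) x₀).map_target hy⟩]
  have : transition x₀ x₀ =ᶠ[𝓝 y] id := by
    filter_upwards [(isOpen_target x₀).mem_nhds hy] with z hz
    exact (extChartAt (𝓡 n) x₀).right_inv hz
  rw [this.fderiv_eq, fderiv_id]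
-- A one-sided inverse of an endomorphism of a finite-dimensional space is two-sided.
theorem coordMap_comp_chartDeriv_self {x₀ : M} {y : Model n}
    (hy : y ∈ (extChartAt (𝓡 n) x₀).target) :
    (coordMap x₀ y : Model n →L[ℝ] Model n).comp
      (chartDeriv x₀ ((extChartAt (𝓡 n) x₀).symm y)) = ContinuousLinearMap.id ℝ (Model n) := by
  have h : (chartDeriv x₀ ((extChartAt (𝓡 n) x₀).symm y)).toLinearMap ∘ₗ
      (coordMap x₀ y : Model n →L[ℝ] Model n).toLinearMap = LinearMap.id :=
    LinearMap.ext fun v => congrArg (fun L : Model n →L[ℝ] Model n => L v)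
      (chartDeriv_comp_coordMap_self hy)
  ext1 v
  exact congrArg (fun L : Model n →ₗ[ℝ] Model n => L v) ((LinearMap.comp_eq_id_comm ℝ (Model n)).1 h)
/-- The coordinate expressions of a form in two charts are related by pullback. -/
theorem chartRep_eq_pullback {k : ℕ} (α : FormField n M k) {x₀ x₁ : M} {y : Model n}
    (hy : y ∈ transitionDomain x₀ x₁) :
    chartRep x₀ α y = (chartRep x₁ α (transition x₀ x₁ y)).compContinuousLinearMap
      (fderiv ℝ (transition x₀ x₁) y) := by
  let β : M → Model n [⋀^Fin k]→L[ℝ] ℝ := α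
  have h1 : chartRep x₀ α y = (β ((extChartAt (𝓡 n) x₀).symm y)).compContinuousLinearMap
      (coordMap x₀ y : Model n →L[ℝ] Model n) := rfl
  have h2 : chartRep x₁ α (transition x₀ x₁ y) =
      (β ((extChartAt (𝓡 n) x₁).symm (transition x₀ x₁ y))).compContinuousLinearMap
      (coordMap x₁ (transition x₀ x₁ y) : Model n →L[ℝ] Model n) := rfl
  rw [h1, h2, symm_transition hy, coordMap_eq_comp hy]
  rfl
/-- The coordinate expression of the exterior differential, in any chart. -/
theorem chartRep_extD {k : ℕ} {α : FormField n M k} (hα : IsSmoothForm α) (x₀ : M) {y : Model n}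
    (hy : y ∈ (extChartAt (𝓡 n) x₀).target) :
    chartRep x₀ (extD α) y = extDeriv (chartRep x₀ α) y := by
  set x := (extChartAt (𝓡 n) x₀).symm y with hx
  have hyD : y ∈ transitionDomain x₀ x := ⟨hy, mem_extChartAt_source x⟩
  have h1 : chartRep x₀ (extD α) y = (extDeriv (chartRep x α)
      (transition x₀ x y)).compContinuousLinearMap
      ((chartDeriv x x).comp (coordMap x₀ y : Model n →L[ℝ] Model n)) := rfl
  rw [h1, chartDeriv_comp_coordMap hyD]
  have hd : DifferentiableAt ℝ (chartRep x α) (transition x₀ x y) :=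
    ((hα x).contDiffAt ((isOpen_target x).mem_nhds (transition_mem hyD).1)).differentiableAt
      (by simp)
  -- The differential at a point is defined in the preferred chart of that point; naturality under
  -- the change of coordinates moves it to the chart at x₀.
  rw [← extDeriv_pullback (r := ∞) hd (contDiffAt_transition hyD) two_le_infty]
  refine Filter.EventuallyEq.extDeriv_eq ?_
  filter_upwards [(isOpen_transitionDomain x₀ x).mem_nhds hyD] with z hz
  exact (chartRep_eq_pullback α hz).symm
theorem IsSmoothForm.extD {k : ℕ} {α : FormField n M k} (hα : IsSmoothForm α) :
    IsSmoothForm (extD α) := by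
  intro x₀
  have h : ContDiffOn ℝ ∞ (extDeriv (chartRep x₀ α)) (extChartAt (𝓡 n) x₀).target := by
    have h1 : ContDiffOn ℝ ∞ (fderiv ℝ (chartRep x₀ α)) (extChartAt (𝓡 n) x₀).target :=
      (hα x₀).fderiv_of_isOpen (isOpen_target x₀) (by simp)
    exact (ContinuousAlternatingMap.alternatizeUncurryFinCLM ℝ (Model n) ℝ).contDiff.comp_contDiffOn h1
  exact h.congr fun y hy => chartRep_extD hα x₀ hy
-- The coordinate map at a point is invertible, so pulling back by it loses nothing; pointwise
-- identities may be checked in any one chart.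
theorem chartRep_apply_chart {k : ℕ} (α : FormField n M k) (x : M) :
    ∀ x₀ : M, x ∈ (extChartAt (𝓡 n) x₀).source →
      (chartRep x₀ α (extChartAt (𝓡 n) x₀ x) = 0 ↔ α x = 0) := by
  intro x₀ hx
  let β : M → Model n [⋀^Fin k]→L[ℝ] ℝ := α
  have hy := (extChartAt (𝓡 n) x₀).map_source hx
  have h1 : chartRep x₀ α (extChartAt (𝓡 n) x₀ x) =
      (β ((extChartAt (𝓡 n) x₀).symm (extChartAt (𝓡 n) x₀ x))).compContinuousLinearMap
      (coordMap x₀ (extChartAt (𝓡 n) x₀ x) : Model n →L[ℝ] Model n) := rfl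
  have h2 := coordMap_comp_chartDeriv_self hy
  rw [(extChartAt (𝓡 n) x₀).left_inv hx] at h1 h2
  change _ ↔ β x = 0
  constructor
  · intro h
    rw [h1] at h
    ext v
    have h3 := congrArg (fun γ => γ fun i => chartDeriv x₀ x (v i)) h
    have h4 : ∀ w, coordMap x₀ (extChartAt (𝓡 n) x₀ x) (chartDeriv x₀ x w) = w := fun w =>
      congrArg (fun L : Model n →L[ℝ] Model n => L w) h2
    refine Eq.trans ?_ h3
    exact congrArg (β x) (funext fun i => (h4 (v i)).symm)
  · intro h
    rw [h1, h]
    rfl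
theorem ne_zero_mem_of_extD {k : ℕ} (α : FormField n M k) :
    {x | extD α x ≠ 0} ⊆ closure {x | α x ≠ 0} := by
  intro x hx
  by_contra hc
  refine hx ?_
  have hev : ∀ᶠ z in 𝓝 x, α z = 0 := by
    filter_upwards [isClosed_closure.isOpen_compl.mem_nhds hc] with z hz
    by_contra h
    exact hz (subset_closure h)
  have hcont : ContinuousAt (extChartAt (𝓡 n) x).symm (extChartAt (𝓡 n) x x) :=
    continuousAt_extChartAt_symm x
  have hev' : chartRep x α =ᶠ[𝓝 (extChartAt (𝓡 n) x x)] 0 := by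
    have h1 : Tendsto (extChartAt (𝓡 n) x).symm (𝓝 (extChartAt (𝓡 n) x x)) (𝓝 x) := by
      have := hcont.tendsto
      rwa [extChartAt_to_inv] at this
    filter_upwards [h1.eventually hev] with y hy
    rw [chartRep, hy]
    rfl
  rw [extD, hev'.extDeriv_eq]
  have : extDeriv (0 : Model n → Model n [⋀^Fin k]→L[ℝ] ℝ) (extChartAt (𝓡 n) x x) = 0 := by
    have h := extDeriv_smul (x := extChartAt (𝓡 n) x x) (0 : ℝ)
      (0 : Model n → Model n [⋀^Fin k]→L[ℝ] ℝ)
    simpa using h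
  rw [this]
  rfl
theorem IsTestForm.extD {k : ℕ} {α : FormField n M k} (hα : IsTestForm α) :
    IsTestForm (extD α) :=
  ⟨hα.1.extD, hα.2.of_isClosed_subset isClosed_closure
    (closure_minimal (ne_zero_mem_of_extD α) isClosed_closure)⟩
theorem extD_extD {k : ℕ} {α : FormField n M k} (hα : IsSmoothForm α) :
    extD (extD α) = 0 := by
  funext x
  have hy := mem_extChartAt_target (I := 𝓡 n) x
  refine (chartRep_apply_chart (extD (extD α)) x x (mem_extChartAt_source x)).1 ?_
  rw [chartRep_extD hα.extD x hy]
  have : chartRep x (extD α) =ᶠ[𝓝 (extChartAt (𝓡 n) x x)] extDeriv (chartRep x α) := by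
    filter_upwards [(isOpen_target x).mem_nhds hy] with z hz
    exact chartRep_extD hα x hz
  rw [this.extDeriv_eq]
  exact extDeriv_extDeriv_apply ((hα x).contDiffAt ((isOpen_target x).mem_nhds hy)) two_le_infty
/-- The product of a form and a function. -/
def mulForm {k : ℕ} (ρ : M → ℝ) (α : FormField n M k) : FormField n M k := fun x => ρ x • α x
theorem chartRep_mulForm {k : ℕ} (ρ : M → ℝ) (α : FormField n M k) (x₀ : M) (y : Model n) :
    chartRep x₀ (mulForm ρ α) y = ρ ((extChartAt (𝓡 n) x₀).symm y) • chartRep x₀ α y := rfl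
theorem IsSmoothForm.mulForm {k : ℕ} {ρ : M → ℝ} (hρ : ContMDiff (𝓡 n) 𝓘(ℝ, ℝ) ∞ ρ)
    {α : FormField n M k} (hα : IsSmoothForm α) : IsSmoothForm (mulForm ρ α) := by
  intro x₀
  have h1 : ContDiffOn ℝ ∞ (ρ ∘ (extChartAt (𝓡 n) x₀).symm) (extChartAt (𝓡 n) x₀).target := by
    rw [← contMDiffOn_iff_contDiffOn]
    exact hρ.comp_contMDiffOn (contMDiffOn_extChartAt_symm x₀)
  exact h1.smul (hα x₀)
end Charts

/-! ## The Riemannian measure -/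
section RiemannianMeasure
/-- The Gram matrix after a linear change of frame. -/
theorem gramMatrix_comp {V : Type*} [AddCommGroup V] [Module ℝ V] [TopologicalSpace V] {n : ℕ}
    (B : V →L[ℝ] V →L[ℝ] ℝ) (L : Model n →ₗ[ℝ] V) (T : Model n →ₗ[ℝ] Model n) :
    (gramMatrix B fun i => L (T (EuclideanSpace.basisFun (Fin n) ℝ i))) =
      (LinearMap.toMatrix (EuclideanSpace.basisFun (Fin n) ℝ).toBasis
        (EuclideanSpace.basisFun (Fin n) ℝ).toBasis T).transpose *
        ((gramMatrix B fun i => L (EuclideanSpace.basisFun (Fin n) ℝ i)) *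
          LinearMap.toMatrix (EuclideanSpace.basisFun (Fin n) ℝ).toBasis
            (EuclideanSpace.basisFun (Fin n) ℝ).toBasis T) := by
  set e := (EuclideanSpace.basisFun (Fin n) ℝ).toBasis with he
  have hT : ∀ i, T (e i) = ∑ j, LinearMap.toMatrix e e T j i • e j := fun i => by
    conv_lhs => rw [← e.sum_repr (T (e i))]
    exact Finset.sum_congr rfl fun j _ => by rw [LinearMap.toMatrix_apply]
  have he' : ∀ i, EuclideanSpace.basisFun (Fin n) ℝ i = e i := fun i => by
    rw [he, OrthonormalBasis.coe_toBasis]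
  ext i j
  simp only [Matrix.mul_apply, Matrix.transpose_apply, gramMatrix, Matrix.of_apply, he', hT,
    map_sum, map_smul, sum_apply, smul_apply, smul_eq_mul, Finset.mul_sum]
  rw [Finset.sum_comm]
  refine Finset.sum_congr rfl fun a _ => Finset.sum_congr rfl fun c _ => by ring
/-- The determinant of the Gram matrix after a linear change of frame. -/
theorem gramMatrix_comp_det {V : Type*} [AddCommGroup V] [Module ℝ V] [TopologicalSpace V] {n : ℕ}
    (B : V →L[ℝ] V →L[ℝ] ℝ) (L : Model n →ₗ[ℝ] V) (T : Model n →ₗ[ℝ] Model n) :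
    (gramMatrix B fun i => L (T (EuclideanSpace.basisFun (Fin n) ℝ i))).det =
      LinearMap.det T ^ 2 *
        (gramMatrix B fun i => L (EuclideanSpace.basisFun (Fin n) ℝ i)).det := by
  rw [gramMatrix_comp, Matrix.det_mul, Matrix.det_mul, Matrix.det_transpose, LinearMap.det_toMatrix]
  ring
variable {n : ℕ} {M : Type*} [TopologicalSpace M] [ChartedSpace (Model n) M]
  [IsManifold (𝓡 n) ∞ M]
/-- The density of the Riemannian measure in the chart at `x₀`. -/
def volDensity (g : Metric n M) (x₀ : M) (y : Model n) : ℝ :=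
  √(gramMatrix (g.inner ((extChartAt (𝓡 n) x₀).symm y)) (coordFrame x₀ y)).det
theorem continuousOn_volDensity (g : Metric n M) (x₀ : M) :
    ContinuousOn (volDensity g x₀) (extChartAt (𝓡 n) x₀).target :=
  Real.continuous_sqrt.comp_continuousOn
    ((Continuous.matrix_det continuous_id).comp_continuousOn (continuousOn_gram g x₀))
theorem volDensity_nonneg (g : Metric n M) (x₀ : M) (y : Model n) : 0 ≤ volDensity g x₀ y :=
  Real.sqrt_nonneg _
-- The Gram determinant is multiplied by the square of the Jacobian determinant, its square root by
-- the absolute value.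
theorem volDensity_transition (g : Metric n M) {x₀ x₁ : M} {y : Model n}
    (hy : y ∈ transitionDomain x₀ x₁) :
    volDensity g x₀ y =
      |(fderiv ℝ (transition x₀ x₁) y).det| * volDensity g x₁ (transition x₀ x₁ y) := by
  let G : M → Model n →L[ℝ] Model n →L[ℝ] ℝ := fun x => g.inner x
  have h0 : volDensity g x₀ y = √(gramMatrix (G ((extChartAt (𝓡 n) x₀).symm y)) fun i =>
      (coordMap x₀ y : Model n →L[ℝ] Model n) (EuclideanSpace.basisFun (Fin n) ℝ i)).det := rfl
  have h1 : volDensity g x₁ (transition x₀ x₁ y) =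
      √(gramMatrix (G ((extChartAt (𝓡 n) x₁).symm (transition x₀ x₁ y))) fun i =>
      (coordMap x₁ (transition x₀ x₁ y) : Model n →L[ℝ] Model n)
        (EuclideanSpace.basisFun (Fin n) ℝ i)).det := rfl
  rw [h0, h1, symm_transition hy, coordMap_eq_comp hy]
  have := gramMatrix_comp_det (G ((extChartAt (𝓡 n) x₀).symm y))
    (coordMap x₁ (transition x₀ x₁ y) : Model n →L[ℝ] Model n).toLinearMap
    (fderiv ℝ (transition x₀ x₁) y).toLinearMap
  have h2 := congrArg Real.sqrt this
  rw [Real.sqrt_mul (sq_nonneg _), Real.sqrt_sq_eq_abs] at h2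
  exact h2
variable [MeasurableSpace M] [BorelSpace M]
theorem aemeasurable_chart_symm (x₀ : M) :
    AEMeasurable (extChartAt (𝓡 n) x₀).symm
      (volume.restrict (extChartAt (𝓡 n) x₀).target) :=
  (continuousOn_extChartAt_symm x₀).aemeasurable (isOpen_target x₀).measurableSet
theorem aemeasurable_volDensity (g : Metric n M) (x₀ : M) :
    AEMeasurable (volDensity g x₀) (volume.restrict (extChartAt (𝓡 n) x₀).target) :=
  (continuousOn_volDensity g x₀).aemeasurable (isOpen_target x₀).measurableSet
theorem lintegral_chartMeasure (g : Metric n M) (x₀ : M) {f : M → ℝ≥0∞} (hf : Measurable f) :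
    ∫⁻ x, f x ∂chartMeasure g x₀ = ∫⁻ y in (extChartAt (𝓡 n) x₀).target,
      ENNReal.ofReal (volDensity g x₀ y) * f ((extChartAt (𝓡 n) x₀).symm y) := by
  have hd := (aemeasurable_volDensity g x₀).ennreal_ofReal
  have h1 := (aemeasurable_chart_symm (n := n) x₀)
  rw [chartMeasure, lintegral_map' hf.aemeasurable
    (h1.mono_ac (withDensity_absolutelyContinuous _ _))]
  exact lintegral_withDensity_eq_lintegral_mul₀ hd (hf.comp_aemeasurable h1)
theorem lintegral_chartMeasure_source (g : Metric n M) (x₀ x₁ : M) {f : M → ℝ≥0∞}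
    (hf : Measurable f) :
    ∫⁻ x in (extChartAt (𝓡 n) x₁).source, f x ∂chartMeasure g x₀ =
      ∫⁻ y in transitionDomain x₀ x₁,
      ENNReal.ofReal (volDensity g x₀ y) * f ((extChartAt (𝓡 n) x₀).symm y) := by
  have hs := (isOpen_extChartAt_source (I := 𝓡 n) x₁).measurableSet
  have hD := (isOpen_transitionDomain (n := n) x₀ x₁).measurableSet
  have ht := (isOpen_target (n := n) x₀).measurableSet
  rw [← lintegral_indicator hs, lintegral_chartMeasure g x₀ (hf.indicator hs),
    ← lintegral_indicator ht, ← lintegral_indicator hD]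
  refine lintegral_congr fun y => ?_
  by_cases h1 : y ∈ (extChartAt (𝓡 n) x₀).target
  · by_cases h2 : (extChartAt (𝓡 n) x₀).symm y ∈ (extChartAt (𝓡 n) x₁).source
    · rw [indicator_of_mem h1, indicator_of_mem h2,
        indicator_of_mem (show y ∈ transitionDomain x₀ x₁ from ⟨h1, h2⟩)]
    · rw [indicator_of_mem h1, indicator_of_notMem h2,
        indicator_of_notMem (show y ∉ transitionDomain x₀ x₁ from fun h => h2 h.2), mul_zero]
  · rw [indicator_of_notMem h1,
      indicator_of_notMem (show y ∉ transitionDomain x₀ x₁ from fun h => h1 h.1)]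
-- In the change of variables formula the Jacobian is exactly the factor by which the two densities
-- differ.
theorem chartMeasure_restrict_comm (g : Metric n M) (x₀ x₁ : M) :
    (chartMeasure g x₀).restrict (extChartAt (𝓡 n) x₁).source =
      (chartMeasure g x₁).restrict (extChartAt (𝓡 n) x₀).source := by
  refine Measure.ext_of_lintegral _ fun f hf => ?_
  rw [lintegral_chartMeasure_source g x₀ x₁ hf, lintegral_chartMeasure_source g x₁ x₀ hf]
  have himg : transition x₀ x₁ '' transitionDomain (n := n) x₀ x₁ = transitionDomain x₁ x₀ := by
    refine Subset.antisymm (image_subset_iff.2 fun y hy => transition_mem hy) fun z hz => ?_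
    exact ⟨transition x₁ x₀ z, transition_mem hz, transition_transition hz⟩
  rw [← himg, lintegral_image_eq_lintegral_abs_det_fderiv_mul volume
    (isOpen_transitionDomain x₀ x₁).measurableSet
    (fun y hy => ((contDiffAt_transition hy).differentiableAt
      (by simp)).hasFDerivAt.hasFDerivWithinAt) (transition_injOn x₀ x₁)]
  refine setLIntegral_congr_fun (isOpen_transitionDomain x₀ x₁).measurableSet fun y hy => ?_
  simp only [symm_transition hy]
  rw [volDensity_transition g hy, ENNReal.ofReal_mul (abs_nonneg _), mul_assoc]
theorem chartMeasure_restrict_self (g : Metric n M) (x₀ : M) :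
    (chartMeasure g x₀).restrict (extChartAt (𝓡 n) x₀).source = chartMeasure g x₀ := by
  refine Measure.ext_of_lintegral _ fun f hf => ?_
  rw [lintegral_chartMeasure_source g x₀ x₀ hf, lintegral_chartMeasure g x₀ hf]
  congr 2
  exact inter_eq_left.2 fun y hy => (extChartAt (𝓡 n) x₀).map_target hy
-- On the domain of one chart all chart measures are dominated by that of this chart, because they
-- agree on overlaps; the supremum adds nothing there.
theorem riemannianMeasure_restrict (g : Metric n M) (x₀ : M) :
    (riemannianMeasure g).restrict (extChartAt (𝓡 n) x₀).source = chartMeasure g x₀ := by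
  set s := (extChartAt (𝓡 n) x₀).source with hs
  have hsm : MeasurableSet s := (isOpen_extChartAt_source (I := 𝓡 n) x₀).measurableSet
  have hle : ∀ x₁ : M, chartMeasure g x₁ ≤ riemannianMeasure g := fun x₁ =>
    le_iSup (fun x₁ => chartMeasure g x₁) x₁
  refine le_antisymm ?_ ?_
  -- A supremum of measures is not the supremum of their values, but it is the least upper bound. So
  -- it is enough to bound each chart measure by its part inside s, controlled by the overlap
  -- identity, plus the remainder outside s.
  · have h1 : riemannianMeasure g ≤ chartMeasure g x₀ + (riemannianMeasure g).restrict sᶜ := by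
      refine iSup_le fun x₁ => ?_
      rw [← Measure.restrict_add_restrict_compl (μ := chartMeasure g x₁) hsm]
      refine add_le_add ?_ (Measure.restrict_mono subset_rfl (hle x₁))
      rw [← chartMeasure_restrict_comm]
      exact Measure.restrict_le_self
    have h2 := Measure.restrict_mono (subset_refl s) h1
    rw [Measure.restrict_add, Measure.restrict_restrict hsm, inter_compl_self,
      Measure.restrict_empty, add_zero, chartMeasure_restrict_self] at h2
    exact h2
  · rw [← chartMeasure_restrict_self g x₀]
    exact Measure.restrict_mono subset_rfl (hle x₀)
/-- The integral of a function over a chart domain, in coordinates. -/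
theorem setIntegral_source (g : Metric n M) (x₀ : M) {f : M → ℝ} (hf : Measurable f) :
    ∫ x in (extChartAt (𝓡 n) x₀).source, f x ∂riemannianMeasure g =
      ∫ y in (extChartAt (𝓡 n) x₀).target,
        volDensity g x₀ y * f ((extChartAt (𝓡 n) x₀).symm y) := by
  have hd := (aemeasurable_volDensity g x₀).ennreal_ofReal
  have h1 := (aemeasurable_chart_symm (n := n) x₀)
  rw [riemannianMeasure_restrict, chartMeasure, integral_map
    (h1.mono_ac (withDensity_absolutelyContinuous _ _)) hf.aestronglyMeasurable]
  refine (integral_withDensity_eq_integral_toReal_smul₀ hd (by simp) _).trans ?_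
  refine integral_congr_ae (Eventually.of_forall fun y => ?_)
  simp only [smul_eq_mul]
  rw [ENNReal.toReal_ofReal (volDensity_nonneg _ _ _)]
-- The density is continuous, hence bounded on a compact neighbourhood in the chart. This yields the
-- σ-finiteness needed for Riesz representation and the integrability of test forms.
instance isLocallyFiniteMeasure_riemannianMeasure (g : Metric n M) :
    IsLocallyFiniteMeasure (riemannianMeasure g) where
  finiteAtNhds x₀ := by
    obtain ⟨K, hK, hKt, hKc⟩ := local_compact_nhds (extChartAt_target_mem_nhds (I := 𝓡 n) x₀)
    obtain ⟨C, hC⟩ := (hKc.bddAbove_image ((continuousOn_volDensity g x₀).mono hKt))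
    refine ⟨(extChartAt (𝓡 n) x₀).source ∩ (extChartAt (𝓡 n) x₀) ⁻¹' (interior K), ?_, ?_⟩
    · exact inter_mem (extChartAt_source_mem_nhds x₀)
        ((continuousAt_extChartAt x₀) (isOpen_interior.mem_nhds (mem_interior_iff_mem_nhds.2 hK)))
    · set V := (extChartAt (𝓡 n) x₀).source ∩ (extChartAt (𝓡 n) x₀) ⁻¹' (interior K) with hV
      have hVm : MeasurableSet V := ((continuousOn_extChartAt x₀).isOpen_inter_preimage
        (isOpen_extChartAt_source x₀) isOpen_interior).measurableSet
      have h1 : riemannianMeasure g V = chartMeasure g x₀ V := by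
        rw [← riemannianMeasure_restrict, Measure.restrict_apply hVm,
          inter_eq_left.2 inter_subset_left]
      rw [h1, ← lintegral_indicator_one hVm,
        lintegral_chartMeasure g x₀ (measurable_one.indicator hVm)]
      calc _ ≤ ∫⁻ y in (extChartAt (𝓡 n) x₀).target,
            K.indicator (fun _ => ENNReal.ofReal C) y := by
            refine setLIntegral_mono' (isOpen_target x₀).measurableSet fun y hy => ?_
            by_cases h : (extChartAt (𝓡 n) x₀).symm y ∈ V
            · have hyK : y ∈ K := by
                have := interior_subset h.2
                rwa [(extChartAt (𝓡 n) x₀).right_inv hy] at this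
              rw [indicator_of_mem h, indicator_of_mem hyK, Pi.one_apply, mul_one]
              exact ENNReal.ofReal_le_ofReal (hC ⟨y, hyK, rfl⟩)
            · rw [indicator_of_notMem h, mul_zero]
              exact zero_le
        _ ≤ ∫⁻ y, K.indicator (fun _ => ENNReal.ofReal C) y := setLIntegral_le_lintegral _ _
        _ = ENNReal.ofReal C * volume K := by
            rw [lintegral_indicator hKc.measurableSet, setLIntegral_const]
        _ < ⊤ := ENNReal.mul_lt_top ENNReal.ofReal_lt_top hKc.measure_lt_top
end RiemannianMeasure

/-! ## Frames adapted to the metric -/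
section LocalFrames
-- At the identity matrix the determinant is 1 and the quadratic form is ∑ c_I². Everything is
-- continuous in H there, and only finitely many degrees j ≤ n occur, so one neighbourhood serves
-- for all of them.
theorem eventually_quadratic_comparison (n : ℕ) :
    ∀ᶠ H in 𝓝 (1 : Matrix (Fin n) (Fin n) ℝ), (1 / 2 ≤ √H.det ∧ √H.det ≤ 2) ∧
      ∀ j ≤ n, ∀ c : (Fin j → Fin n) → ℝ,
        1 / 2 * ∑ I, c I ^ 2 ≤ ∑ I, ∑ J, (∏ a, H⁻¹ (I a) (J a)) * (c I * c J) ∧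
        ∑ I, ∑ J, (∏ a, H⁻¹ (I a) (J a)) * (c I * c J) ≤ 2 * ∑ I, c I ^ 2 := by
  have hdet : ContinuousAt (fun H : Matrix (Fin n) (Fin n) ℝ => √H.det) 1 :=
    (Real.continuous_sqrt.comp (Continuous.matrix_det continuous_id)).continuousAt
  have h1 : ∀ᶠ H in 𝓝 (1 : Matrix (Fin n) (Fin n) ℝ), 1 / 2 ≤ √H.det ∧ √H.det ≤ 2 := by
    refine hdet.eventually (p := fun t => 1 / 2 ≤ t ∧ t ≤ 2) ?_
    simp only [Matrix.det_one, Real.sqrt_one]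
    exact Icc_mem_nhds (by norm_num) (by norm_num)
  have hinv : ∀ i j, ContinuousAt (fun H : Matrix (Fin n) (Fin n) ℝ => H⁻¹ i j) 1 := fun i j => by
    simp only [Matrix.inv_def, Ring.inverse_eq_inv', Matrix.smul_apply, smul_eq_mul]
    refine ContinuousAt.mul ?_ ?_
    · exact ((Continuous.matrix_det continuous_id).continuousAt).inv₀ (by simp)
    · exact ((Continuous.matrix_adjugate continuous_id).matrix_elem i j).continuousAt
  refine h1.and ?_
  refine (Set.finite_le_nat n).eventually_all.2 fun j _ => ?_
  set N : ℝ := ((Fintype.card (Fin j → Fin n) : ℕ) : ℝ) with hN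
  have hN0 : 0 ≤ N := Nat.cast_nonneg _
  -- With N multi-indices, an error of at most 1 / (2 (N + 1)) in each entry changes the form by at
  -- most half of ∑ c_I²; the summand 1 spares the question whether N vanishes.
  have hε : (0 : ℝ) < 1 / (2 * (N + 1)) := by positivity
  have hK : ∀ᶠ H in 𝓝 (1 : Matrix (Fin n) (Fin n) ℝ), ∀ I J : Fin j → Fin n,
      |(∏ a, H⁻¹ (I a) (J a)) - if I = J then 1 else 0| ≤ 1 / (2 * (N + 1)) := by
    refine eventually_all.2 fun I => eventually_all.2 fun J => ?_
    have hc : ContinuousAt (fun H : Matrix (Fin n) (Fin n) ℝ =>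
        |(∏ a, H⁻¹ (I a) (J a)) - if I = J then 1 else 0|) 1 :=
      ((tendsto_finsetProd _ fun a _ => hinv _ _).sub continuousAt_const).abs
    refine hc.eventually (p := fun t => t ≤ 1 / (2 * (N + 1))) ?_
    have h0 : (∏ a, (1 : Matrix (Fin n) (Fin n) ℝ)⁻¹ (I a) (J a)) = if I = J then 1 else 0 := by
      simp only [inv_one, Matrix.one_apply]
      by_cases h : I = J
      · simp [h]
      · rw [if_neg h]
        obtain ⟨a, ha⟩ := Function.ne_iff.1 h
        exact Finset.prod_eq_zero (Finset.mem_univ a) (if_neg ha)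
    have h2 : |(∏ a, (1 : Matrix (Fin n) (Fin n) ℝ)⁻¹ (I a) (J a)) - if I = J then 1 else 0| = 0 := by
      rw [h0, sub_self, abs_zero]
    change Iic _ ∈ 𝓝 (|(∏ a, (1 : Matrix (Fin n) (Fin n) ℝ)⁻¹ (I a) (J a)) -
      if I = J then 1 else 0|)
    rw [h2]
    exact Iic_mem_nhds hε
  filter_upwards [hK] with H hH c
  set S : ℝ := ∑ I, c I ^ 2 with hS
  have hS0 : 0 ≤ S := Finset.sum_nonneg fun I _ => sq_nonneg _
  have hdiff : |(∑ I, ∑ J, (∏ a, H⁻¹ (I a) (J a)) * (c I * c J)) - S| ≤ 1 / 2 * S := by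
    have e1 : S = ∑ I, ∑ J, (if I = J then (1 : ℝ) else 0) * (c I * c J) := by
      rw [hS]
      refine Finset.sum_congr rfl fun I _ => ?_
      simp [sq]
    have e2 : ∑ I : Fin j → Fin n, ∑ J : Fin j → Fin n,
        1 / (2 * (N + 1)) * ((c I ^ 2 + c J ^ 2) / 2) = N / (N + 1) * (1 / 2 * S) := by
      simp only [← Finset.mul_sum, ← Finset.sum_div, Finset.sum_add_distrib, Finset.sum_const,
        Finset.card_univ, nsmul_eq_mul, ← hS]
      rw [← hN]
      field_simp
      ring
    calc _ = |∑ I, ∑ J, ((∏ a, H⁻¹ (I a) (J a)) - if I = J then 1 else 0) * (c I * c J)| := by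
          conv_lhs => rw [e1]
          simp only [← Finset.sum_sub_distrib, ← sub_mul]
      _ ≤ ∑ I, ∑ J, |((∏ a, H⁻¹ (I a) (J a)) - if I = J then 1 else 0) * (c I * c J)| :=
          (Finset.abs_sum_le_sum_abs _ _).trans
            (Finset.sum_le_sum fun I _ => Finset.abs_sum_le_sum_abs _ _)
      _ ≤ ∑ I : Fin j → Fin n, ∑ J : Fin j → Fin n,
          1 / (2 * (N + 1)) * ((c I ^ 2 + c J ^ 2) / 2) := by
          refine Finset.sum_le_sum fun I _ => Finset.sum_le_sum fun J _ => ?_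
          rw [abs_mul]
          refine mul_le_mul (hH I J) ?_ (abs_nonneg _) hε.le
          rw [abs_le]
          constructor <;> nlinarith [sq_nonneg (c I - c J), sq_nonneg (c I + c J)]
      _ = N / (N + 1) * (1 / 2 * S) := e2
      _ ≤ 1 / 2 * S := by
          refine mul_le_of_le_one_left (by positivity) ?_
          rw [div_le_one (by positivity)]
          linarith
  rw [abs_le] at hdiff
  constructor <;> linarith [hdiff.1, hdiff.2]
variable {n : ℕ} {M : Type*} [TopologicalSpace M] [ChartedSpace (Model n) M]
  [IsManifold (𝓡 n) ∞ M]
/-- The sign of the coordinate frame of the preferred chart for the orientation. -/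
def orientationSign (o : ManifoldOrientation n M) (x : M) : ℝ :=
  open Classical in if (stdFrame x).orientation = o.at' x then 1 else -1
theorem orientationSign_eq (o : ManifoldOrientation n M) (x : M) :
    orientationSign o x = 1 ∨ orientationSign o x = -1 := by
  unfold orientationSign
  split_ifs <;> simp
theorem abs_sign {d : ℝ} (hd : d ≠ 0) : |Real.sign d| = 1 := by
  rcases hd.lt_or_gt with h | h
  · simp [Real.sign_of_neg h]
  · simp [Real.sign_of_pos h]
theorem sign_mul_self_eq_abs (d : ℝ) : Real.sign d * d = |d| := by
  rcases lt_trichotomy d 0 with h | h | h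
  · simp [Real.sign_of_neg h, abs_of_neg h]
  · simp [h]
  · simp [Real.sign_of_pos h, abs_of_pos h]
-- A change of frame multiplies the value of a top-degree form by det L and the root of the Gram
-- determinant by |det L|, so the quotient changes only by the sign of det L.
theorem topDensity_frame (g : Metric n M) (o : ManifoldOrientation n M) (x : M)
    (L : Model n →L[ℝ] Model n) (hL : L.det ≠ 0)
    (η : (TangentSpace (𝓡 n) x) [⋀^Fin n]→ₗ[ℝ] ℝ) :
    topDensity g o x η = orientationSign o x * Real.sign L.det *
      η (fun i => L (stdVec n i)) /
        √(gramMatrix (V := TangentSpace (𝓡 n) x) (g.inner x) fun i => L (stdVec n i)).det := by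
  have h1 : η (fun i => L (stdVec n i)) = L.det * η (stdFrame x) := by
    have h := AlternatingMap.eq_smul_basis_det (stdFrame x) η
    have h2 := Module.Basis.det_comp (stdFrame x) L.toLinearMap
      (stdFrame x)
    rw [(stdFrame x).det_self, mul_one] at h2
    have h3 := congrArg (fun ξ : (TangentSpace (𝓡 n) x) [⋀^Fin n]→ₗ[ℝ] ℝ =>
      ξ fun i => L (stdVec n i)) h
    refine h3.trans ?_
    change η (stdFrame x) * (stdFrame x).det (fun i => L (stdVec n i)) = _
    rw [mul_comm]
    congr 1
  have h2 := congrArg Real.sqrt (gramMatrix_comp_det (V := TangentSpace (𝓡 n) x) (g.inner x)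
    (LinearMap.id : Model n →ₗ[ℝ] Model n) L.toLinearMap)
  rw [Real.sqrt_mul (sq_nonneg _), Real.sqrt_sq_eq_abs] at h2
  have h3 : √(gramMatrix (V := TangentSpace (𝓡 n) x) (g.inner x) fun i => L (stdVec n i)).det =
      |L.det| * √(gramMatrix (g.inner x) (stdFrame x)).det := by
    refine h2.trans ?_
    congr 4
  rw [h3, h1, topDensity]
  have h4 : orientationSign o x * Real.sign L.det * (L.det * η (stdFrame x)) =
      |L.det| * (orientationSign o x * η (stdFrame x)) := by
    rw [← sign_mul_self_eq_abs]
    ring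
  rw [h4, mul_div_mul_left _ _ (abs_ne_zero.2 hL)]
  rfl
theorem coordMap_det_ne_zero {x₀ : M} {y : Model n} (hy : y ∈ (extChartAt (𝓡 n) x₀).target) :
    (coordMap x₀ y : Model n →L[ℝ] Model n).det ≠ 0 := by
  intro h
  have h1 := congrArg ContinuousLinearMap.det (coordMap_comp_chartDeriv_self hy)
  have h2 : (coordMap x₀ y : Model n →L[ℝ] Model n).det *
      (chartDeriv (n := n) x₀ ((extChartAt (𝓡 n) x₀).symm y)).det = 1 := by
    refine (LinearMap.det_comp _ _).symm.trans (Eq.trans h1 ?_)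
    exact LinearMap.det_id
  rw [h, zero_mul] at h2
  exact zero_ne_one h2
/-- The coordinate frames of the chart at `x₀` are all positive or all negative near `x₀`. -/
theorem exists_eventually_orientationSign (o : ManifoldOrientation n M) (x₀ : M) :
    ∃ c : ℝ, (c = 1 ∨ c = -1) ∧ ∀ᶠ x in 𝓝 x₀, orientationSign o x *
      Real.sign (coordMap x₀ (extChartAt (𝓡 n) x₀ x) : Model n →L[ℝ] Model n).det = c := by
  classical
  obtain ⟨ε, hε⟩ := o.locally_constant x₀
  let σ : Orientation ℝ (Model n) (Fin n) := (EuclideanSpace.basisFun (Fin n) ℝ).toBasis.orientation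
  have hcard : Fintype.card (Fin n) = Module.finrank ℝ (Model n) := by simp
  -- The constant records whether the orientation, read in the trivialization at x₀, is the standard
  -- one of ℝⁿ.
  refine ⟨if ε = σ then 1 else -1, by split_ifs <;> simp, ?_⟩
  filter_upwards [hε, extChartAt_source_mem_nhds (I := 𝓡 n) x₀] with x hx hxs
  have hy := (extChartAt (𝓡 n) x₀).map_source hxs
  have hb : x ∈ (trivializationAt (Model n) (TangentSpace (𝓡 n) (M := M)) x₀).baseSet := by
    have := mem_baseSet_of_target x₀ hy
    rwa [(extChartAt (𝓡 n) x₀).left_inv hxs] at this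
  specialize hx hb
  set T : Model n ≃ₗ[ℝ] Model n :=
    ((trivializationAt (Model n) (TangentSpace (𝓡 n) (M := M)) x₀).continuousLinearEquivAt
      ℝ x hb).toLinearEquiv with hT
  let at' : Orientation ℝ (Model n) (Fin n) := o.at' x
  have hx' : Orientation.map (Fin n) T at' = ε := hx
  let C : Model n →L[ℝ] Model n := coordMap x₀ (extChartAt (𝓡 n) x₀ x)
  -- The coordinate map inverts the trivialization, so their determinants have the same sign, and
  -- that sign decides whether the trivialization reverses orientations.
  have hC : C.toLinearMap = T.symm.toLinearMap := by
    let S : M → Model n →L[ℝ] Model n := fun z =>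
      (trivializationAt (Model n) (TangentSpace (𝓡 n) (M := M)) x₀).symmL ℝ z
    have h1 : ∀ v, C v = S ((extChartAt (𝓡 n) x₀).symm (extChartAt (𝓡 n) x₀ x)) v :=
      coordMap_eq_symmL x₀ hy
    rw [(extChartAt (𝓡 n) x₀).left_inv hxs] at h1
    ext1 v
    refine (h1 v).trans ?_
    exact congrFun
      (Bundle.Trivialization.symm_continuousLinearEquivAt_eq
        (trivializationAt (Model n) (TangentSpace (𝓡 n) (M := M)) x₀) hb).symm v
  have hdet : LinearMap.det C.toLinearMap * LinearMap.det T.toLinearMap = 1 := by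
    rw [hC, ← LinearMap.det_comp]
    simp
  have hne : σ ≠ -σ := Module.Ray.ne_neg_self σ
  have hnn : - -σ = σ := neg_neg σ
  have hsign : Real.sign C.det = Real.sign (LinearMap.det T.toLinearMap) := by
    have hd : C.det * LinearMap.det T.toLinearMap = 1 := hdet
    rcases lt_trichotomy (LinearMap.det T.toLinearMap) 0 with h | h | h
    · have : C.det < 0 := by
        by_contra hc
        nlinarith
      rw [Real.sign_of_neg h, Real.sign_of_neg this]
    · rw [h, mul_zero] at hd
      exact absurd hd zero_ne_one
    · have : 0 < C.det := by
        by_contra hc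
        nlinarith
      rw [Real.sign_of_pos h, Real.sign_of_pos this]
  change orientationSign o x * Real.sign C.det = _
  rw [hsign]
  have hor : orientationSign o x = if σ = at' then 1 else -1 := by
    unfold orientationSign
    rfl
  have hTne : LinearMap.det T.toLinearMap ≠ 0 := right_ne_zero_of_mul_eq_one hdet
  rw [hor, ← hx']
  rcases Orientation.eq_or_eq_neg at' σ hcard with h | h <;>
  rcases hTne.lt_or_gt with hd | hd
  · rw [h, (Orientation.map_eq_neg_iff_det_neg σ T hcard).2 hd, Real.sign_of_neg hd]
    simp [hne.symm]
  · rw [h, (Orientation.map_eq_iff_det_pos σ T hcard).2 hd, Real.sign_of_pos hd]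
    simp
  · rw [h, Orientation.map_neg, (Orientation.map_eq_neg_iff_det_neg σ T hcard).2 hd,
      Real.sign_of_neg hd]
    simp [hne, hnn]
  · rw [h, Orientation.map_neg, (Orientation.map_eq_iff_det_pos σ T hcard).2 hd,
      Real.sign_of_pos hd]
    simp [hne, hne.symm]
end LocalFrames

/-! ### Measurable almost orthonormal frames -/

section AdaptedFrames
theorem measurableSet_inter_preimage {X Y : Type*} [MeasurableSpace X] [MeasurableSpace Y]
    {s : Set X} (hs : MeasurableSet s) {f : X → Y} (hf : Measurable (s.domRestrict f)) {A : Set Y}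
    (hA : MeasurableSet A) : MeasurableSet (s ∩ f ⁻¹' A) := by
  convert! MeasurableSet.subtype_image hs (hf hA) using 1
  ext x
  constructor
  · exact fun hx => ⟨⟨x, hx.1⟩, hx.2, rfl⟩
  · rintro ⟨z, hz, rfl⟩
    exact ⟨z.2, hz⟩
theorem measurable_domRestrict_of_inter_preimage {X Y : Type*} [MeasurableSpace X]
    [MeasurableSpace Y] {s : Set X} {f : X → Y}
    (hf : ∀ A, MeasurableSet A → MeasurableSet (s ∩ f ⁻¹' A)) : Measurable (s.domRestrict f) := by
  intro A hA
  convert! measurable_subtype_coe (hf A hA) using 1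
  ext x
  exact ⟨fun h => ⟨x.2, h⟩, fun h => h.2⟩
/-- A second countable space covered by neighbourhoods of its points is cut into countably many
measurable pieces, each contained in one of these neighbourhoods. -/
theorem exists_measurable_index {X : Type*} [TopologicalSpace X] [SecondCountableTopology X]
    [MeasurableSpace X] [BorelSpace X] (U : X → Set X) (hU : ∀ x, IsOpen (U x))
    (hx : ∀ x, x ∈ U x) :
    ∃ i : X → X, (range i).Countable ∧ (∀ z, MeasurableSet (i ⁻¹' {z})) ∧ ∀ x, x ∈ U (i x) := by
  obtain ⟨s, hs, hcov⟩ := TopologicalSpace.countable_cover_nhds fun x => (hU x).mem_nhds (hx x)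
  rcases isEmpty_or_nonempty X with he | he
  · exact ⟨id, by simp [Set.eq_empty_of_isEmpty], fun z => isEmptyElim z,
      fun x => isEmptyElim x⟩
  have hne : s.Nonempty := by
    obtain ⟨x⟩ := he
    have hx' : x ∈ ⋃ x ∈ s, U x := hcov ▸ mem_univ x
    obtain ⟨z, hz, -⟩ := mem_iUnion₂.1 hx'
    exact ⟨z, hz⟩
  obtain ⟨e, rfl⟩ := hs.exists_eq_range hne
  have hex : ∀ x, ∃ m, x ∈ U (e m) := fun x => by
    have hx' : x ∈ ⋃ x ∈ range e, U x := hcov ▸ mem_univ x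
    obtain ⟨z, ⟨m, rfl⟩, hz⟩ := mem_iUnion₂.1 hx'
    exact ⟨m, hz⟩
  classical
  -- Each point goes to the first neighbourhood of a countable subcover that contains it; the pieces
  -- of equal first index are measurable.
  have hfind : Measurable fun x => Nat.find (hex x) :=
    measurable_find hex fun m => (hU (e m)).measurableSet
  refine ⟨fun x => e (Nat.find (hex x)), (countable_range e).mono ?_, fun z => ?_, fun x =>
    Nat.find_spec (hex x)⟩
  · rintro _ ⟨x, rfl⟩
    exact ⟨_, rfl⟩
  · exact hfind (MeasurableSpace.measurableSet_top (s := e ⁻¹' {z}))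
variable {n : ℕ} {M : Type*} [TopologicalSpace M] [ChartedSpace (Model n) M]
  [IsManifold (𝓡 n) ∞ M]
theorem det_ne_zero_of_gramMatrix {V : Type*} [AddCommGroup V] [Module ℝ V] [TopologicalSpace V]
    (B : V →L[ℝ] V →L[ℝ] ℝ) (C : Model n →L[ℝ] V) (L : Model n →L[ℝ] Model n)
    (h : (gramMatrix B fun i => C (L (stdVec n i))).det ≠ 0) : L.det ≠ 0 := by
  intro h0
  have := gramMatrix_comp_det B C.toLinearMap L.toLinearMap
  refine h (this.trans ?_)
  have h1 : LinearMap.det L.toLinearMap = 0 := h0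
  rw [h1]
  ring
theorem sign_mul' {a b : ℝ} : Real.sign (a * b) = Real.sign a * Real.sign b := by
  rcases lt_trichotomy a 0 with ha | ha | ha <;> rcases lt_trichotomy b 0 with hb | hb | hb <;>
  simp [ha, hb, Real.sign_of_neg, Real.sign_of_pos, mul_neg_of_neg_of_pos, mul_neg_of_pos_of_neg,
    mul_pos_of_neg_of_neg]
/-- After a constant linear change, the coordinate frame at `x₀` is almost orthonormal near
`x₀`. -/
theorem exists_local_frame (g : Metric n M) (o : ManifoldOrientation n M) (x₀ : M)
    {G : Set (Matrix (Fin n) (Fin n) ℝ)} (hG : G ∈ 𝓝 1) :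
    ∃ P : Model n →L[ℝ] Model n, P.det ≠ 0 ∧ ∃ c : ℝ, (c = 1 ∨ c = -1) ∧ ∃ U : Set M, IsOpen U ∧
      x₀ ∈ U ∧ U ⊆ (extChartAt (𝓡 n) x₀).source ∧
      ContinuousOn (fun x => gramMatrix (V := TangentSpace (𝓡 n) x) (g.inner x) fun i =>
        (coordMap x₀ (extChartAt (𝓡 n) x₀ x) : Model n →L[ℝ] Model n) (P (stdVec n i))) U ∧
      ∀ x ∈ U, (orientationSign o x * Real.sign
        ((coordMap x₀ (extChartAt (𝓡 n) x₀ x) : Model n →L[ℝ] Model n).comp P).det = c) ∧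
        (gramMatrix (V := TangentSpace (𝓡 n) x) (g.inner x) fun i =>
        (coordMap x₀ (extChartAt (𝓡 n) x₀ x) : Model n →L[ℝ] Model n) (P (stdVec n i))) ∈ G := by
  obtain ⟨e, he⟩ := exists_orthonormal_frame g x₀
  let e' : Fin n → Model n := e
  let T : Model n →L[ℝ] Model n := ∑ i, (EuclideanSpace.proj i : Model n →L[ℝ] ℝ).smulRight (e' i)
  have hT : ∀ i, T (stdVec n i) = e' i := fun i => by
    simp [T, stdVec_apply, sum_apply]
  have hxs := mem_extChartAt_source (I := 𝓡 n) x₀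
  have hy₀ := mem_extChartAt_target (I := 𝓡 n) x₀
  -- With this choice the coordinate map at x₀ composed with P carries the standard basis to the
  -- orthonormal basis e. The Gram matrix is 1 at x₀ and lies in G nearby by continuity.
  let P : Model n →L[ℝ] Model n := (chartDeriv x₀ x₀).comp T
  have hCP : ∀ i, (coordMap x₀ (extChartAt (𝓡 n) x₀ x₀) : Model n →L[ℝ] Model n)
      (P (stdVec n i)) = e' i := fun i => by
    have h := coordMap_comp_chartDeriv_self hy₀
    rw [extChartAt_to_inv] at h
    rw [← hT i]
    exact congrArg (fun L : Model n →L[ℝ] Model n => L (T (stdVec n i))) h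
  let Gr : M → Matrix (Fin n) (Fin n) ℝ := fun x =>
    gramMatrix (V := TangentSpace (𝓡 n) x) (g.inner x) fun i =>
      (coordMap x₀ (extChartAt (𝓡 n) x₀ x) : Model n →L[ℝ] Model n) (P (stdVec n i))
  have hGr1 : Gr x₀ = 1 := by
    rw [← he]
    exact congrArg (gramMatrix (V := TangentSpace (𝓡 n) x₀) (g.inner x₀)) (funext hCP)
  have hcont : ContinuousOn Gr (extChartAt (𝓡 n) x₀).source := by
    have h1 := (continuousOn_gram g x₀).comp (continuousOn_extChartAt x₀) fun x hx =>
      (extChartAt (𝓡 n) x₀).map_source hx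
    have h2 : ContinuousOn (fun x => (LinearMap.toMatrix (EuclideanSpace.basisFun (Fin n) ℝ).toBasis
        (EuclideanSpace.basisFun (Fin n) ℝ).toBasis P.toLinearMap).transpose *
        ((gramMatrix (g.inner ((extChartAt (𝓡 n) x₀).symm (extChartAt (𝓡 n) x₀ x)))
          (coordFrame x₀ (extChartAt (𝓡 n) x₀ x))) *
          LinearMap.toMatrix (EuclideanSpace.basisFun (Fin n) ℝ).toBasis
            (EuclideanSpace.basisFun (Fin n) ℝ).toBasis P.toLinearMap))
        (extChartAt (𝓡 n) x₀).source := by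
      refine ContinuousOn.comp (t := univ) (g := fun H : Matrix (Fin n) (Fin n) ℝ => _ * (H * _))
        ?_ h1 (fun _ _ => mem_univ _)
      exact (continuous_const.matrix_mul (continuous_id.matrix_mul continuous_const)).continuousOn
    refine h2.congr fun x hx => ?_
    let G' : M → Model n →L[ℝ] Model n →L[ℝ] ℝ := fun x => g.inner x
    have h3 := gramMatrix_comp (G' ((extChartAt (𝓡 n) x₀).symm (extChartAt (𝓡 n) x₀ x)))
      (coordMap x₀ (extChartAt (𝓡 n) x₀ x) : Model n →L[ℝ] Model n).toLinearMap P.toLinearMap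
    refine Eq.trans ?_ h3
    rw [(extChartAt (𝓡 n) x₀).left_inv hx]
    rfl
  have hsrc := isOpen_extChartAt_source (I := 𝓡 n) x₀
  have hP : P.det ≠ 0 := by
    refine det_ne_zero_of_gramMatrix (V := Model n) (g.inner x₀)
      (coordMap x₀ (extChartAt (𝓡 n) x₀ x₀)) P ?_
    change (Gr x₀).det ≠ 0
    rw [hGr1, Matrix.det_one]
    exact one_ne_zero
  obtain ⟨c, hc, hev⟩ := exists_eventually_orientationSign o x₀
  have hevG : ∀ᶠ x in 𝓝 x₀, Gr x ∈ G := by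
    have := (hcont.continuousAt (hsrc.mem_nhds hxs)).tendsto
    rw [hGr1] at this
    exact this.eventually hG
  obtain ⟨U, hUsub, hUo, hUx⟩ := _root_.mem_nhds_iff.1 (hev.and (hevG.and (hsrc.mem_nhds hxs)))
  refine ⟨P, hP, c * Real.sign P.det, ?_, U, hUo, hUx, fun x hx => (hUsub hx).2.2,
    hcont.mono fun x hx => (hUsub hx).2.2, fun x hx => ⟨?_, (hUsub hx).2.1⟩⟩
  · rcases hc with rfl | rfl <;> rcases hP.lt_or_gt with h | h <;>
    simp [Real.sign_of_neg, Real.sign_of_pos, h]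
  · have h1 : ((coordMap x₀ (extChartAt (𝓡 n) x₀ x) : Model n →L[ℝ] Model n).comp P).det =
        (coordMap x₀ (extChartAt (𝓡 n) x₀ x) : Model n →L[ℝ] Model n).det * P.det :=
      LinearMap.det_comp _ _
    rw [h1, sign_mul', ← mul_assoc, (hUsub hx).1]
variable [MeasurableSpace M]
/-- A measurable frame of the tangent bundle in which the metric is comparable to the Euclidean
one. -/
structure AdaptedFrame (g : Metric n M) (o : ManifoldOrientation n M) where
  /-- The frame, as an isomorphism of `ℝⁿ` onto the tangent space. -/
  map : M → Model n ≃L[ℝ] Model n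
  /-- The volume of the dual frame. -/
  density : M → ℝ
  measurable_density : Measurable density
  le_abs_density (x : M) : 1 / 2 ≤ |density x|
  abs_density_le (x : M) : |density x| ≤ 2
  topDensity_eq (x : M) (η : (TangentSpace (𝓡 n) x) [⋀^Fin n]→ₗ[ℝ] ℝ) :
    topDensity g o x η = density x * η fun i => map x (stdVec n i)
  measurable_components {j : ℕ} {α : FormField n M j} (hα : IsMeasurableForm α)
    (I : Fin j → Fin n) : Measurable fun x => α x fun a => map x (stdVec n (I a))
  measurable_pullback {j : ℕ} (A : Model n [⋀^Fin j]→L[ℝ] ℝ) : IsMeasurableForm (n := n) (M := M)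
    fun x => A.compContinuousLinearMap ((map x).symm : Model n →L[ℝ] Model n)
  norm_sq_comparison {j : ℕ} (hj : j ≤ n) (x : M) (α : (TangentSpace (𝓡 n) x) [⋀^Fin j]→L[ℝ] ℝ) :
    1 / 2 * ((j.factorial : ℝ)⁻¹ * ∑ I : Fin j → Fin n, (α fun a => map x (stdVec n (I a))) ^ 2) ≤
      formNorm g x α ^ 2 ∧ formNorm g x α ^ 2 ≤
      2 * ((j.factorial : ℝ)⁻¹ * ∑ I : Fin j → Fin n, (α fun a => map x (stdVec n (I a))) ^ 2)
variable [BorelSpace M] [SecondCountableTopology M]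
-- A global continuous frame need not exist, but only measurability is required: local almost
-- orthonormal frames are used on the pieces of a countable measurable partition.
theorem exists_adaptedFrame (g : Metric n M) (o : ManifoldOrientation n M) :
    Nonempty (AdaptedFrame g o) := by
  choose P hP c hc U hUo hUx hUs hcont hU using fun x₀ : M =>
    exists_local_frame g o x₀ (eventually_quadratic_comparison n)
  obtain ⟨i, hi, him, hiU⟩ := exists_measurable_index U hUo hUx
  let L : M → Model n →L[ℝ] Model n := fun x =>
    (coordMap (i x) (extChartAt (𝓡 n) (i x) x) : Model n →L[ℝ] Model n).comp (P (i x))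
  let Gr : M → Matrix (Fin n) (Fin n) ℝ := fun x =>
    gramMatrix (V := TangentSpace (𝓡 n) x) (g.inner x) fun j => L x (stdVec n j)
  have hGr := fun x => (hU (i x) x (hiU x)).2
  have hGrdet : ∀ x, (Gr x).det ≠ 0 := fun x h => by
    have h1 : 1 / 2 ≤ √(Gr x).det := (hGr x).1.1
    rw [h, Real.sqrt_zero] at h1
    norm_num at h1
  have hL : ∀ x, (L x).det ≠ 0 := fun x =>
    det_ne_zero_of_gramMatrix (V := Model n) (g.inner x) (ContinuousLinearMap.id ℝ _) (L x)
      (hGrdet x)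
  let E : M → Model n ≃L[ℝ] Model n := fun x =>
    ContinuousLinearMap.toContinuousLinearEquivOfDetNeZero (L x) (hL x)
  have hE : ∀ x v, E x v = L x v := fun x v => rfl
  -- Measurability may be checked on each piece, where the chart and the matrix P are fixed.
  have hpieces : ∀ {Y : Type} [MeasurableSpace Y] (f : M → Y),
      (∀ z A, MeasurableSet A → MeasurableSet (i ⁻¹' {z} ∩ f ⁻¹' A)) → Measurable f := by
    intro Y _ f hf A hA
    have : f ⁻¹' A = ⋃ z ∈ range i, i ⁻¹' {z} ∩ f ⁻¹' A := by
      ext x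
      simp only [mem_iUnion]
      exact ⟨fun h => ⟨i x, ⟨x, rfl⟩, rfl, h⟩, fun ⟨z, _, h⟩ => h.2⟩
    rw [this]
    exact MeasurableSet.biUnion hi fun z _ => hf z A hA
  have hiUz : ∀ z x, x ∈ i ⁻¹' {z} → x ∈ U z := fun z x hx => by
    have h1 : i x = z := hx
    exact h1 ▸ hiU x
  refine ⟨⟨E, fun x => c (i x) / √(Gr x).det, ?_, ?_, ?_, ?_, ?_, ?_, ?_⟩⟩
  · refine hpieces _ fun z A hA => ?_
    have h1 : Measurable ((U z).domRestrict fun x => c z /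
        √(gramMatrix (V := TangentSpace (𝓡 n) x) (g.inner x) fun j =>
          (coordMap z (extChartAt (𝓡 n) z x) : Model n →L[ℝ] Model n)
            (P z (stdVec n j))).det) := by
      have h2 := (continuousOn_iff_continuous_domRestrict.1 (hcont z))
      exact measurable_const.div (h2.matrix_det.sqrt).measurable
    have h2 := (him z).inter (measurableSet_inter_preimage (hUo z).measurableSet h1 hA)
    convert! h2 using 1
    ext x
    constructor
    · rintro ⟨hx, hxA⟩
      refine ⟨hx, hiUz z x hx, ?_⟩
      have h1 : i x = z := hx
      rw [← h1]
      exact hxA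
    · rintro ⟨hx, -, hxA⟩
      refine ⟨hx, ?_⟩
      have h1 : i x = z := hx
      rw [← h1] at hxA
      exact hxA
  · intro x
    have h1 : 1 / 2 ≤ √(Gr x).det ∧ √(Gr x).det ≤ 2 := (hGr x).1
    have h2 : |c (i x)| = 1 := by rcases hc (i x) with h | h <;> simp [h]
    rw [abs_div, h2, abs_of_nonneg (Real.sqrt_nonneg _)]
    exact one_div_le_one_div_of_le (by linarith [h1.1]) h1.2
  · intro x
    have h1 : 1 / 2 ≤ √(Gr x).det ∧ √(Gr x).det ≤ 2 := (hGr x).1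
    have h2 : |c (i x)| = 1 := by rcases hc (i x) with h | h <;> simp [h]
    rw [abs_div, h2, abs_of_nonneg (Real.sqrt_nonneg _), div_le_iff₀ (by linarith [h1.1])]
    linarith [h1.1]
  · intro x η
    have h1 : orientationSign o x * Real.sign (L x).det = c (i x) := (hU (i x) x (hiU x)).1
    rw [topDensity_frame g o x (L x) (hL x), h1]
    exact mul_div_right_comm _ _ _
  · intro j α hα I
    refine hpieces _ fun z A hA => ?_
    have hm : Measurable fun x : (extChartAt (𝓡 n) z).source =>
        (⟨extChartAt (𝓡 n) z x, (extChartAt (𝓡 n) z).map_source x.2⟩ :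
          (extChartAt (𝓡 n) z).target) :=
      (continuousOn_iff_continuous_domRestrict.1
        (continuousOn_extChartAt z)).measurable.subtype_mk
    have h1 := (hα z fun a => P z (stdVec n (I a))).comp hm
    have h2 := (him z).inter (measurableSet_inter_preimage
      (f := fun x => chartRep z α (extChartAt (𝓡 n) z x) fun a => P z (stdVec n (I a)))
      (isOpen_extChartAt_source (I := 𝓡 n) z).measurableSet h1 hA)
    have key : ∀ x, x ∈ i ⁻¹' {z} →
        (chartRep z α (extChartAt (𝓡 n) z x) fun a => P z (stdVec n (I a))) =
          α x fun a => E x (stdVec n (I a)) := by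
      intro x hx
      have h1 : i x = z := hx
      let β : M → Model n [⋀^Fin j]→L[ℝ] ℝ := α
      have e1 : (chartRep z α (extChartAt (𝓡 n) z x) fun a => P z (stdVec n (I a))) =
        β ((extChartAt (𝓡 n) z).symm (extChartAt (𝓡 n) z x)) fun a =>
          (coordMap z (extChartAt (𝓡 n) z x) : Model n →L[ℝ] Model n) (P z (stdVec n (I a))) := rfl
      rw [e1, (extChartAt (𝓡 n) z).left_inv (hUs z (hiUz z x hx)), ← h1]
      rfl
    convert! h2 using 1
    ext x
    constructor
    · rintro ⟨hx, hxA⟩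
      refine ⟨hx, hUs z (hiUz z x hx), ?_⟩
      rw [mem_preimage, key x hx]
      exact hxA
    · rintro ⟨hx, -, hxA⟩
      refine ⟨hx, ?_⟩
      have hxA' : (chartRep z α (extChartAt (𝓡 n) z x) fun a => P z (stdVec n (I a))) ∈ A := hxA
      rw [key x hx] at hxA'
      exact hxA'
  · intro j A x₀ v
    refine measurable_domRestrict_of_inter_preimage fun B hB => ?_
    set f : Model n → ℝ := fun y => chartRep x₀ (fun x =>
      A.compContinuousLinearMap ((E x).symm : Model n →L[ℝ] Model n) : FormField n M j) y v with hf
    -- On the piece of index z the frame is the coordinate map of the chart at z composed with P z.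
    -- In the chart at x₀ its inverse is therefore the Jacobian of the transition followed by the
    -- inverse of P z, which is continuous.
    let fz : M → Model n → ℝ := fun z y => A fun a =>
      (ContinuousLinearMap.toContinuousLinearEquivOfDetNeZero (P z) (hP z)).symm
        (fderiv ℝ (transition x₀ z) y (v a))
    have key : ∀ z y, y ∈ transitionDomain x₀ z → (extChartAt (𝓡 n) x₀).symm y ∈ i ⁻¹' {z} →
        f y = fz z y := by
      intro z y hy hiz
      have h1 : i ((extChartAt (𝓡 n) x₀).symm y) = z := hiz
      have e1 : f y = A fun a => (E ((extChartAt (𝓡 n) x₀).symm y)).symm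
        ((coordMap x₀ y : Model n →L[ℝ] Model n) (v a)) := rfl
      rw [e1]
      refine congrArg A (funext fun a => ?_)
      refine (ContinuousLinearEquiv.symm_apply_eq (E ((extChartAt (𝓡 n) x₀).symm y))).2 ?_
      change (coordMap x₀ y : Model n →L[ℝ] Model n) (v a) = (coordMap (i ((extChartAt (𝓡 n) x₀).symm y)) (extChartAt (𝓡 n)
        (i ((extChartAt (𝓡 n) x₀).symm y)) ((extChartAt (𝓡 n) x₀).symm y)) :
          Model n →L[ℝ] Model n) (P (i ((extChartAt (𝓡 n) x₀).symm y)) _)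
      rw [h1, coordMap_eq_comp hy]
      change _ = (coordMap z (transition x₀ z y) : Model n →L[ℝ] Model n)
        ((ContinuousLinearMap.toContinuousLinearEquivOfDetNeZero (P z) (hP z)) _)
      rw [ContinuousLinearEquiv.apply_symm_apply]
      rfl
    have hfz : ∀ z, ContinuousOn (fz z) (transitionDomain x₀ z) := by
      intro z
      have h1 : ContinuousOn (fderiv ℝ (transition x₀ z)) (transitionDomain (n := n) x₀ z) :=
        (contDiffOn_transition x₀ z).continuousOn_fderiv_of_isOpen
          (isOpen_transitionDomain x₀ z) (by simp)
      refine A.cont.comp_continuousOn (continuousOn_pi.2 fun a => ?_)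
      exact (ContinuousLinearEquiv.continuous _).comp_continuousOn
        (h1.clm_apply continuousOn_const)
    have hsplit : (extChartAt (𝓡 n) x₀).target ∩ f ⁻¹' B = ⋃ z ∈ range i,
        ((extChartAt (𝓡 n) x₀).target ∩ (extChartAt (𝓡 n) x₀).symm ⁻¹' (i ⁻¹' {z})) ∩
          (transitionDomain x₀ z ∩ fz z ⁻¹' B) := by
      ext y
      simp only [mem_iUnion]
      constructor
      · rintro ⟨hy, hyB⟩
        have hD : y ∈ transitionDomain x₀ (i ((extChartAt (𝓡 n) x₀).symm y)) :=
          ⟨hy, hUs _ (hiU _)⟩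
        refine ⟨i ((extChartAt (𝓡 n) x₀).symm y), ⟨_, rfl⟩, ⟨hy, rfl⟩, hD, ?_⟩
        rw [mem_preimage, ← key _ y hD rfl]
        exact hyB
      · rintro ⟨z, -, ⟨hy, hz⟩, hD, hyB⟩
        refine ⟨hy, ?_⟩
        rw [mem_preimage, key z y hD hz]
        exact hyB
    rw [hsplit]
    refine MeasurableSet.biUnion hi fun z _ => MeasurableSet.inter ?_ ?_
    · exact measurableSet_inter_preimage (isOpen_target x₀).measurableSet
        (continuousOn_iff_continuous_domRestrict.1 (continuousOn_extChartAt_symm x₀)).measurable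
        (him z)
    · exact measurableSet_inter_preimage (isOpen_transitionDomain x₀ z).measurableSet
        (continuousOn_iff_continuous_domRestrict.1 (hfz z)).measurable hB
  · intro j hj x α
    obtain ⟨e, he⟩ := exists_orthonormal_frame g x
    let b : Module.Basis (Fin n) ℝ (TangentSpace (𝓡 n) x) :=
      (stdFrame x).map (E x).toLinearEquiv
    have hb : (b : Fin n → TangentSpace (𝓡 n) x) = fun j => L x (stdVec n j) := by
      funext j
      change L x ((EuclideanSpace.basisFun (Fin n) ℝ).toBasis j) = _
      rw [OrthonormalBasis.coe_toBasis]
      rfl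
    have h1 : formNorm g x α ^ 2 = frameNormSq (g.inner x) b α := by
      rw [formNorm, frameNormSq_basis g x (stdFrame x) e he, Real.sq_sqrt (by positivity),
        frameNormSq_basis g x b e he]
    rw [h1, hb]
    have h2 := (hGr x).2 j hj fun I => α fun a => L x (stdVec n (I a))
    have hfac : (0 : ℝ) ≤ (j.factorial : ℝ)⁻¹ := by positivity
    have h3 := mul_le_mul_of_nonneg_left h2.1 hfac
    have h4 := mul_le_mul_of_nonneg_left h2.2 hfac
    constructor
    · refine le_trans (le_of_eq ?_) h3
      simp only [hE]
      ring
    · refine le_trans h4 (le_of_eq ?_)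
      simp only [hE]
      ring
end AdaptedFrames

/-! ## Duality of the spaces of integrable forms -/
section PointwiseDuality
theorem norm_stdVec {n : ℕ} (i : Fin n) : ‖stdVec n i‖ = 1 := by simp [stdVec]
theorem abs_apply_stdVec_le {j n : ℕ} (A : Model n [⋀^Fin j]→L[ℝ] ℝ) (I : Fin j → Fin n) :
    |A fun a => stdVec n (I a)| ≤ ‖A‖ := by
  have := A.le_opNorm fun a => stdVec n (I a)
  simpa [norm_stdVec] using this
-- The components form an injective linear map on a finite-dimensional space, and such a map is
-- bounded below.
theorem exists_norm_le_components (j n : ℕ) : ∃ K : ℝ, 0 < K ∧ ∀ A : Model n [⋀^Fin j]→L[ℝ] ℝ,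
    ‖A‖ ^ 2 ≤ K * ∑ I : Fin j → Fin n, (A fun a => stdVec n (I a)) ^ 2 := by
  obtain ⟨K, hK, hA⟩ := LinearMap.exists_antilipschitzWith (stdComponents j n)
    (LinearMap.ker_eq_bot.2 stdComponents_injective)
  refine ⟨K ^ 2, by positivity, fun A => ?_⟩
  have h1 : ‖A‖ ≤ K * ‖stdComponents j n A‖ := by
    have := hA.le_mul_dist A 0
    simpa using this
  have h2 : ‖stdComponents j n A‖ ≤ √(∑ I : Fin j → Fin n, (A fun a => stdVec n (I a)) ^ 2) := by
    refine (pi_norm_le_iff_of_nonneg (Real.sqrt_nonneg _)).2 fun I => ?_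
    refine Real.abs_le_sqrt ?_
    exact Finset.single_le_sum (f := fun I : Fin j → Fin n => (A fun a => stdVec n (I a)) ^ 2)
      (fun I _ => sq_nonneg _) (Finset.mem_univ I)
  have h3 : ‖A‖ ≤ K * √(∑ I : Fin j → Fin n, (A fun a => stdVec n (I a)) ^ 2) :=
    h1.trans (mul_le_mul_of_nonneg_left h2 K.2)
  calc ‖A‖ ^ 2 ≤ (K * √(∑ I : Fin j → Fin n, (A fun a => stdVec n (I a)) ^ 2)) ^ 2 := by gcongr
    _ = _ := by
      rw [mul_pow, Real.sq_sqrt (Finset.sum_nonneg fun I _ => sq_nonneg _)]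
theorem exists_abs_wedge_le {k l n : ℕ} (h : k + l = n) : ∃ K : ℝ, 0 < K ∧
    ∀ (A : Model n [⋀^Fin k]→L[ℝ] ℝ) (B : Model n [⋀^Fin l]→L[ℝ] ℝ),
      |wedge h A B (stdVec n)| ≤ K * (‖A‖ * ‖B‖) := by
  refine ⟨((k.factorial : ℝ) * l.factorial)⁻¹ *
    (Fintype.card (Equiv.Perm (Fin k ⊕ Fin l)) : ℕ), ?_, fun A B => ?_⟩
  · have : 0 < Fintype.card (Equiv.Perm (Fin k ⊕ Fin l)) := Fintype.card_pos
    positivity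
  · rw [wedge_eq_sum, abs_mul, abs_of_pos (by positivity : (0:ℝ) < ((k.factorial : ℝ) * l.factorial)⁻¹),
      mul_assoc]
    refine mul_le_mul_of_nonneg_left ?_ (by positivity)
    refine (Finset.abs_sum_le_sum_abs _ _).trans ((Finset.sum_le_card_nsmul _ _ (‖A‖ * ‖B‖)
      fun σ _ => ?_).trans (by simp))
    have h1 : |((Equiv.Perm.sign σ : ℤ) : ℝ)| = 1 := by
      rcases Int.units_eq_one_or (Equiv.Perm.sign σ) with h | h <;> simp [h]
    rw [abs_mul, h1, one_mul, wedgeSummand, abs_mul]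
    exact mul_le_mul (abs_apply_stdVec_le A _) (abs_apply_stdVec_le B _) (abs_nonneg _)
      (norm_nonneg _)
variable {n : ℕ} {M : Type*} [TopologicalSpace M] [ChartedSpace (Model n) M]
  [IsManifold (𝓡 n) ∞ M] [MeasurableSpace M] {g : Metric n M} {o : ManifoldOrientation n M}
namespace AdaptedFrame
variable (F : AdaptedFrame g o)
/-- A form read in the frame. -/
def pull {j : ℕ} (α : FormField n M j) (x : M) : Model n [⋀^Fin j]→L[ℝ] ℝ :=
  ContinuousAlternatingMap.compContinuousLinearMap (M' := Model n) (M := Model n)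
    (α x) (F.map x : Model n →L[ℝ] Model n)
/-- The form that is constantly `A` in the frame. -/
def push {j : ℕ} (A : Model n [⋀^Fin j]→L[ℝ] ℝ) : FormField n M j := fun x =>
  A.compContinuousLinearMap ((F.map x).symm : Model n →L[ℝ] Model n)
theorem pull_push {j : ℕ} (A : Model n [⋀^Fin j]→L[ℝ] ℝ) (x : M) : F.pull (F.push A) x = A := by
  ext v
  change A (fun a => (F.map x).symm (F.map x (v a))) = A v
  simp
theorem pull_injective {j : ℕ} {α β : FormField n M j} (h : ∀ x, F.pull α x = F.pull β x) :
    α = β := by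
  funext x
  let a : Model n [⋀^Fin j]→L[ℝ] ℝ := α x
  let b : Model n [⋀^Fin j]→L[ℝ] ℝ := β x
  change a = b
  ext v
  have h1 : a (fun i => F.map x ((F.map x).symm (v i))) =
      b (fun i => F.map x ((F.map x).symm (v i))) :=
    congrArg (fun A : Model n [⋀^Fin j]→L[ℝ] ℝ => A fun i => (F.map x).symm (v i)) (h x)
  simpa using h1
theorem wedgeDensity_eq {k l : ℕ} (h : k + l = n) (α : FormField n M k) (φ : FormField n M l)
    (x : M) : wedgeDensity g o h α φ x =
      F.density x * wedge h (F.pull α x) (F.pull φ x) (stdVec n) := by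
  rw [wedgeDensity, F.topDensity_eq]
  congr 1
  exact (wedge_compContinuousLinearMap (V := Model n) (V' := Model n) h (α x) (φ x)
    (F.map x : Model n →L[ℝ] Model n) (stdVec n)).symm
-- The frame is almost orthonormal with bounds independent of the point, so the length of a form is
-- uniformly equivalent to the operator norm of its expression in the frame.
theorem exists_comparison {j : ℕ} (hj : j ≤ n) : ∃ c C : ℝ, 0 < c ∧ 0 < C ∧
    ∀ (α : FormField n M j) (x : M), ‖F.pull α x‖ ≤ c * formNorm g x (α x) ∧
      formNorm g x (α x) ≤ C * ‖F.pull α x‖ := by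
  obtain ⟨K, hK, hKA⟩ := exists_norm_le_components j n
  have hf : (0 : ℝ) < j.factorial := by positivity
  refine ⟨√(2 * j.factorial * K), √(2 * ((j.factorial : ℝ)⁻¹ *
    (Fintype.card (Fin j → Fin n) : ℕ) )) + 1, by positivity, by positivity, fun α x => ?_⟩
  obtain ⟨h1, h2⟩ := F.norm_sq_comparison hj x (α x)
  set S := ∑ I : Fin j → Fin n, (α x fun a => F.map x (stdVec n (I a))) ^ 2 with hS
  have hS' : S = ∑ I : Fin j → Fin n, (F.pull α x fun a => stdVec n (I a)) ^ 2 := rfl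
  have hn := formNorm_nonneg g x (α x)
  constructor
  · have h3 := hKA (F.pull α x)
    rw [← hS'] at h3
    have h4 : ‖F.pull α x‖ ^ 2 ≤ 2 * j.factorial * K * formNorm g x (α x) ^ 2 := by
      have h5 : S ≤ 2 * j.factorial * formNorm g x (α x) ^ 2 := by
        have := mul_le_mul_of_nonneg_left h1 (by positivity : (0 : ℝ) ≤ 2 * j.factorial)
        refine le_trans (le_of_eq ?_) this
        field_simp
      nlinarith
    calc ‖F.pull α x‖ ≤ √(2 * j.factorial * K * formNorm g x (α x) ^ 2) :=
          Real.le_sqrt_of_sq_le h4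
      _ = _ := by rw [Real.sqrt_mul (by positivity), Real.sqrt_sq hn]
  · have h3 : S ≤ (Fintype.card (Fin j → Fin n) : ℕ) * ‖F.pull α x‖ ^ 2 := by
      rw [hS']
      refine (Finset.sum_le_card_nsmul _ _ (‖F.pull α x‖ ^ 2) fun I _ => ?_).trans (by simp)
      exact sq_le_sq' (abs_le.1 (abs_apply_stdVec_le (F.pull α x) I)).1
        (abs_le.1 (abs_apply_stdVec_le (F.pull α x) I)).2
    have h4 : formNorm g x (α x) ^ 2 ≤ 2 * ((j.factorial : ℝ)⁻¹ *
        (Fintype.card (Fin j → Fin n) : ℕ)) * ‖F.pull α x‖ ^ 2 := by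
      refine h2.trans ?_
      have := mul_le_mul_of_nonneg_left h3 (by positivity : (0 : ℝ) ≤ 2 * (j.factorial : ℝ)⁻¹)
      linarith
    calc formNorm g x (α x) ≤ √(2 * ((j.factorial : ℝ)⁻¹ *
          (Fintype.card (Fin j → Fin n) : ℕ)) * ‖F.pull α x‖ ^ 2) := Real.le_sqrt_of_sq_le h4
      _ = √(2 * ((j.factorial : ℝ)⁻¹ *
          (Fintype.card (Fin j → Fin n) : ℕ))) * ‖F.pull α x‖ := by
          rw [Real.sqrt_mul (by positivity), Real.sqrt_sq (norm_nonneg _)]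
      _ ≤ _ := by nlinarith [norm_nonneg (F.pull α x)]
-- Components determine a form linearly, so every functional of its expression in the frame is a
-- fixed linear combination of measurable components.
theorem measurable_functional {j : ℕ} {α : FormField n M j} (hα : IsMeasurableForm α)
    (ℓ : (Model n [⋀^Fin j]→L[ℝ] ℝ) →ₗ[ℝ] ℝ) : Measurable fun x => ℓ (F.pull α x) := by
  classical
  obtain ⟨r, hr⟩ := LinearMap.exists_leftInverse_of_injective (stdComponents j n)
    (LinearMap.ker_eq_bot.2 stdComponents_injective)
  have h1 : ∀ A, ℓ A = ∑ I, stdComponents j n A I *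
      (ℓ ∘ₗ r) fun J => if I = J then 1 else 0 := fun A => by
    have h2 := LinearMap.pi_apply_eq_sum_univ (ℓ ∘ₗ r) (stdComponents j n A)
    rw [LinearMap.comp_apply, ← LinearMap.comp_apply r, hr] at h2
    exact h2
  simp only [h1]
  exact Finset.measurable_fun_sum _ fun I _ =>
    (F.measurable_components hα I).mul_const _
theorem measurable_wedgeDensity (F : AdaptedFrame g o) {k l : ℕ} (h : k + l = n) {α : FormField n M k}
    {φ : FormField n M l} (hα : IsMeasurableForm α) (hφ : IsMeasurableForm φ) :
    Measurable (wedgeDensity g o h α φ) := by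
  have h1 : wedgeDensity g o h α φ = fun x =>
      F.density x * wedge h (F.pull α x) (F.pull φ x) (stdVec n) :=
    funext fun x => F.wedgeDensity_eq h α φ x
  rw [h1]
  refine F.measurable_density.mul ?_
  simp only [wedge_eq_sum]
  refine (Finset.measurable_fun_sum _ fun σ _ => ?_).const_mul _
  exact ((F.measurable_components hα _).mul (F.measurable_components hφ _)).const_mul _
theorem exists_abs_wedgeDensity_le (F : AdaptedFrame g o) {k l : ℕ} (h : k + l = n) : ∃ K : ℝ, 0 < K ∧
    ∀ (α : FormField n M k) (φ : FormField n M l) (x : M),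
      |wedgeDensity g o h α φ x| ≤ K * formNorm g x (α x) * formNorm g x (φ x) := by
  obtain ⟨K, hK, hw⟩ := exists_abs_wedge_le h
  obtain ⟨c, _, hc, _, h1⟩ := F.exists_comparison (show k ≤ n by omega)
  obtain ⟨d, _, hd, _, h2⟩ := F.exists_comparison (show l ≤ n by omega)
  refine ⟨2 * K * c * d, by positivity, fun α φ x => ?_⟩
  rw [F.wedgeDensity_eq, abs_mul]
  calc _ ≤ 2 * (K * (‖F.pull α x‖ * ‖F.pull φ x‖)) :=
        mul_le_mul (F.abs_density_le x) (hw _ _) (abs_nonneg _) (by norm_num)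
    _ ≤ 2 * (K * ((c * formNorm g x (α x)) * (d * formNorm g x (φ x)))) := by
        have := mul_le_mul (h1 α x).1 (h2 φ x).1 (norm_nonneg _)
          (mul_nonneg hc.le (formNorm_nonneg _ _ _))
        gcongr
    _ = _ := by ring
end AdaptedFrame
theorem wedgeDensity_comm {k l : ℕ} (h : k + l = n) (h' : l + k = n) (α : FormField n M k)
    (φ : FormField n M l) : wedgeDensity g o h' φ α =
      ((wedgeSign k l : ℤ) : ℝ) • wedgeDensity g o h α φ := by
  funext x
  rw [Pi.smul_apply, wedgeDensity, wedgeDensity, topDensity, topDensity,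
    wedge_comm h h' (α x) (φ x) (stdFrame x), smul_eq_mul]
  ring
theorem wedgeIntegral_comm {k l : ℕ} (h : k + l = n) (h' : l + k = n) (α : FormField n M k)
    (φ : FormField n M l) : wedgeIntegral g o h' φ α =
      ((wedgeSign k l : ℤ) : ℝ) * wedgeIntegral g o h α φ := by
  rw [wedgeIntegral, wedgeDensity_comm h h']
  exact integral_const_mul _ _
theorem wedgeDensity_add_right {k l : ℕ} (h : k + l = n) (α : FormField n M k)
    (φ ψ : FormField n M l) :
    wedgeDensity g o h α (φ + ψ) = wedgeDensity g o h α φ + wedgeDensity g o h α ψ := by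
  funext x
  simp only [wedgeDensity, Pi.add_apply, topDensity, wedge_add_right h (α x) (φ x) (ψ x)]
  ring
theorem wedgeDensity_smul_right {k l : ℕ} (h : k + l = n) (c : ℝ) (α : FormField n M k)
    (φ : FormField n M l) : wedgeDensity g o h α (c • φ) = c • wedgeDensity g o h α φ := by
  funext x
  simp only [wedgeDensity, Pi.smul_apply, topDensity, wedge_smul_right h c (α x) (φ x),
    smul_eq_mul]
  ring
end PointwiseDuality

/-! ### Perfectness of the pairing of L^p forms -/

section LpDuality
theorem holderConjugate_toReal {p q : ℝ≥0∞} (hp : 1 < p) (hp' : p < ⊤) (hpq : q⁻¹ + p⁻¹ = 1) :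
    p.toReal.HolderConjugate q.toReal ∧ ENNReal.ofReal p.toReal = p ∧
      ENNReal.ofReal q.toReal = q := by
  have hpq' : p⁻¹ + q⁻¹ = 1 := by rw [add_comm]; exact hpq
  have : p.HolderConjugate q := ENNReal.holderConjugate_iff.2 hpq'
  have h1 : 1 < p.toReal := by
    rw [← ENNReal.toReal_one]
    exact (ENNReal.toReal_lt_toReal (by simp) hp'.ne).2 hp
  have hq : q ≠ ⊤ := by
    rintro rfl
    rw [ENNReal.inv_top, add_zero, ENNReal.inv_eq_one] at hpq'
    exact hp.ne' hpq'
  exact ⟨ENNReal.HolderConjugate.toReal h1, ENNReal.ofReal_toReal hp'.ne, ENNReal.ofReal_toReal hq⟩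
theorem exists_dual_function_ennreal {α : Type*} [MeasurableSpace α] {μ : Measure α} [SigmaFinite μ]
    {p q : ℝ≥0∞} (hp : 1 < p) (hp' : p < ⊤) (hpq : q⁻¹ + p⁻¹ = 1)
    (F : measMemLp p μ →ₗ[ℝ] ℝ) (C : ℝ) (hC : 0 ≤ C)
    (hF : ∀ u, |F u| ≤ C * (eLpNorm u.1 p μ).toReal) :
    ∃ h : α → ℝ, Measurable h ∧ eLpNorm h q μ ≤ ENNReal.ofReal C ∧
      ∀ u, F u = ∫ x, u.1 x * h x ∂μ := by
  obtain ⟨h, h1, h2⟩ := holderConjugate_toReal hp hp' hpq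
  -- Once the real exponents are variables, p and q can be eliminated in favour of their images
  -- under `ENNReal.ofReal`.
  generalize p.toReal = P at h h1
  generalize q.toReal = Q at h h2
  subst h1 h2
  exact exists_dual_function h F C hC hF
theorem IsMeasurableForm.mulForm {n : ℕ} {M : Type*} [TopologicalSpace M] [ChartedSpace (Model n) M]
    [MeasurableSpace M] [BorelSpace M] {j : ℕ} {u : M → ℝ}
    (hu : Measurable u) {α : FormField n M j} (hα : IsMeasurableForm α) :
    IsMeasurableForm (mulForm u α) := by
  intro x₀ v
  have h1 : Measurable fun y : (extChartAt (𝓡 n) x₀).target =>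
      u ((extChartAt (𝓡 n) x₀).symm y) :=
    hu.comp (continuousOn_iff_continuous_domRestrict.1
      (continuousOn_extChartAt_symm x₀)).measurable
  exact h1.mul (hα x₀ v)
variable {n : ℕ} {M : Type*} [TopologicalSpace M] [ChartedSpace (Model n) M]
  [IsManifold (𝓡 n) ∞ M] [SecondCountableTopology M] [MeasurableSpace M] [BorelSpace M]
  {g : Metric n M} {o : ManifoldOrientation n M}
theorem LpForm.eLpNorm_lt_top {p : Exponent} {j : ℕ} (α : LpForm g p j) :
    eLpNorm (fun x => formNorm g x (α.form x)) p (riemannianMeasure g) < ⊤ := α.2.2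
theorem LpForm.measurable {p : Exponent} {j : ℕ} (α : LpForm g p j) :
    IsMeasurableForm α.form := α.2.1
theorem LpForm.ext {p : Exponent} {j : ℕ} {α β : LpForm g p j} (h : α.form = β.form) : α = β :=
  Subtype.ext h
/-- The underlying form, as a linear map. -/
def LpForm.formHom (g : Metric n M) (p : Exponent) (j : ℕ) : LpForm g p j →ₗ[ℝ] FormField n M j where
  toFun α := α.form
  map_add' _ _ := rfl
  map_smul' _ _ := rfl
theorem LpForm.form_sum {p : Exponent} {j : ℕ} {ι : Type*} (s : Finset ι) (α : ι → LpForm g p j) :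
    (∑ i ∈ s, α i).form = ∑ i ∈ s, (α i).form := map_sum (LpForm.formHom g p j) α s
-- Hölder's inequality after the pointwise bound |α ∧ φ| ≤ K |α| |φ|. The constant is pointwise,
-- hence common to all exponents.
theorem exists_integrable_wedgeDensity (g : Metric n M) (o : ManifoldOrientation n M) {k l : ℕ}
    (h : k + l = n) : ∃ K : ℝ, 0 ≤ K ∧ ∀ (p q : Exponent), (q : ℝ≥0∞)⁻¹ + (p : ℝ≥0∞)⁻¹ = 1 →
      ∀ (α : LpForm g p k) (φ : LpForm g q l),
        Integrable (wedgeDensity g o h α.form φ.form) (riemannianMeasure g) ∧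
        |wedgeIntegral g o h α.form φ.form| ≤ K * ‖α‖ * ‖φ‖ := by
  obtain ⟨F⟩ := exists_adaptedFrame g o
  obtain ⟨K, hK, hle⟩ := F.exists_abs_wedgeDensity_le h
  refine ⟨K, hK.le, fun p q hpq α φ => ?_⟩
  have : (p : ℝ≥0∞).HolderConjugate q := ENNReal.holderConjugate_iff.2 (by rw [add_comm]; exact hpq)
  have hm := F.measurable_wedgeDensity h α.measurable φ.measurable
  have h1 : eLpNorm (fun x => formNorm g x (α.form x) * formNorm g x (φ.form x)) 1
      (riemannianMeasure g) ≤ (1 : NNReal) * eLpNorm (fun x => formNorm g x (α.form x)) p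
        (riemannianMeasure g) * eLpNorm (fun x => formNorm g x (φ.form x)) q
        (riemannianMeasure g) :=
    eLpNorm_le_eLpNorm_mul_eLpNorm_of_nnnorm
      (measurable_formNorm g α.measurable).aestronglyMeasurable
      (measurable_formNorm g φ.measurable).aestronglyMeasurable (fun a b => a * b) 1
      (Eventually.of_forall fun x => by simp)
  have h2 : eLpNorm (wedgeDensity g o h α.form φ.form) 1 (riemannianMeasure g) ≤
      ENNReal.ofReal K * (eLpNorm (fun x => formNorm g x (α.form x)) p
        (riemannianMeasure g) * eLpNorm (fun x => formNorm g x (φ.form x)) q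
        (riemannianMeasure g)) := by
    have h3 : eLpNorm (wedgeDensity g o h α.form φ.form) 1 (riemannianMeasure g) ≤
        eLpNorm (K • fun x => formNorm g x (α.form x) * formNorm g x (φ.form x)) 1
          (riemannianMeasure g) := by
      refine eLpNorm_mono_real fun x => ?_
      refine (hle α.form φ.form x).trans (le_of_eq ?_)
      simp only [Pi.smul_apply, smul_eq_mul]
      ring
    refine h3.trans ?_
    rw [eLpNorm_const_smul, ← ofReal_norm, Real.norm_of_nonneg hK.le]
    gcongr
    simpa using h1
  have hfin := ENNReal.mul_lt_top (ENNReal.ofReal_lt_top (r := K))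
    (ENNReal.mul_lt_top α.eLpNorm_lt_top φ.eLpNorm_lt_top)
  refine ⟨memLp_one_iff_integrable.1 ⟨hm.aestronglyMeasurable, h2.trans_lt hfin⟩, ?_⟩
  have h4 : ‖wedgeIntegral g o h α.form φ.form‖ₑ ≤ _ :=
    (enorm_integral_le_lintegral_enorm _).trans
      ((eLpNorm_one_eq_lintegral_enorm (μ := riemannianMeasure g)).symm.le.trans h2)
  have h5 := ENNReal.toReal_mono hfin.ne h4
  rw [toReal_enorm, ENNReal.toReal_mul, ENNReal.toReal_mul, ENNReal.toReal_ofReal hK.le,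
    ← mul_assoc] at h5
  exact h5
namespace AdaptedFrame
variable (F : AdaptedFrame g o)
theorem pull_mulForm {j : ℕ} (u : M → ℝ) (α : FormField n M j) (x : M) :
    F.pull (mulForm u α) x = u x • F.pull α x := rfl
theorem pull_sum {j : ℕ} {ι : Type*} (s : Finset ι) (α : ι → FormField n M j) (x : M) :
    F.pull (∑ i ∈ s, α i) x = ∑ i ∈ s, F.pull (α i) x := by
  let T : FormField n M j →+ (Model n [⋀^Fin j]→L[ℝ] ℝ) :=
    ⟨⟨fun α => F.pull α x, rfl⟩, fun _ _ => rfl⟩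
  exact map_sum T α s
-- Multiples of a form that is constant in the frame have length comparable to |u| ‖A‖; these are
-- the building blocks through which scalar functions enter.
theorem memLp_form {j : ℕ} (hj : j ≤ n) : ∃ C : ℝ, 0 ≤ C ∧ ∀ (p : Exponent)
    (A : Model n [⋀^Fin j]→L[ℝ] ℝ) (u : M → ℝ), Measurable u →
      IsMeasurableForm (mulForm u (F.push A)) ∧
      eLpNorm (fun x => formNorm g x (mulForm u (F.push A) x)) p (riemannianMeasure g) ≤
        ENNReal.ofReal (C * ‖A‖) * eLpNorm u p (riemannianMeasure g) := by
  obtain ⟨_, C, _, hC, h1⟩ := F.exists_comparison hj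
  refine ⟨C, hC.le, fun p A u hu => ⟨(F.measurable_pullback A).mulForm hu, ?_⟩⟩
  have h3 : eLpNorm (fun x => formNorm g x (mulForm u (F.push A) x)) p (riemannianMeasure g) ≤
      eLpNorm ((C * ‖A‖) • fun x => |u x|) p (riemannianMeasure g) := by
    refine eLpNorm_mono_real fun x => ?_
    rw [Real.norm_of_nonneg (formNorm_nonneg _ _ _)]
    refine (h1 _ x).2.trans (le_of_eq ?_)
    rw [F.pull_mulForm, F.pull_push, norm_smul, Pi.smul_apply, smul_eq_mul, Real.norm_eq_abs]
    ring
  refine h3.trans (le_of_eq ?_)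
  rw [eLpNorm_const_smul, ← ofReal_norm, Real.norm_of_nonneg (by positivity)]
  congr 1
  exact eLpNorm_norm u
end AdaptedFrame
/-- Every continuous functional on the `p`-integrable `k`-forms is the integral of the wedge product
with a form that is integrable for the conjugate exponent. -/
theorem exists_representing_form (g : Metric n M) (o : ManifoldOrientation n M) {k l : ℕ}
    (h : k + l = n) : ∃ K : ℝ, 0 ≤ K ∧ ∀ (p q : Exponent), 1 < (p : ℝ≥0∞) → (p : ℝ≥0∞) < ⊤ →
      (q : ℝ≥0∞)⁻¹ + (p : ℝ≥0∞)⁻¹ = 1 → ∀ f : StrongDual ℝ (LpForm g p k),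
        ∃ φ : LpForm g q l, ‖φ‖ ≤ K * ‖f‖ ∧ ∀ α, f α = wedgeIntegral g o h α.form φ.form := by
  obtain ⟨F⟩ := exists_adaptedFrame g o
  obtain ⟨N, a, c, hac⟩ := exists_dual_forms h
  obtain ⟨C₁, hC₁, hk⟩ := F.memLp_form (show k ≤ n by omega)
  obtain ⟨C₂, hC₂, hl⟩ := F.memLp_form (show l ≤ n by omega)
  obtain ⟨c₁, _, hc₁, _, hcomp⟩ := F.exists_comparison (show k ≤ n by omega)
  refine ⟨∑ i, C₂ * ‖c i‖ * 2 * (C₁ * ‖a i‖), by positivity, fun p q hp hp' hpq f => ?_⟩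
  -- the functional on the multiples of the basis forms
  let S : Fin N → (measMemLp (p : ℝ≥0∞) (riemannianMeasure g) →ₗ[ℝ] LpForm g p k) := fun i =>
    { toFun := fun u => (⟨mulForm u.1 (F.push (a i)), (hk p (a i) u.1 u.2.1).1,
        (hk p (a i) u.1 u.2.1).2.trans_lt (ENNReal.mul_lt_top ENNReal.ofReal_lt_top u.2.2.2)⟩ :
          pIntegrableForms g p k)
      map_add' := fun u v => LpForm.ext (funext fun x => add_smul _ _ _)
      map_smul' := fun r u => LpForm.ext (funext fun x => mul_smul _ _ _) }
  have hS : ∀ i u, (S i u).form = mulForm u.1 (F.push (a i)) := fun i u => rfl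
  have hSn : ∀ i u, ‖S i u‖ ≤ C₁ * ‖a i‖ * (eLpNorm u.1 p (riemannianMeasure g)).toReal := by
    intro i u
    rw [LpForm.norm_def, hS]
    have := ENNReal.toReal_mono (ENNReal.mul_lt_top ENNReal.ofReal_lt_top u.2.2.2).ne
      (hk p (a i) u.1 u.2.1).2
    rwa [ENNReal.toReal_mul, ENNReal.toReal_ofReal (by positivity)] at this
  have hrep : ∀ i, ∃ w : M → ℝ, Measurable w ∧ eLpNorm w q (riemannianMeasure g) ≤
      ENNReal.ofReal (‖f‖ * (C₁ * ‖a i‖)) ∧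
      ∀ u, f (S i u) = ∫ x, u.1 x * w x ∂riemannianMeasure g := by
    intro i
    refine exists_dual_function_ennreal hp hp' hpq (f.toLinearMap ∘ₗ S i) _ (by positivity)
      fun u => ?_
    calc |f (S i u)| ≤ ‖f‖ * ‖S i u‖ := f.le_opNorm _
      _ ≤ ‖f‖ * (C₁ * ‖a i‖ * (eLpNorm u.1 p (riemannianMeasure g)).toReal) := by
          gcongr
          exact hSn i u
      _ = _ := by ring
  choose w hwm hwn hw using hrep
  have hd0 : ∀ x, F.density x ≠ 0 := fun x h0 => by
    have := F.le_abs_density x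
    rw [h0, abs_zero] at this
    norm_num at this
  -- The factor `F.density` by which the integrand differs from the wedge product in the frame must
  -- be divided out; it is bounded away from 0.
  have hdm : ∀ i, Measurable fun x => w i x / F.density x := fun i =>
    (hwm i).div F.measurable_density
  have hdn : ∀ i, eLpNorm (fun x => w i x / F.density x) q (riemannianMeasure g) ≤
      ENNReal.ofReal (2 * (‖f‖ * (C₁ * ‖a i‖))) := by
    intro i
    have h1 : eLpNorm (fun x => w i x / F.density x) q (riemannianMeasure g) ≤
        eLpNorm ((2 : ℝ) • fun x => |w i x|) q (riemannianMeasure g) := by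
      refine eLpNorm_mono_real fun x => ?_
      rw [Real.norm_eq_abs, abs_div, Pi.smul_apply, smul_eq_mul,
        div_le_iff₀ (abs_pos.2 (hd0 x))]
      nlinarith [F.le_abs_density x, abs_nonneg (w i x)]
    refine h1.trans ?_
    rw [eLpNorm_const_smul, ← ofReal_norm, Real.norm_of_nonneg (by norm_num),
      ENNReal.ofReal_mul (by norm_num)]
    gcongr
    exact (eLpNorm_norm (w i)).le.trans (hwn i)
  let φi : Fin N → LpForm g q l := fun i =>
    (⟨mulForm (fun x => w i x / F.density x) (F.push (c i)), (hl q (c i) _ (hdm i)).1,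
      (hl q (c i) _ (hdm i)).2.trans_lt (ENNReal.mul_lt_top ENNReal.ofReal_lt_top
        ((hdn i).trans_lt ENNReal.ofReal_lt_top))⟩ : pIntegrableForms g q l)
  have hφi : ∀ i, (φi i).form = mulForm (fun x => w i x / F.density x) (F.push (c i)) :=
    fun i => rfl
  have hφn : ∀ i, ‖φi i‖ ≤ C₂ * ‖c i‖ * 2 * (C₁ * ‖a i‖) * ‖f‖ := by
    intro i
    rw [LpForm.norm_def, hφi]
    have h1 := (hl q (c i) _ (hdm i)).2.trans (mul_le_mul_right (hdn i) _)
    have := ENNReal.toReal_mono (ENNReal.mul_lt_top ENNReal.ofReal_lt_top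
      ENNReal.ofReal_lt_top).ne h1
    rw [ENNReal.toReal_mul, ENNReal.toReal_ofReal (by positivity),
      ENNReal.toReal_ofReal (by positivity)] at this
    refine this.trans (le_of_eq ?_)
    ring
  refine ⟨∑ i, φi i, ?_, fun α => ?_⟩
  · rw [Finset.sum_mul]
    exact (norm_sum_le _ _).trans (Finset.sum_le_sum fun i _ => hφn i)
  · -- the coefficients of the form
    have hum : ∀ i, Measurable fun x => a.repr (F.pull α.form x) i := fun i =>
      F.measurable_functional α.measurable (a.coord i)
    have hun : ∀ i, MemLp (fun x => a.repr (F.pull α.form x) i) p (riemannianMeasure g) := by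
      intro i
      refine ⟨(hum i).aestronglyMeasurable, ?_⟩
      let ℓ : (Model n [⋀^Fin k]→L[ℝ] ℝ) →L[ℝ] ℝ := LinearMap.toContinuousLinearMap (a.coord i)
      have h1 : eLpNorm (fun x => a.repr (F.pull α.form x) i) p (riemannianMeasure g) ≤
          eLpNorm ((‖ℓ‖ * c₁) • fun x => formNorm g x (α.form x)) p (riemannianMeasure g) := by
        refine eLpNorm_mono_real fun x => ?_
        calc ‖a.repr (F.pull α.form x) i‖ = ‖ℓ (F.pull α.form x)‖ := rfl
          _ ≤ ‖ℓ‖ * ‖F.pull α.form x‖ := ℓ.le_opNorm _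
          _ ≤ ‖ℓ‖ * (c₁ * formNorm g x (α.form x)) := by
              gcongr
              exact (hcomp α.form x).1
          _ = _ := by
              rw [Pi.smul_apply, smul_eq_mul]
              ring
      refine h1.trans_lt ?_
      rw [eLpNorm_const_smul]
      exact ENNReal.mul_lt_top enorm_lt_top α.eLpNorm_lt_top
    let u : Fin N → measMemLp (p : ℝ≥0∞) (riemannianMeasure g) := fun i =>
      ⟨fun x => a.repr (F.pull α.form x) i, hum i, hun i⟩
    -- Expansion of α in the basis of forms constant in the frame, with coefficients in L^p.
    have hα : α = ∑ i, S i (u i) := by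
      refine LpForm.ext ?_
      rw [LpForm.form_sum]
      refine F.pull_injective fun x => ?_
      rw [F.pull_sum]
      simp only [hS, F.pull_mulForm, F.pull_push]
      exact (a.sum_repr _).symm
    have hint : ∀ i, Integrable (fun x => a.repr (F.pull α.form x) i * w i x)
        (riemannianMeasure g) := by
      intro i
      have : (p : ℝ≥0∞).HolderConjugate q :=
        ENNReal.holderConjugate_iff.2 (by rw [add_comm]; exact hpq)
      exact (hun i).integrable_mul
        ⟨(hwm i).aestronglyMeasurable, (hwn i).trans_lt ENNReal.ofReal_lt_top⟩
    conv_lhs => rw [hα]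
    rw [map_sum]
    simp only [hw]
    rw [← integral_finsetSum _ fun i _ => hint i, wedgeIntegral]
    refine integral_congr_ae (Eventually.of_forall fun x => ?_)
    rw [F.wedgeDensity_eq, LpForm.form_sum, F.pull_sum]
    simp only [hφi, F.pull_mulForm, F.pull_push]
    -- The forms c i are dual to the basis a, so the wedge product with the i-th summand of φ
    -- extracts the i-th coefficient of α.
    rw [← wedgePairing_apply, map_sum, Finset.mul_sum]
    refine Finset.sum_congr rfl fun i _ => ?_
    rw [map_smul, wedgePairing_apply, hac, smul_eq_mul]
    have := hd0 x
    field_simp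
/-- The pairing `∫ α ∧ φ` of forms with conjugate exponents. -/
def formPairing (g : Metric n M) (o : ManifoldOrientation n M) {k l : ℕ} (h : k + l = n)
    {p q : Exponent} (hpq : (q : ℝ≥0∞)⁻¹ + (p : ℝ≥0∞)⁻¹ = 1) :
    LpForm g p k →L[ℝ] StrongDual ℝ (LpForm g q l) :=
  LinearMap.mkContinuous₂
    (LinearMap.mk₂ ℝ (fun α φ => wedgeIntegral g o h α.form φ.form)
      (fun α β φ => by
        have H := (exists_integrable_wedgeDensity g o h).choose_spec.2 p q hpq
        rw [LpForm.form_add, wedgeIntegral, wedgeDensity_add]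
        exact integral_add' (H α φ).1 (H β φ).1)
      (fun c α φ => by
        rw [LpForm.form_smul, wedgeIntegral, wedgeDensity_smul]
        exact integral_const_mul _ _)
      (fun α φ ψ => by
        have H := (exists_integrable_wedgeDensity g o h).choose_spec.2 p q hpq
        rw [LpForm.form_add, wedgeIntegral, wedgeDensity_add_right]
        exact integral_add' (H α φ).1 (H α ψ).1)
      (fun c α φ => by
        rw [LpForm.form_smul, wedgeIntegral, wedgeDensity_smul_right]
        exact integral_const_mul _ _))
    (exists_integrable_wedgeDensity g o h).choose
    fun α φ => ((exists_integrable_wedgeDensity g o h).choose_spec.2 p q hpq α φ).2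
theorem formPairing_apply (g : Metric n M) (o : ManifoldOrientation n M) {k l : ℕ} (h : k + l = n)
    {p q : Exponent} (hpq : (q : ℝ≥0∞)⁻¹ + (p : ℝ≥0∞)⁻¹ = 1) (α : LpForm g p k)
    (φ : LpForm g q l) :
    formPairing g o h hpq α φ = wedgeIntegral g o h α.form φ.form := rfl
theorem integrable_wedgeDensity (g : Metric n M) (o : ManifoldOrientation n M) {k l : ℕ}
    (h : k + l = n) {p q : Exponent} (hpq : (q : ℝ≥0∞)⁻¹ + (p : ℝ≥0∞)⁻¹ = 1) (α : LpForm g p k)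
    (φ : LpForm g q l) :
    Integrable (wedgeDensity g o h α.form φ.form) (riemannianMeasure g) := by
  obtain ⟨K, -, H⟩ := exists_integrable_wedgeDensity g o h
  exact (H p q hpq α φ).1
/-- Functionals on the forms integrable for `q` are represented by forms integrable for the
conjugate exponent. -/
theorem exists_formPairing_eq (g : Metric n M) (o : ManifoldOrientation n M) {k l : ℕ}
    (h : k + l = n) {p q : Exponent} (hpq : (q : ℝ≥0∞)⁻¹ + (p : ℝ≥0∞)⁻¹ = 1)
    (hq : 1 < (q : ℝ≥0∞)) (hq' : (q : ℝ≥0∞) < ⊤) :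
    ∃ K : ℝ, 0 ≤ K ∧ ∀ f : StrongDual ℝ (LpForm g q l), ∃ α : LpForm g p k,
      ‖α‖ ≤ K * ‖f‖ ∧ formPairing g o h hpq α = f := by
  have h' : l + k = n := by omega
  obtain ⟨K, hK, H⟩ := exists_representing_form g o h'
  refine ⟨K, hK, fun f => ?_⟩
  obtain ⟨α, hα, hf⟩ := H q p hq hq' (by rw [add_comm]; exact hpq) f
  refine ⟨((wedgeSign k l : ℤ) : ℝ) • α, ?_, ?_⟩
  · have : |((wedgeSign k l : ℤ) : ℝ)| = 1 := by
      rcases Int.units_eq_one_or (wedgeSign k l) with h | h <;> simp [h]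
    rw [norm_smul, Real.norm_eq_abs, this, one_mul]
    exact hα
  · ext φ
    rw [map_smul, hf φ, wedgeIntegral_comm h h']
    rfl
end LpDuality

/-! ## Test forms and Stokes' theorem -/
section Stokes
-- Extension by zero gives a C¹ function with compact support on the whole space, and integration by
-- parts against the constant 1 leaves nothing.
theorem integral_fderiv_apply_eq_zero {E : Type*} [NormedAddCommGroup E] [NormedSpace ℝ E]
    [FiniteDimensional ℝ E] [MeasurableSpace E] [BorelSpace E] {μ : Measure E}
    [μ.IsAddHaarMeasure] {s K : Set E} (hs : IsOpen s) (hK : IsCompact K) (hKs : K ⊆ s) {f : E → ℝ}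
    (hf : ContDiffOn ℝ 1 f s) (h0 : ∀ y ∈ s, y ∉ K → f y = 0) (v : E) :
    IntegrableOn (fun y => fderiv ℝ f y v) s μ ∧ ∫ y in s, fderiv ℝ f y v ∂μ = 0 := by
  set F : E → ℝ := s.indicator f with hF
  have hFs : ∀ y ∈ s, F =ᶠ[𝓝 y] f := fun y hy => by
    filter_upwards [hs.mem_nhds hy] with z hz
    exact indicator_of_mem hz f
  have hFK : ∀ y ∉ K, F y = 0 := fun y hy => by
    by_cases h : y ∈ s
    · rw [hF, indicator_of_mem h, h0 y h hy]
    · exact indicator_of_notMem h f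
  have hFK' : ∀ y ∉ K, F =ᶠ[𝓝 y] fun _ => 0 := fun y hy => by
    filter_upwards [hK.isClosed.isOpen_compl.mem_nhds hy] with z hz
    exact hFK z hz
  have hC : ContDiff ℝ 1 F := by
    refine contDiff_iff_contDiffAt.2 fun y => ?_
    by_cases h : y ∈ s
    · exact (hf.contDiffAt (hs.mem_nhds h)).congr_of_eventuallyEq (hFs y h)
    · exact contDiffAt_const.congr_of_eventuallyEq (hFK' y fun hy => h (hKs hy))
  have hsupp : HasCompactSupport F := HasCompactSupport.intro hK hFK
  have hcont : Continuous fun y => fderiv ℝ F y v :=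
    (hC.continuous_fderiv (by simp)).clm_apply continuous_const
  have hint : Integrable (fun y => fderiv ℝ F y v) μ :=
    hcont.integrable_of_hasCompactSupport (hsupp.fderiv_apply ℝ v)
  have hzero : ∫ y, fderiv ℝ F y v ∂μ = 0 := by
    have hFi : Integrable F μ := hC.continuous.integrable_of_hasCompactSupport hsupp
    have := integral_mul_fderiv_eq_neg_fderiv_mul_of_integrable (μ := μ) (f := fun _ : E => (1 : ℝ))
      (g := F) (v := v) (by simp) (by simpa using hint) (by simpa using hFi)
      (fun x _ => differentiableAt_const _) (fun x _ => hC.differentiable (by simp) x)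
    simpa using this
  have hcongr : ∀ y ∈ s, fderiv ℝ F y v = fderiv ℝ f y v := fun y hy => by
    rw [(hFs y hy).fderiv_eq]
  constructor
  · exact (hint.integrableOn (s := s)).congr_fun hcongr hs.measurableSet
  · rw [← setIntegral_congr_fun hs.measurableSet hcongr,
      setIntegral_eq_integral_of_forall_compl_eq_zero, hzero]
    intro y hy
    rw [(hFK' y fun h => hy (hKs h)).fderiv_eq]
    simp
variable {n : ℕ} {M : Type*} [TopologicalSpace M] [ChartedSpace (Model n) M]
  [IsManifold (𝓡 n) ∞ M] {g : Metric n M} {o : ManifoldOrientation n M}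
-- A nonzero determinant would not be enough, since the square root of a negative number is 0.
-- Relative to an orthonormal frame the Gram determinant is the square of a nonzero determinant.
theorem volDensity_ne_zero (g : Metric n M) {x₀ : M} {y : Model n}
    (hy : y ∈ (extChartAt (𝓡 n) x₀).target) : volDensity g x₀ y ≠ 0 := by
  set x := (extChartAt (𝓡 n) x₀).symm y with hx
  obtain ⟨e, he⟩ := exists_orthonormal_frame g x
  let e' : Fin n → Model n := e
  let T : Model n →L[ℝ] Model n := ∑ i, (EuclideanSpace.proj i : Model n →L[ℝ] ℝ).smulRight (e' i)
  have hT : ∀ i, T (stdVec n i) = e' i := fun i => by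
    simp [T, stdVec_apply, sum_apply]
  let B : Model n →L[ℝ] Model n →L[ℝ] ℝ := g.inner x
  have hTe : gramMatrix B (fun i => T (stdVec n i)) = 1 := by
    rw [funext hT]
    exact he
  have hTd : T.det ≠ 0 := by
    refine det_ne_zero_of_gramMatrix (V := Model n) B (ContinuousLinearMap.id ℝ _) T ?_
    change (gramMatrix B fun i => T (stdVec n i)).det ≠ 0
    rw [hTe]
    simp
  let C : Model n →L[ℝ] Model n := coordMap x₀ y
  let R : Model n →ₗ[ℝ] Model n :=
    ((ContinuousLinearMap.toContinuousLinearEquivOfDetNeZero T hTd).symm :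
      Model n →L[ℝ] Model n).toLinearMap ∘ₗ C.toLinearMap
  have hTR : ∀ v, T (R v) = C v := fun v =>
    (ContinuousLinearMap.toContinuousLinearEquivOfDetNeZero T hTd).apply_symm_apply (C v)
  have hR : LinearMap.det R ≠ 0 := by
    have h1 : LinearMap.det T.toLinearMap * LinearMap.det R = C.det := by
      rw [← LinearMap.det_comp]
      exact congrArg LinearMap.det (LinearMap.ext hTR)
    intro h
    rw [h, mul_zero] at h1
    exact coordMap_det_ne_zero hy h1.symm
  have h2 := gramMatrix_comp_det B T.toLinearMap R
  have h3 : (gramMatrix B fun i => C (EuclideanSpace.basisFun (Fin n) ℝ i)).det =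
      LinearMap.det R ^ 2 := by
    rw [← mul_one (LinearMap.det R ^ 2), ← Matrix.det_one (n := Fin n), ← hTe]
    refine Eq.trans ?_ h2
    congr 2
    funext i
    exact (hTR _).symm
  have h4 : volDensity g x₀ y = √(LinearMap.det R ^ 2) := congrArg Real.sqrt h3
  rw [h4, Real.sqrt_sq_eq_abs]
  exact abs_ne_zero.2 hR
-- The root of the Gram determinant in the measure cancels the one in the density of an n-form. Up
-- to an orientation sign, the metric disappears from ∫ α ∧ φ.
theorem volDensity_mul_wedgeDensity (g : Metric n M) (o : ManifoldOrientation n M) {k l : ℕ}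
    (h : k + l = n) (α : FormField n M k) (φ : FormField n M l) {x₀ : M} {y : Model n}
    (hy : y ∈ (extChartAt (𝓡 n) x₀).target) :
    volDensity g x₀ y * wedgeDensity g o h α φ ((extChartAt (𝓡 n) x₀).symm y) =
      orientationSign o ((extChartAt (𝓡 n) x₀).symm y) *
        Real.sign (coordMap x₀ y : Model n →L[ℝ] Model n).det *
        wedge h (chartRep x₀ α y) (chartRep x₀ φ y) (stdVec n) := by
  have h1 := topDensity_frame g o _ (coordMap x₀ y) (coordMap_det_ne_zero hy)
    (wedge h (α ((extChartAt (𝓡 n) x₀).symm y)) (φ ((extChartAt (𝓡 n) x₀).symm y)))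
  have h2 := wedge_compContinuousLinearMap h (α ((extChartAt (𝓡 n) x₀).symm y))
    (φ ((extChartAt (𝓡 n) x₀).symm y)) (coordMap x₀ y) (stdVec n)
  have h3 := volDensity_ne_zero g hy
  have h4 : wedge h (chartRep x₀ α y) (chartRep x₀ φ y) (stdVec n) = _ := h2
  rw [wedgeDensity, h1, h4]
  exact mul_div_cancel₀ _ h3
/-- Evaluation of forms on fixed vectors. -/
def evalCLM {j : ℕ} (v : Fin j → Model n) : (Model n [⋀^Fin j]→L[ℝ] ℝ) →L[ℝ] ℝ :=
  LinearMap.toContinuousLinearMap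
    { toFun := fun A => A v
      map_add' := fun _ _ => rfl
      map_smul' := fun _ _ => rfl }
theorem evalCLM_apply {j : ℕ} (v : Fin j → Model n) (A : Model n [⋀^Fin j]→L[ℝ] ℝ) :
    evalCLM v A = A v := rfl
theorem extD_eq_zero_of_notMem {j : ℕ} {α : FormField n M j} {x : M}
    (hx : x ∉ closure {x | α x ≠ 0}) : extD α x = 0 := by
  by_contra h
  exact hx (ne_zero_mem_of_extD α h)
theorem chartRep_eq_zero {j : ℕ} {α : FormField n M j} {x₀ : M} {y : Model n}
    (h : α ((extChartAt (𝓡 n) x₀).symm y) = 0) : chartRep x₀ α y = 0 := by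
  rw [chartRep, h]
  rfl
theorem wedge_zero_left {k l : ℕ} (h : k + l = n) (B : Model n [⋀^Fin l]→L[ℝ] ℝ)
    (v : Fin n → Model n) : wedge h (0 : Model n [⋀^Fin k]→L[ℝ] ℝ) B v = 0 := by
  have := congrArg (fun η : Model n [⋀^Fin n]→ₗ[ℝ] ℝ => η v) (wedge_smul h (0 : ℝ) 0 B)
  simpa using this
theorem wedgeDensity_eq_zero_left {k l : ℕ} (h : k + l = n) {α : FormField n M k}
    (φ : FormField n M l) {x : M} (hx : α x = 0) : wedgeDensity g o h α φ x = 0 := by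
  rw [wedgeDensity, topDensity, hx]
  have : wedge h (0 : (TangentSpace (𝓡 n) x) [⋀^Fin k]→L[ℝ] ℝ) (φ x) (stdFrame x) = 0 :=
    wedge_zero_left (n := n) h (φ x) (stdFrame x)
  rw [this, mul_zero, zero_div]
-- Both terms are antisymmetrized sums over the same permutations, the factor (-1)^k cancelling the
-- one of the second term. The product rule merges them into directional derivatives of products of
-- components, each of which integrates to zero when one factor has compact support.
theorem wedge_extDeriv_add {k m : ℕ} (h : (k + 1) + m = n) (h' : k + (m + 1) = n)
    {a : Model n → Model n [⋀^Fin k]→L[ℝ] ℝ} {b : Model n → Model n [⋀^Fin m]→L[ℝ] ℝ}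
    {y : Model n} (ha : DifferentiableAt ℝ a y) (hb : DifferentiableAt ℝ b y) :
    wedge h (extDeriv a y) (b y) (stdVec n) + (-1) ^ k * wedge h' (a y) (extDeriv b y) (stdVec n) =
      ((k.factorial : ℝ) * m.factorial)⁻¹ * ∑ σ : Equiv.Perm (Fin (k + 1) ⊕ Fin m),
        ((Equiv.Perm.sign σ : ℤ) : ℝ) * fderiv ℝ (fun z =>
          a z (fun i => stdVec n (blockEquiv h (σ (Sum.inl i.succ)))) *
          b z (fun i => stdVec n (blockEquiv h (σ (Sum.inr i))))) y
          (stdVec n (blockEquiv h (σ (Sum.inl 0)))) := by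
  have h1 := factorial_mul_wedge_alternatizeUncurryFin_left h (fderiv ℝ a y) (b y) (stdVec n)
  have h2 := factorial_mul_wedge_alternatizeUncurryFin_right h h' (a y) (fderiv ℝ b y) (stdVec n)
  have h3 : ∀ (A : Fin k → Model n) (B : Fin m → Model n) (v : Model n),
      fderiv ℝ (fun z => a z A * b z B) y v =
        fderiv ℝ a y v A * b y B + a y A * fderiv ℝ b y v B := by
    intro A B v
    have e1 : HasFDerivAt (fun z => a z A) ((evalCLM A).comp (fderiv ℝ a y)) y :=
      (evalCLM A).hasFDerivAt.comp y ha.hasFDerivAt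
    have e2 : HasFDerivAt (fun z => b z B) ((evalCLM B).comp (fderiv ℝ b y)) y :=
      (evalCLM B).hasFDerivAt.comp y hb.hasFDerivAt
    refine (congrArg (fun L : Model n →L[ℝ] ℝ => L v) (e1.mul e2).fderiv).trans ?_
    simp only [add_apply, smul_apply, ContinuousLinearMap.comp_apply, evalCLM_apply, smul_eq_mul]
    ring
  have hpos : (0 : ℝ) < (k.factorial : ℝ) * m.factorial := by positivity
  rw [eq_inv_mul_iff_mul_eq₀ hpos.ne', mul_add]
  have h4 : ((k.factorial : ℝ) * m.factorial) *
      ((-1) ^ k * wedge h' (a y) (extDeriv b y) (stdVec n)) =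
      antisymSum h (fun x y' z => a y y' * fderiv ℝ b y x z) (stdVec n) := by
    rw [mul_left_comm]
    refine (congrArg _ h2).trans ?_
    rw [← mul_assoc, ← mul_pow]
    simp
  rw [h4]
  refine (congrArg (fun t => t + _) h1).trans ?_
  rw [antisymSum, antisymSum, ← Finset.sum_add_distrib]
  refine Finset.sum_congr rfl fun σ _ => ?_
  rw [h3]
  ring
variable [SecondCountableTopology M] [MeasurableSpace M] [BorelSpace M]
theorem IsSmoothForm.isMeasurableForm {j : ℕ} {α : FormField n M j} (hα : IsSmoothForm α) :
    IsMeasurableForm α := by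
  intro x₀ v
  have h1 : ContinuousOn (fun y => chartRep x₀ α y v) (extChartAt (𝓡 n) x₀).target :=
    (evalCLM v).continuous.comp_continuousOn (hα x₀).continuousOn
  exact (continuousOn_iff_continuous_domRestrict.1 h1).measurable
-- The length does not depend on the frame, so it may be computed in the coordinate frame of a fixed
-- chart, where every ingredient is continuous.
theorem IsSmoothForm.continuous_formNorm (g : Metric n M) {j : ℕ} {α : FormField n M j}
    (hα : IsSmoothForm α) : Continuous fun x => formNorm g x (α x) := by
  refine continuous_iff_continuousAt.2 fun x₀ => ?_
  let H : Model n → Matrix (Fin n) (Fin n) ℝ := fun y =>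
    gramMatrix (g.inner ((extChartAt (𝓡 n) x₀).symm y)) (coordFrame x₀ y)
  have hH : ContinuousOn H (extChartAt (𝓡 n) x₀).target := continuousOn_gram g x₀
  have hHdet : ∀ y ∈ (extChartAt (𝓡 n) x₀).target, (H y).det ≠ 0 := fun y hy => by
    obtain ⟨b, hb⟩ := exists_coordFrame_basis x₀ hy
    have hb' : (b : Fin n → _) = coordFrame x₀ y := funext hb
    change (gramMatrix _ _).det ≠ 0
    rw [← hb']
    exact gram_det_ne_zero g _ b
  have hinv : ∀ i i', ContinuousOn (fun y => (H y)⁻¹ i i') (extChartAt (𝓡 n) x₀).target := by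
    intro i i'
    simp only [Matrix.inv_def, Ring.inverse_eq_inv', Matrix.smul_apply, smul_eq_mul]
    refine ContinuousOn.mul (ContinuousOn.inv₀ ?_ hHdet) ?_
    · exact (Continuous.matrix_det continuous_id).comp_continuousOn hH
    · exact ((Continuous.matrix_adjugate continuous_id).matrix_elem i i').comp_continuousOn hH
  have hcont : ContinuousOn (fun y => √((j.factorial : ℝ)⁻¹ *
      ∑ I : Fin j → Fin n, ∑ J : Fin j → Fin n, (∏ a, (H y)⁻¹ (I a) (J a)) *
        (chartRep x₀ α y (fun a => EuclideanSpace.basisFun (Fin n) ℝ (I a)) *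
          chartRep x₀ α y (fun a => EuclideanSpace.basisFun (Fin n) ℝ (J a)))))
      (extChartAt (𝓡 n) x₀).target := by
    have he : ∀ v, ContinuousOn (fun y => chartRep x₀ α y v) (extChartAt (𝓡 n) x₀).target :=
      fun v => (evalCLM v).continuous.comp_continuousOn (hα x₀).continuousOn
    refine Real.continuous_sqrt.comp_continuousOn (continuousOn_const.mul
      (continuousOn_finsetSum _ fun I _ => continuousOn_finsetSum _ fun J _ => ?_))
    exact (continuousOn_finsetProd _ fun a _ => hinv _ _).mul ((he _).mul (he _))
  have heq : ∀ x ∈ (extChartAt (𝓡 n) x₀).source, formNorm g x (α x) =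
      (fun y => √((j.factorial : ℝ)⁻¹ *
      ∑ I : Fin j → Fin n, ∑ J : Fin j → Fin n, (∏ a, (H y)⁻¹ (I a) (J a)) *
        (chartRep x₀ α y (fun a => EuclideanSpace.basisFun (Fin n) ℝ (I a)) *
          chartRep x₀ α y (fun a => EuclideanSpace.basisFun (Fin n) ℝ (J a)))))
      (extChartAt (𝓡 n) x₀ x) := by
    intro x hx
    have hy := (extChartAt (𝓡 n) x₀).map_source hx
    have key : ∀ y ∈ (extChartAt (𝓡 n) x₀).target,
        formNorm g ((extChartAt (𝓡 n) x₀).symm y) (α ((extChartAt (𝓡 n) x₀).symm y)) =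
        √((j.factorial : ℝ)⁻¹ *
        ∑ I : Fin j → Fin n, ∑ J : Fin j → Fin n, (∏ a, (H y)⁻¹ (I a) (J a)) *
        (chartRep x₀ α y (fun a => EuclideanSpace.basisFun (Fin n) ℝ (I a)) *
          chartRep x₀ α y (fun a => EuclideanSpace.basisFun (Fin n) ℝ (J a)))) := by
      intro y hy
      obtain ⟨e, he⟩ := exists_orthonormal_frame g ((extChartAt (𝓡 n) x₀).symm y)
      obtain ⟨b, hb⟩ := exists_coordFrame_basis x₀ hy
      have hb' : (b : Fin n → _) = coordFrame x₀ y := funext hb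
      rw [formNorm, frameNormSq_basis g _ (stdFrame _) e he, ← frameNormSq_basis g _ b e he, hb']
      rfl
    have := key _ hy
    rw [(extChartAt (𝓡 n) x₀).left_inv hx] at this
    exact this
  have h1 := (hcont.comp (continuousOn_extChartAt x₀) fun x hx =>
    (extChartAt (𝓡 n) x₀).map_source hx).congr heq
  exact h1.continuousAt (extChartAt_source_mem_nhds x₀)
theorem IsTestForm.mem_pIntegrableForms (g : Metric n M) (p : Exponent) {j : ℕ}
    {α : FormField n M j} (hα : IsTestForm α) : α ∈ pIntegrableForms g p j := by
  refine ⟨hα.1.isMeasurableForm, ?_⟩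
  refine ((hα.1.continuous_formNorm g).memLp_of_hasCompactSupport ?_).2
  refine HasCompactSupport.intro' hα.2 isClosed_closure fun x hx => ?_
  have : α x = 0 := by
    by_contra h
    exact hx (subset_closure h)
  rw [this, formNorm_zero]
/-- A test form as an integrable form. -/
def IsTestForm.toLp (g : Metric n M) (p : Exponent) {j : ℕ}
    {α : FormField n M j} (hα : IsTestForm α) : LpForm g p j :=
  (⟨α, hα.mem_pIntegrableForms g p⟩ : pIntegrableForms g p j)
theorem IsTestForm.form_toLp (p : Exponent) {j : ℕ} {α : FormField n M j} (hα : IsTestForm α) :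
    (hα.toLp g p).form = α := rfl
-- Test forms belong to all L^p, and the exponents 2 and 2 are conjugate.
theorem IsTestForm.integrable_wedgeDensity (g : Metric n M) (o : ManifoldOrientation n M) {k l : ℕ}
    (h : k + l = n) {α : FormField n M k} {φ : FormField n M l} (hα : IsTestForm α)
    (hφ : IsTestForm φ) : Integrable (wedgeDensity g o h α φ) (riemannianMeasure g) :=
  _root_.integrable_wedgeDensity g o h (p := ⟨2, by norm_num⟩) (q := ⟨2, by norm_num⟩)
    (ENNReal.inv_two_add_inv_two) (hα.toLp g _) (hφ.toLp g _)
end Stokes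

/-! ### Stokes' theorem on the manifold -/

section GlobalStokes
theorem one_le_infty : (1 : WithTop ℕ∞) ≤ (∞ : WithTop ℕ∞) := WithTop.coe_le_coe.2 le_top
variable {n : ℕ} {M : Type*} [TopologicalSpace M] [ChartedSpace (Model n) M]
  [IsManifold (𝓡 n) ∞ M] [SecondCountableTopology M] [MeasurableSpace M] [BorelSpace M]
  {g : Metric n M} {o : ManifoldOrientation n M}
/-- The density of `d(α ∧ η)`. -/
def dWedgeDensity (g : Metric n M) (o : ManifoldOrientation n M) {k m : ℕ} (h : (k + 1) + m = n)
    (h' : k + (m + 1) = n) (α : FormField n M k) (η : FormField n M m) (x : M) : ℝ :=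
  wedgeDensity g o h (extD α) η x + (-1) ^ k * wedgeDensity g o h' α (extD η) x
-- On V the orientation sign of the chart is a constant c. In coordinates the integrand is c times a
-- sum of derivatives of compactly supported functions; compact support is needed for α only.
theorem integral_dWedgeDensity_local {k m : ℕ} (h : (k + 1) + m = n)
    (h' : k + (m + 1) = n) {α : FormField n M k} {η : FormField n M m} (hα : IsTestForm α)
    (hη : IsSmoothForm η) {x₀ : M} {V : Set M} (hV : V ⊆ (extChartAt (𝓡 n) x₀).source)
    {c : ℝ} (hc : ∀ x ∈ V, orientationSign o x *
      Real.sign (coordMap x₀ (extChartAt (𝓡 n) x₀ x) : Model n →L[ℝ] Model n).det = c)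
    (hsupp : closure {x | α x ≠ 0} ⊆ V) :
    ∫ x, dWedgeDensity g o h h' α η x ∂riemannianMeasure g = 0 := by
  obtain ⟨F⟩ := exists_adaptedFrame g o
  set K := closure {x | α x ≠ 0} with hK
  have hα0 : ∀ x ∉ K, α x = 0 := fun x hx => by
    by_contra h
    exact hx (subset_closure h)
  have hmeas : Measurable (dWedgeDensity g o h h' α η) :=
    (F.measurable_wedgeDensity h hα.1.extD.isMeasurableForm hη.isMeasurableForm).add
      ((F.measurable_wedgeDensity h' hα.1.isMeasurableForm hη.extD.isMeasurableForm).const_mul _)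
  have hD0 : ∀ x ∉ K, dWedgeDensity g o h h' α η x = 0 := fun x hx => by
    rw [dWedgeDensity, wedgeDensity_eq_zero_left h _ (extD_eq_zero_of_notMem hx),
      wedgeDensity_eq_zero_left h' _ (hα0 x hx), mul_zero, add_zero]
  rw [← setIntegral_eq_integral_of_forall_compl_eq_zero (s := (extChartAt (𝓡 n) x₀).source)
    fun x hx => hD0 x fun hxK => hx (hV (hsupp hxK)), setIntegral_source g x₀ hmeas]
  set Ω := (extChartAt (𝓡 n) x₀).target with hΩ
  have hΩo : IsOpen Ω := isOpen_target x₀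
  set K' := extChartAt (𝓡 n) x₀ '' K with hK'
  have hK's : K' ⊆ Ω := by
    rintro _ ⟨x, hx, rfl⟩
    exact (extChartAt (𝓡 n) x₀).map_source (hV (hsupp hx))
  have hK'c : IsCompact K' :=
    hα.2.image_of_continuousOn ((continuousOn_extChartAt x₀).mono (hsupp.trans hV))
  have ha0 : ∀ y ∈ Ω, y ∉ K' → (extChartAt (𝓡 n) x₀).symm y ∉ K := fun y hy hyK hx =>
    hyK ⟨_, hx, (extChartAt (𝓡 n) x₀).right_inv hy⟩
  have hda : ∀ y ∈ Ω, DifferentiableAt ℝ (chartRep x₀ α) y := fun y hy =>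
    ((hα.1 x₀).contDiffAt (hΩo.mem_nhds hy)).differentiableAt (by simp)
  have hdb : ∀ y ∈ Ω, DifferentiableAt ℝ (chartRep x₀ η) y := fun y hy =>
    ((hη x₀).contDiffAt (hΩo.mem_nhds hy)).differentiableAt (by simp)
  let f : Equiv.Perm (Fin (k + 1) ⊕ Fin m) → Model n → ℝ := fun σ z =>
    chartRep x₀ α z (fun i => stdVec n (blockEquiv h (σ (Sum.inl i.succ)))) *
      chartRep x₀ η z (fun i => stdVec n (blockEquiv h (σ (Sum.inr i))))
  have hf : ∀ σ, ContDiffOn ℝ 1 (f σ) Ω := fun σ => by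
    have h1 := (evalCLM (fun i => stdVec n (blockEquiv h (σ (Sum.inl i.succ))))).contDiff.comp_contDiffOn
      ((hα.1 x₀).of_le one_le_infty)
    have h2 := (evalCLM (fun i => stdVec n (blockEquiv h (σ (Sum.inr i))))).contDiff.comp_contDiffOn
      ((hη x₀).of_le one_le_infty)
    exact h1.mul h2
  have hf0 : ∀ σ, ∀ y ∈ Ω, y ∉ K' → f σ y = 0 := fun σ y hy hyK => by
    have : chartRep x₀ α y = 0 := chartRep_eq_zero (hα0 _ (ha0 y hy hyK))
    simp [f, this]
  have hfi := fun σ => integral_fderiv_apply_eq_zero (μ := (volume : Measure (Model n))) hΩo hK'c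
    hK's (hf σ) (hf0 σ) (stdVec n (blockEquiv h (σ (Sum.inl 0))))
  have key : ∀ y ∈ Ω, volDensity g x₀ y *
      dWedgeDensity g o h h' α η ((extChartAt (𝓡 n) x₀).symm y) =
      c * (((k.factorial : ℝ) * m.factorial)⁻¹ * ∑ σ : Equiv.Perm (Fin (k + 1) ⊕ Fin m),
        ((Equiv.Perm.sign σ : ℤ) : ℝ) *
          fderiv ℝ (f σ) y (stdVec n (blockEquiv h (σ (Sum.inl 0))))) := by
    intro y hy
    rw [← wedge_extDeriv_add h h' (hda y hy) (hdb y hy)]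
    -- The sign is known only on V. Away from the support of α, where it may be different, both
    -- sides vanish.
    by_cases hyK : (extChartAt (𝓡 n) x₀).symm y ∈ K
    · have hcy := hc _ (hsupp hyK)
      rw [(extChartAt (𝓡 n) x₀).right_inv hy] at hcy
      rw [dWedgeDensity, mul_add, mul_left_comm, volDensity_mul_wedgeDensity g o h _ _ hy,
        volDensity_mul_wedgeDensity g o h' _ _ hy, chartRep_extD hα.1 x₀ hy,
        chartRep_extD hη x₀ hy, hcy]
      ring
    · rw [hD0 _ hyK, mul_zero, ← chartRep_extD hα.1 x₀ hy,
        chartRep_eq_zero (extD_eq_zero_of_notMem hyK), chartRep_eq_zero (hα0 _ hyK),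
        wedge_zero_left, wedge_zero_left]
      ring
  rw [setIntegral_congr_fun hΩo.measurableSet key, integral_const_mul, integral_const_mul,
    integral_finsetSum _ fun σ _ => (hfi σ).1.const_mul _]
  simp only [integral_const_mul, (hfi _).2, mul_zero, Finset.sum_const_zero]
theorem IsTestForm.mulForm {k : ℕ} {ρ : M → ℝ} (hρ : ContMDiff (𝓡 n) 𝓘(ℝ, ℝ) ∞ ρ)
    {α : FormField n M k} (hα : IsTestForm α) : IsTestForm (mulForm ρ α) := by
  refine ⟨hα.1.mulForm hρ, hα.2.of_isClosed_subset isClosed_closure (closure_mono fun x hx h => ?_)⟩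
  exact hx (by rw [_root_.mulForm, h, smul_zero])
theorem closure_mulForm_subset {k : ℕ} (ρ : M → ℝ) (α : FormField n M k) :
    closure {x | mulForm ρ α x ≠ 0} ⊆ tsupport ρ := by
  refine closure_mono fun x hx h => ?_
  exact hx (by rw [mulForm, h, zero_smul])
variable [T2Space M]
/-- **Stokes' theorem** for the wedge product of two test forms. -/
theorem integral_dWedgeDensity {k m : ℕ} (h : (k + 1) + m = n) (h' : k + (m + 1) = n)
    {α : FormField n M k} {η : FormField n M m} (hα : IsTestForm α) (hη : IsTestForm η) :
    ∫ x, dWedgeDensity g o h h' α η x ∂riemannianMeasure g = 0 := by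
  have hloc : ∀ x₀ : M, ∃ V : Set M, IsOpen V ∧ x₀ ∈ V ∧ V ⊆ (extChartAt (𝓡 n) x₀).source ∧
      ∃ c : ℝ, ∀ x ∈ V, orientationSign o x *
        Real.sign (coordMap x₀ (extChartAt (𝓡 n) x₀ x) : Model n →L[ℝ] Model n).det = c := by
    intro x₀
    obtain ⟨c, -, hc⟩ := exists_eventually_orientationSign o x₀
    obtain ⟨V, hV, hVo, hx⟩ := _root_.mem_nhds_iff.1
      (hc.and (extChartAt_source_mem_nhds (I := 𝓡 n) x₀))
    exact ⟨V, hVo, hx, fun x hx => (hV hx).2, c, fun x hx => (hV hx).1⟩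
  choose V hVo hVx hVs c hc using hloc
  set K := closure {x | α x ≠ 0} with hK
  have hlc : LocallyCompactSpace M := ChartedSpace.locallyCompactSpace (Model n) M
  obtain ⟨f, hf⟩ := SmoothPartitionOfUnity.exists_isSubordinate (𝓡 n) (s := K) isClosed_closure V hVo
    fun x _ => mem_iUnion.2 ⟨x, hVx x⟩
  have hfin : {i | (Function.support (f i) ∩ K).Nonempty}.Finite :=
    f.locallyFinite.finite_nonempty_inter_compact hα.2
  have hsum : α = ∑ i ∈ hfin.toFinset, mulForm (f i) α := by
    funext x
    rw [Finset.sum_apply]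
    simp only [mulForm]
    rw [← Finset.sum_smul]
    by_cases hx : x ∈ K
    · have h1 := f.sum_eq_one hx
      rw [finsum_eq_sum_of_support_subset (s := hfin.toFinset)] at h1
      · rw [h1, one_smul]
      · intro i hi
        rw [Finite.coe_toFinset]
        exact ⟨x, hi, hx⟩
    · have : α x = 0 := by
        by_contra h
        exact hx (subset_closure h)
      rw [this, smul_zero]
  -- The induction carries along that partial sums are test forms, since additivity of d and
  -- integrability depend on it.
  have hpart : ∀ s : Finset M, IsTestForm (∑ i ∈ s, mulForm (f i) α) ∧
      ∫ x, dWedgeDensity g o h h' (∑ i ∈ s, mulForm (f i) α) η x ∂riemannianMeasure g = 0 := by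
    intro s
    induction s using Finset.cons_induction with
    | empty =>
      rw [Finset.sum_empty]
      refine ⟨IsTestForm.zero, ?_⟩
      have : ∀ x, dWedgeDensity g o h h' (0 : FormField n M k) η x = 0 := fun x => by
        rw [dWedgeDensity, extD_zero, wedgeDensity_eq_zero_left h _ rfl,
          wedgeDensity_eq_zero_left h' _ rfl]
        ring
      simp [this]
    | cons i s hi ih =>
      rw [Finset.sum_cons]
      have h1 : IsTestForm (mulForm (f i) α) := hα.mulForm (f i).contMDiff
      refine ⟨h1.add ih.1, ?_⟩
      have h2 : ∫ x, dWedgeDensity g o h h' (mulForm (f i) α) η x ∂riemannianMeasure g = 0 :=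
        integral_dWedgeDensity_local h h' h1 hη.1 (hVs i) (hc i)
          ((closure_mulForm_subset _ _).trans (hf i))
      have hint : ∀ {β : FormField n M k}, IsTestForm β →
          Integrable (dWedgeDensity g o h h' β η) (riemannianMeasure g) := fun hβ =>
        (hβ.extD.integrable_wedgeDensity g o h hη).add
          ((hβ.integrable_wedgeDensity g o h' hη.extD).const_mul _)
      have h3 : dWedgeDensity g o h h' (mulForm (f i) α + ∑ i ∈ s, mulForm (f i) α) η =
          dWedgeDensity g o h h' (mulForm (f i) α) η +
          dWedgeDensity g o h h' (∑ i ∈ s, mulForm (f i) α) η := by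
        funext x
        simp only [dWedgeDensity, Pi.add_apply]
        rw [extD_add h1.1 ih.1.1, wedgeDensity_add, wedgeDensity_add]
        simp only [Pi.add_apply]
        ring
      rw [h3]
      refine (integral_add' (hint h1) (hint ih.1)).trans ?_
      rw [h2, ih.2, add_zero]
  rw [hsum]
  exact (hpart _).2
-- Stokes' theorem read as integration by parts. It places test forms in every Ω_{q,p}, and their
-- differentials among the exact forms.
theorem IsTestForm.isWeakD {k : ℕ} {α : FormField n M k} (hα : IsTestForm α) :
    IsWeakD g o α (_root_.extD α) := by
  intro m h h' η hη
  have h1 := hα.extD.integrable_wedgeDensity g o h hη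
  have h2 := hα.integrable_wedgeDensity g o h' hη.extD
  refine ⟨h1, h2, ?_⟩
  have h3 := integral_dWedgeDensity (g := g) (o := o) h h' hα hη
  have h4 : ∫ x, dWedgeDensity g o h h' α η x ∂riemannianMeasure g =
      wedgeIntegral g o h (_root_.extD α) η + (-1) ^ k * wedgeIntegral g o h' α (_root_.extD η) :=
    (integral_add h1 (h2.const_mul _)).trans (congrArg _ (integral_const_mul _ _))
  rw [h4] at h3
  rw [pow_succ]
  linarith
end GlobalStokes

/-! ## Functions that annihilate the test forms of top degree -/
section TopDegree
variable {n : ℕ} {M : Type*} [TopologicalSpace M] [ChartedSpace (Model n) M]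
  [IsManifold (𝓡 n) ∞ M] {g : Metric n M} {o : ManifoldOrientation n M}
/-- The volume form of the coordinates of the chart at `x₀`. -/
def coordVolume (x₀ : M) : FormField n M n := fun x =>
  (minorForm id : Model n [⋀^Fin n]→L[ℝ] ℝ).compContinuousLinearMap (chartDeriv x₀ x)
theorem chartRep_coordVolume {x₀ x₁ : M} {y : Model n} (hy : y ∈ transitionDomain x₁ x₀) :
    chartRep x₁ (coordVolume x₀) y =
      (minorForm id : Model n [⋀^Fin n]→L[ℝ] ℝ).compContinuousLinearMap
        (fderiv ℝ (transition x₁ x₀) y) := by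
  rw [← chartDeriv_comp_coordMap hy]
  rfl
theorem eq_smul_minorForm_id (B : Model n [⋀^Fin n]→L[ℝ] ℝ) :
    B = B (stdVec n) • (minorForm id : Model n [⋀^Fin n]→L[ℝ] ℝ) := by
  have h : B - B (stdVec n) • (minorForm id : Model n [⋀^Fin n]→L[ℝ] ℝ) = 0 := by
    set e := (EuclideanSpace.basisFun (Fin n) ℝ).toBasis with he
    have he' : (e : Fin n → Model n) = stdVec n := by
      rw [he, OrthonormalBasis.coe_toBasis]
      rfl
    apply ContinuousAlternatingMap.toAlternatingMap_injective
    rw [AlternatingMap.eq_smul_basis_det e (ContinuousAlternatingMap.toAlternatingMap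
      (B - B (stdVec n) • (minorForm id : Model n [⋀^Fin n]→L[ℝ] ℝ))), he']
    have : (B - B (stdVec n) • (minorForm id : Model n [⋀^Fin n]→L[ℝ] ℝ)) (stdVec n) = 0 := by
      have h1 : (minorForm id : Model n [⋀^Fin n]→L[ℝ] ℝ) (stdVec n) = 1 :=
        minorForm_stdVec id Function.injective_id
      simp [h1]
    have h2 : (ContinuousAlternatingMap.toAlternatingMap
      (B - B (stdVec n) • (minorForm id : Model n [⋀^Fin n]→L[ℝ] ℝ))) (stdVec n) = 0 := this
    rw [h2, zero_smul]
    rfl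
  exact sub_eq_zero.1 h
theorem contDiffOn_chartRep_coordVolume (x₀ x₁ : M) :
    ContDiffOn ℝ ∞ (chartRep (n := n) x₁ (coordVolume x₀)) (transitionDomain (n := n) x₁ x₀) := by
  have h1 : ContDiffOn ℝ ∞ (fderiv ℝ (transition x₁ x₀)) (transitionDomain (n := n) x₁ x₀) :=
    (contDiffOn_transition x₁ x₀).fderiv_of_isOpen (isOpen_transitionDomain x₁ x₀) (by simp)
  have h2 : ContDiffOn ℝ ∞ (fun y i => fderiv ℝ (transition x₁ x₀) y (stdVec n i))
      (transitionDomain (n := n) x₁ x₀) :=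
    contDiffOn_pi.2 fun i => h1.clm_apply contDiffOn_const
  have h3 : ContDiff ℝ ∞ (fun v => (minorForm id : Model n [⋀^Fin n]→L[ℝ] ℝ) v) :=
    (minorForm id : Model n [⋀^Fin n]→L[ℝ] ℝ).toContinuousMultilinearMap.contDiff
  refine ((h3.comp_contDiffOn h2).smul
    (contDiffOn_const (c := (minorForm id : Model n [⋀^Fin n]→L[ℝ] ℝ)))).congr fun y hy => ?_
  rw [chartRep_coordVolume hy]
  exact eq_smul_minorForm_id _
-- At points outside the domain of the chart at x₀ the coordinate volume is meaningless, but ρ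
-- vanishes in a neighbourhood of them because its closed support lies inside the domain.
theorem isTestForm_mulForm_coordVolume [T2Space M] {x₀ : M} {ρ : M → ℝ} (hρ : ContMDiff (𝓡 n) 𝓘(ℝ, ℝ) ∞ ρ)
    (hc : HasCompactSupport ρ) (hs : tsupport ρ ⊆ (extChartAt (𝓡 n) x₀).source) :
    IsTestForm (mulForm ρ (coordVolume (n := n) x₀)) := by
  refine ⟨fun x₁ y hy => ?_, ?_⟩
  · have hyo := (isOpen_target (n := n) x₁).mem_nhds hy
    by_cases h : (extChartAt (𝓡 n) x₁).symm y ∈ (extChartAt (𝓡 n) x₀).source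
    · have hD : y ∈ transitionDomain x₁ x₀ := ⟨hy, h⟩
      have h1 : ContDiffOn ℝ ∞ (ρ ∘ (extChartAt (𝓡 n) x₁).symm) (extChartAt (𝓡 n) x₁).target := by
        rw [← contMDiffOn_iff_contDiffOn]
        exact hρ.comp_contMDiffOn (contMDiffOn_extChartAt_symm x₁)
      exact ((h1.contDiffAt hyo).smul ((contDiffOn_chartRep_coordVolume x₀ x₁).contDiffAt
        ((isOpen_transitionDomain x₁ x₀).mem_nhds hD))).contDiffWithinAt
    · have hev : ∀ᶠ z in 𝓝 y, ρ ((extChartAt (𝓡 n) x₁).symm z) = 0 := by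
        have h1 : (extChartAt (𝓡 n) x₁).symm y ∈ (tsupport ρ)ᶜ := fun hm => h (hs hm)
        have h2 := ((continuousOn_extChartAt_symm (I := 𝓡 n) x₁).continuousAt hyo).eventually
          ((isClosed_tsupport ρ).isOpen_compl.mem_nhds h1)
        filter_upwards [h2] with z hz
        exact image_eq_zero_of_notMem_tsupport hz
      refine ContDiffAt.contDiffWithinAt ?_
      refine (contDiffAt_const (c := (0 : Model n [⋀^Fin n]→L[ℝ] ℝ))).congr_of_eventuallyEq ?_
      filter_upwards [hev] with z hz
      rw [chartRep_mulForm, hz, zero_smul]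
  · refine HasCompactSupport.isCompact hc |>.of_isClosed_subset isClosed_closure
      (closure_mono fun x hx hρ => hx ?_)
    change ρ x • coordVolume x₀ x = 0
    rw [hρ, zero_smul]
-- Top-degree forms are multiples of the coordinate volume. Were α x nonzero, nondegeneracy would
-- give a top-degree form with nonzero product, hence a nonzero product with the coordinate volume.
theorem eq_zero_of_wedgeDensity_coordVolume (h : 0 + n = n) {α : FormField n M 0} {x₀ x : M}
    (hx : x ∈ (extChartAt (𝓡 n) x₀).source)
    (h0 : wedgeDensity g o h α (coordVolume x₀) x = 0) : α x = 0 := by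
  have hy := (extChartAt (𝓡 n) x₀).map_source hx
  refine (chartRep_apply_chart α x x₀ hx).1 ?_
  by_contra hne
  obtain ⟨B, hB⟩ := exists_wedge_stdVec_ne_zero h hne
  have h1 := volDensity_mul_wedgeDensity g o h α (coordVolume x₀) hy
  rw [(extChartAt (𝓡 n) x₀).left_inv hx, h0, mul_zero] at h1
  have hrep : chartRep x₀ (coordVolume x₀) (extChartAt (𝓡 n) x₀ x) = minorForm id := by
    have h2 := chartDeriv_comp_coordMap_self hy
    have h3 : chartRep x₀ (coordVolume x₀) (extChartAt (𝓡 n) x₀ x) =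
      (minorForm id : Model n [⋀^Fin n]→L[ℝ] ℝ).compContinuousLinearMap
        ((chartDeriv x₀ ((extChartAt (𝓡 n) x₀).symm (extChartAt (𝓡 n) x₀ x))).comp
          (coordMap x₀ (extChartAt (𝓡 n) x₀ x) : Model n →L[ℝ] Model n)) := rfl
    rw [h3, h2]
    rfl
  rw [hrep] at h1
  have hsign : orientationSign o x *
      Real.sign (coordMap x₀ (extChartAt (𝓡 n) x₀ x) : Model n →L[ℝ] Model n).det ≠ 0 := by
    refine mul_ne_zero ?_ fun h => ?_
    · rcases orientationSign_eq o x with h | h <;> simp [h]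
    · have := abs_sign (coordMap_det_ne_zero hy)
      rw [h, abs_zero] at this
      exact zero_ne_one this
  have h4 := (mul_eq_zero.1 h1.symm).resolve_left hsign
  rw [eq_smul_minorForm_id B, wedge_smul_right, h4, mul_zero] at hB
  exact hB rfl
variable [SecondCountableTopology M] [MeasurableSpace M] [BorelSpace M] [T2Space M]
/-- A function that annihilates the test forms of top degree vanishes almost everywhere. -/
theorem ae_eq_zero_of_forall_isTestForm (h : 0 + n = n) {p : Exponent}
    (α : LpForm g p 0)
    (hα : ∀ η : FormField n M n, IsTestForm η → wedgeIntegral g o h α.form η = 0) :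
    ∀ᵐ x ∂riemannianMeasure g, α.form x = 0 := by
  have hlc : LocallyCompactSpace M := ChartedSpace.locallyCompactSpace (Model n) M
  -- The conjugate exponent, which may be 1 or ∞ here, serves only to make α integrable against test
  -- forms.
  obtain ⟨q, hq1, hpq⟩ : ∃ q : ℝ≥0∞, 1 ≤ q ∧ q⁻¹ + (p : ℝ≥0∞)⁻¹ = 1 := by
    have := ENNReal.HolderConjugate.conjExponent (p := (p : ℝ≥0∞)) p.2
    refine ⟨ENNReal.conjExponent p, this.symm.one_le, ?_⟩
    rw [add_comm]
    exact ENNReal.holderConjugate_iff.1 this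
  have hmul : ∀ (x₀ : M) (ρ : M → ℝ), wedgeDensity g o h α.form (mulForm ρ (coordVolume x₀)) =
      fun x => ρ x • wedgeDensity g o h α.form (coordVolume x₀) x := fun x₀ ρ => by
    funext x
    exact congrFun (wedgeDensity_smul_right h (ρ x) α.form (coordVolume x₀)) x
  have hloc : ∀ x₀ : M, ∀ᵐ x ∂riemannianMeasure g, x ∈ (extChartAt (𝓡 n) x₀).source →
      α.form x = 0 := by
    intro x₀
    have hint : LocallyIntegrableOn (wedgeDensity g o h α.form (coordVolume x₀))
        (extChartAt (𝓡 n) x₀).source (riemannianMeasure g) := by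
      intro x hx
      obtain ⟨ρ, hρ1, hρs⟩ : ∃ ρ : SmoothBumpFunction (𝓡 n) x, True ∧
          tsupport ρ ⊆ (extChartAt (𝓡 n) x₀).source := by
        obtain ⟨ρ, -, hρ⟩ := (SmoothBumpFunction.nhds_basis_tsupport (I := 𝓡 n) x).mem_iff.1
          ((isOpen_extChartAt_source (I := 𝓡 n) x₀).mem_nhds hx)
        exact ⟨ρ, trivial, hρ⟩
      have ht := isTestForm_mulForm_coordVolume ρ.contMDiff ρ.hasCompactSupport hρs
      have hi := integrable_wedgeDensity g o h (p := p) (q := ⟨q, hq1⟩) hpq α (ht.toLp g _)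
      rw [IsTestForm.form_toLp, hmul] at hi
      obtain ⟨V, hV, hVo, hxV⟩ := _root_.mem_nhds_iff.1 (ρ.eventuallyEq_one)
      -- A bump function equal to 1 near x turns the coordinate volume into a test form without
      -- changing the integrand there.
      refine IntegrableAtFilter.filter_mono nhdsWithin_le_nhds ⟨V, hVo.mem_nhds hxV, ?_⟩
      refine hi.integrableOn.congr_fun (fun z hz => ?_) hVo.measurableSet
      have : ρ z = 1 := hV hz
      simp only [this, one_smul]
    -- Fundamental lemma of the calculus of variations, on one chart domain.
    have hz := (isOpen_extChartAt_source (I := 𝓡 n) x₀).ae_eq_zero_of_integral_contMDiff_smul_eq_zero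
      (𝓡 n) hint fun ρ hρ hc hs => by
        have := hα _ (isTestForm_mulForm_coordVolume hρ hc hs)
        rwa [wedgeIntegral, hmul] at this
    filter_upwards [hz] with x hx hxs
    exact eq_zero_of_wedgeDensity_coordVolume h hxs (hx hxs)
  obtain ⟨s, hs, hcov⟩ := TopologicalSpace.countable_cover_nhds
    (fun x : M => extChartAt_source_mem_nhds (I := 𝓡 n) x)
  have hall : ∀ᵐ x ∂riemannianMeasure g, ∀ x₀ ∈ s, x ∈ (extChartAt (𝓡 n) x₀).source →
      α.form x = 0 := (ae_ball_iff hs).2 fun x₀ _ => hloc x₀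
  filter_upwards [hall] with x hx
  have hx' : x ∈ ⋃ x₀ ∈ s, (extChartAt (𝓡 n) x₀).source := hcov ▸ mem_univ x
  obtain ⟨x₀, h1, h2⟩ := mem_iUnion₂.1 hx'
  exact hx x₀ h1 h2
theorem wedgeIntegral_eq_zero_of_ae {k l : ℕ} (h : k + l = n) {α : FormField n M k}
    (hα : ∀ᵐ x ∂riemannianMeasure g, α x = 0) (φ : FormField n M l) :
    wedgeIntegral g o h α φ = 0 := by
  rw [wedgeIntegral, ← integral_zero M ℝ (μ := riemannianMeasure g)]
  refine integral_congr_ae ?_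
  filter_upwards [hα] with x hx
  exact wedgeDensity_eq_zero_left h φ hx
end TopDegree

/-! ## Closed and exact forms as annihilators -/
section Duality
variable {n : ℕ} {M : Type*} [TopologicalSpace M] [ChartedSpace (Model n) M]
  [IsManifold (𝓡 n) ∞ M] [SecondCountableTopology M] [MeasurableSpace M] [BorelSpace M]
  [T2Space M] {g : Metric n M} {o : ManifoldOrientation n M}
theorem one_lt_of_conjugate {p p' : Exponent} (hp : (p : ℝ≥0∞) < ⊤)
    (h : (p' : ℝ≥0∞)⁻¹ + (p : ℝ≥0∞)⁻¹ = 1) : 1 < (p' : ℝ≥0∞) := by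
  refine lt_of_le_of_ne p'.2 fun h1 => hp.ne ?_
  rw [← h1, inv_one] at h
  exact ENNReal.inv_eq_zero.1 ((ENNReal.add_right_inj ENNReal.one_ne_top).1 (h.trans (add_zero 1).symm))
theorem lt_top_of_conjugate {p p' : Exponent} (hp : 1 < (p : ℝ≥0∞))
    (h : (p' : ℝ≥0∞)⁻¹ + (p : ℝ≥0∞)⁻¹ = 1) : (p' : ℝ≥0∞) < ⊤ := by
  refine lt_top_iff_ne_top.2 fun h1 => hp.ne ?_
  rw [h1, ENNReal.inv_top, zero_add, ENNReal.inv_eq_one] at h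
  exact h.symm
theorem eq_zero_of_lt_degree {k : ℕ} (hk : n < k) {x : M}
    (α : TangentSpace (𝓡 n) x [⋀^Fin k]→L[ℝ] ℝ) : α = 0 := by
  ext v
  refine α.toAlternatingMap.map_linearDependent v fun hv => ?_
  have h1 : Module.finrank ℝ (TangentSpace (𝓡 n) x) = n := by
    rw [Module.finrank_eq_card_basis (stdFrame x), Fintype.card_fin]
  have : FiniteDimensional ℝ (TangentSpace (𝓡 n) x) := (stdFrame x).finiteDimensional_of_finite
  have h2 := hv.fintype_card_le_finrank
  rw [h1, Fintype.card_fin] at h2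
  omega
theorem mem_map_snd_testPairs {q p : Exponent} {k : ℕ} {φ : LpForm g p (k + 1)} :
    φ ∈ (testPairs g q p k).map (LinearMap.snd ℝ _ _) ↔
      ∃ η : FormField n M k, IsTestForm η ∧ φ.form = extD η := by
  constructor
  · rintro ⟨z, hz, rfl⟩
    exact ⟨z.1.form, hz.1, hz.2⟩
  · rintro ⟨η, hη, h⟩
    exact ⟨(hη.toLp g q, φ), ⟨hη, h⟩, rfl⟩
theorem wedgeIntegral_zero_left {k l : ℕ} (h : k + l = n) (φ : FormField n M l) :
    wedgeIntegral g o h (0 : FormField n M k) φ = 0 :=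
  wedgeIntegral_eq_zero_of_ae h (Eventually.of_forall fun _ => rfl) φ
theorem wedgeIntegral_zero_right {k l : ℕ} (h : k + l = n) (α : FormField n M k) :
    wedgeIntegral g o h α (0 : FormField n M l) = 0 := by
  have h' : l + k = n := by omega
  rw [wedgeIntegral_comm h' h, wedgeIntegral_zero_left, mul_zero]
-- Weak closedness is orthogonality to dη for all test forms η; integrability is automatic by
-- Hölder. For l = 0 there is nothing to test, in agreement with a zero space of exact test forms.
theorem mem_closedForms_iff {k l : ℕ} (h : k + l = n) {p p' : Exponent}
    (hp : (p' : ℝ≥0∞)⁻¹ + (p : ℝ≥0∞)⁻¹ = 1) {α : LpForm g p k} :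
    α ∈ closedForms g o p k ↔ ∀ a ∈ testExactForms g p' l, formPairing g o h hp α a = 0 := by
  cases l with
  | zero =>
    refine ⟨fun _ a ha => ?_, fun _ m hm => by omega⟩
    rw [(Submodule.mem_bot ℝ).1 ha, map_zero]
  | succ m =>
    constructor
    · intro hα a ha
      obtain ⟨η, hη, hd⟩ := mem_map_snd_testPairs.1 ha
      obtain ⟨-, -, h3⟩ := hα m (by omega) h η hη
      rw [wedgeIntegral_zero_left] at h3
      rw [formPairing_apply, hd]
      exact (mul_eq_zero.1 h3.symm).resolve_left (pow_ne_zero _ (by norm_num))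
    · intro H m' h1 h2 η hη
      obtain rfl : m' = m := by omega
      refine ⟨?_, integrable_wedgeDensity g o h2 hp α (hη.extD.toLp g p'), ?_⟩
      · refine (integrable_zero M ℝ (riemannianMeasure g)).congr (Eventually.of_forall fun x => ?_)
        exact (wedgeDensity_eq_zero_left h1 η rfl).symm
      · have h3 : wedgeIntegral g o h2 α.form (extD η) = 0 :=
          H (hη.extD.toLp g p') (mem_map_snd_testPairs.2 ⟨η, hη, rfl⟩)
        rw [wedgeIntegral_zero_left, h3, mul_zero]
-- The weak differential of γ is tested against dη, which is itself a test form, and d(dη) = 0.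
theorem exactForms_le_closedForms (q p : Exponent) (k : ℕ) :
    exactForms g o q p k ≤ closedForms g o p k := by
  cases k with
  | zero => exact bot_le
  | succ k =>
    rintro _ ⟨z, hz, rfl⟩ m h h' η hη
    obtain ⟨h1, -, h3⟩ := hz (m + 1) h' (by omega) (extD η) hη.extD
    refine ⟨?_, h1, ?_⟩
    · refine (integrable_zero M ℝ (riemannianMeasure g)).congr (Eventually.of_forall fun x => ?_)
      exact (wedgeDensity_eq_zero_left h η rfl).symm
    · rw [extD_extD hη.1, wedgeIntegral_zero_right, mul_zero] at h3
      refine (wedgeIntegral_zero_left h η).trans ?_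
      exact (mul_eq_zero_of_right _ h3).symm
theorem IsTestForm.mem_exactForms {k : ℕ} {η : FormField n M k} (hη : IsTestForm η)
    (q p : Exponent) : hη.extD.toLp g p ∈ exactForms g o q p (k + 1) :=
  ⟨(hη.toLp g q, hη.extD.toLp g p), hη.isWeakD, rfl⟩
theorem testPairs_le_Omega (q p : Exponent) (k : ℕ) : testPairs g q p k ≤ Omega g o q p k := by
  rintro z ⟨h1, h2⟩
  change IsWeakD g o z.1.form z.2.form
  rw [h2]
  exact h1.isWeakD
-- A pair (γ, dγ) defines a continuous functional on L^{p'} × L^s that vanishes on test pairs by the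
-- definition of the weak differential. It vanishes on their closure, and at (φ, 0) only ∫ dγ ∧ φ
-- remains.
theorem formPairing_eq_zero_of_mem_interiorClosedForms {k l : ℕ} (h : k + l = n)
    {p q p' s : Exponent} (hp : (p' : ℝ≥0∞)⁻¹ + (p : ℝ≥0∞)⁻¹ = 1)
    (hs : (s : ℝ≥0∞)⁻¹ + (q : ℝ≥0∞)⁻¹ = 1) {φ : LpForm g p' l}
    (hφ : φ ∈ interiorClosedForms g o p' s l) {e : LpForm g p k} (he : e ∈ exactForms g o q p k) :
    formPairing g o h hp e φ = 0 := by
  cases k with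
  | zero => rw [(Submodule.mem_bot ℝ).1 he, map_zero, zero_apply]
  | succ k =>
    obtain ⟨z, hz, rfl⟩ := he
    have h' : k + (l + 1) = n := by omega
    have H := map_eq_zero_of_mem_closure (testPairs g p' s l)
      ((formPairing g o h hp z.2).comp (ContinuousLinearMap.fst ℝ _ _) -
        ((-1 : ℝ) ^ (k + 1)) • (formPairing g o h' hs z.1).comp (ContinuousLinearMap.snd ℝ _ _))
      (fun w hw => by
        obtain ⟨-, -, h3⟩ := hz l h h' w.1.form hw.1
        change wedgeIntegral g o h z.2.form w.1.form -
          (-1) ^ (k + 1) * wedgeIntegral g o h' z.1.form w.2.form = 0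
        rw [hw.2, h3, sub_self]) hφ.2
    change wedgeIntegral g o h z.2.form φ.form -
          (-1) ^ (k + 1) * wedgeIntegral g o h' z.1.form (0 : FormField n M (l + 1)) = 0 at H
    rwa [wedgeIntegral_zero_right, mul_zero, sub_zero] at H
-- By Stokes' theorem differentials of test forms are exact, whatever q is, so orthogonality to
-- exact forms includes all the tests for weak closedness.
theorem isWeakD_zero_of_forall_exactForms {k l : ℕ} (h : k + l = n)
    {p p' : Exponent} (q : Exponent) (hp : (p' : ℝ≥0∞)⁻¹ + (p : ℝ≥0∞)⁻¹ = 1) {φ : LpForm g p' l}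
    (H : ∀ e ∈ exactForms g o q p k, formPairing g o h hp e φ = 0) : IsWeakD g o φ.form 0 := by
  intro m h1 h2 ζ hζ
  obtain rfl : k = m + 1 := by omega
  have h3 := H _ (hζ.mem_exactForms q p)
  rw [formPairing_apply, IsTestForm.form_toLp] at h3
  have hp' : (p : ℝ≥0∞)⁻¹ + (p' : ℝ≥0∞)⁻¹ = 1 := by rwa [add_comm]
  have h4 := integrable_wedgeDensity g o h2 hp' φ (hζ.extD.toLp g p)
  rw [IsTestForm.form_toLp] at h4
  refine ⟨?_, h4, ?_⟩
  · refine (integrable_zero M ℝ (riemannianMeasure g)).congr (Eventually.of_forall fun x => ?_)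
    exact (wedgeDensity_eq_zero_left h1 ζ rfl).symm
  · rw [wedgeIntegral_zero_left, wedgeIntegral_comm h h2, h3, mul_zero, mul_zero]
-- If a functional separates (φ, 0) from the test pairs, it is represented by a pair (α, γ).
-- Vanishing on (η, dη) makes α the weak differential of γ up to sign, so α pairs to zero with φ,
-- contrary to the separation.
theorem mem_closure_testPairs_of_forall_exactForms {k l : ℕ} (h : k + l = n)
    {p q p' s : Exponent} (hp : (p' : ℝ≥0∞)⁻¹ + (p : ℝ≥0∞)⁻¹ = 1)
    (hs : (s : ℝ≥0∞)⁻¹ + (q : ℝ≥0∞)⁻¹ = 1) (hp1 : 1 < (p' : ℝ≥0∞)) (hpt : (p' : ℝ≥0∞) < ⊤)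
    (hs1 : 1 < (s : ℝ≥0∞)) (hst : (s : ℝ≥0∞) < ⊤) {φ : LpForm g p' l}
    (H : ∀ e ∈ exactForms g o q p k, formPairing g o h hp e φ = 0) :
    ((φ, 0) : LpForm g p' l × LpForm g s (l + 1)) ∈ (testPairs g p' s l).topologicalClosure := by
  by_contra hn
  obtain ⟨F, hF, hne⟩ := exists_functional_of_notMem_closure _ hn
  obtain ⟨_, _, hrep⟩ := exists_formPairing_eq g o h hp hp1 hpt
  obtain ⟨α, -, hα⟩ := hrep (F.comp (ContinuousLinearMap.inl ℝ _ _))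
  have hsplit : ∀ w : LpForm g p' l × LpForm g s (l + 1),
      F w = wedgeIntegral g o h α.form w.1.form + F (0, w.2) := fun w => by
    have h1 : wedgeIntegral g o h α.form w.1.form = F (w.1, 0) := DFunLike.congr_fun hα w.1
    rw [h1, ← map_add, Prod.mk_add_mk, add_zero, zero_add]
  have hφ : F (φ, 0) = wedgeIntegral g o h α.form φ.form := by
    have h1 : F ((0, 0) : LpForm g p' l × LpForm g s (l + 1)) = 0 := map_zero F
    rw [hsplit, h1, add_zero]
  refine hne (hφ.trans ?_)
  cases k with
  | zero =>
    -- In degree 0 no nonzero form is exact, so α itself must vanish. Since η has top degree, dη = 0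
    -- and (η, 0) is a test pair.
    obtain rfl : l = n := by omega
    refine wedgeIntegral_eq_zero_of_ae h (ae_eq_zero_of_forall_isTestForm (o := o) h α fun η hη => ?_) _
    have h1 := hF (hη.toLp g p', 0) ⟨hη, ?_⟩
    · have h2 : F ((0, 0) : LpForm g p' l × LpForm g s (l + 1)) = 0 := map_zero F
      rwa [hsplit, h2, add_zero] at h1
    · funext x
      exact (eq_zero_of_lt_degree (Nat.lt_succ_self _) _).symm
  | succ k =>
    have h' : k + (l + 1) = n := by omega
    obtain ⟨_, _, hrep'⟩ := exists_formPairing_eq g o h' hs hs1 hst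
    obtain ⟨γ, -, hγ⟩ := hrep' (F.comp (ContinuousLinearMap.inr ℝ _ _))
    have hγ' : ∀ ψ : LpForm g s (l + 1), F (0, ψ) = wedgeIntegral g o h' γ.form ψ.form :=
      fun ψ => (DFunLike.congr_fun hγ ψ).symm
    -- The functional gives ∫ α ∧ η = -∫ γ ∧ dη, while a weak differential of the k-form γ carries
    -- the sign (-1)^{k+1}; the factor (-1)^k makes up the difference.
    have hmem : ((-1 : ℝ) ^ k • α) ∈ exactForms g o q p (k + 1) := by
      refine ⟨(γ, (-1 : ℝ) ^ k • α), fun m h1 h2 η hη => ?_, rfl⟩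
      obtain rfl : m = l := by omega
      have h3 := hF (hη.toLp g p', hη.extD.toLp g s) ⟨hη, rfl⟩
      rw [hsplit, hγ'] at h3
      refine ⟨integrable_wedgeDensity g o h1 hp ((-1 : ℝ) ^ k • α) (hη.toLp g p'),
        integrable_wedgeDensity g o h2 hs γ (hη.extD.toLp g s), ?_⟩
      have h4 : wedgeIntegral g o h1 ((-1 : ℝ) ^ k • α).form η =
          (-1 : ℝ) ^ k * wedgeIntegral g o h1 α.form η := by
        rw [LpForm.form_smul, wedgeIntegral, wedgeDensity_smul]
        exact integral_const_mul _ _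
      refine h4.trans ?_
      change wedgeIntegral g o h α.form η + wedgeIntegral g o h' γ.form (extD η) = 0 at h3
      rw [eq_neg_of_add_eq_zero_left h3, pow_succ]
      ring
    have h5 := H _ hmem
    rw [map_smul, smul_apply, smul_eq_mul] at h5
    exact (mul_eq_zero.1 h5).resolve_left (pow_ne_zero _ (by norm_num))
theorem mem_interiorClosedForms_iff {k l : ℕ} (h : k + l = n)
    {p q p' s : Exponent} (hp : (p' : ℝ≥0∞)⁻¹ + (p : ℝ≥0∞)⁻¹ = 1)
    (hs : (s : ℝ≥0∞)⁻¹ + (q : ℝ≥0∞)⁻¹ = 1) (hp1 : 1 < (p' : ℝ≥0∞)) (hpt : (p' : ℝ≥0∞) < ⊤)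
    (hs1 : 1 < (s : ℝ≥0∞)) (hst : (s : ℝ≥0∞) < ⊤) {φ : LpForm g p' l} :
    φ ∈ interiorClosedForms g o p' s l ↔
      ∀ e ∈ exactForms g o q p k, formPairing g o h hp e φ = 0 :=
  ⟨fun hφ _ he => formPairing_eq_zero_of_mem_interiorClosedForms h hp hs hφ he, fun H =>
    ⟨isWeakD_zero_of_forall_exactForms h q hp H,
      mem_closure_testPairs_of_forall_exactForms h hp hs hp1 hpt hs1 hst H⟩⟩
/-- The duality between closed forms modulo exact forms and interior closed forms modulo
differentials of test forms, for spaces isometric to those of closed forms. -/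
theorem exists_reduced_duality {k l : ℕ} (h : k + l = n) {p q p' s : Exponent}
    (hp1 : 1 < (p : ℝ≥0∞)) (hpt : (p : ℝ≥0∞) < ⊤) (hq1 : 1 < (q : ℝ≥0∞)) (hqt : (q : ℝ≥0∞) < ⊤)
    (hp : (p' : ℝ≥0∞)⁻¹ + (p : ℝ≥0∞)⁻¹ = 1) (hs : (s : ℝ≥0∞)⁻¹ + (q : ℝ≥0∞)⁻¹ = 1)
    {Z W : Type*} [SeminormedAddCommGroup Z] [NormedSpace ℝ Z]
    [SeminormedAddCommGroup W] [NormedSpace ℝ W]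
    (jZ : Z →ₗᵢ[ℝ] LpForm g p k) (jW : W →ₗᵢ[ℝ] LpForm g p' l)
    (hZ : ∀ α, (∃ z, jZ z = α) ↔ α ∈ closedForms g o p k)
    (hW : ∀ φ, (∃ w, jW w = φ) ↔ φ ∈ interiorClosedForms g o p' s l)
    (N : Submodule ℝ Z) (N' : Submodule ℝ W)
    (hN : ∀ z, z ∈ N ↔ jZ z ∈ (exactForms g o q p k).topologicalClosure)
    (hN' : ∀ w, w ∈ N' ↔ jW w ∈ (testExactForms g p' l).topologicalClosure) :
    ∃ (Φ : (Z ⧸ N) ≃L[ℝ] StrongDual ℝ (W ⧸ N')) (Ψ : (W ⧸ N') ≃L[ℝ] StrongDual ℝ (Z ⧸ N)),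
      ∀ z w, Integrable (wedgeDensity g o h (jZ z).form (jW w).form) (riemannianMeasure g) ∧
        Φ (Submodule.Quotient.mk z) (Submodule.Quotient.mk w) =
          wedgeIntegral g o h (jZ z).form (jW w).form ∧
        Ψ (Submodule.Quotient.mk w) (Submodule.Quotient.mk z) =
          wedgeIntegral g o h (jZ z).form (jW w).form := by
  have hp1' := one_lt_of_conjugate hpt hp
  have hpt' := lt_top_of_conjugate hp1 hp
  have hs1 := one_lt_of_conjugate hqt hs
  have hst := lt_top_of_conjugate hq1 hs
  obtain ⟨K, hK, hY⟩ := exists_formPairing_eq g o h hp hp1' hpt'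
  obtain ⟨K', hK', hX⟩ := exists_representing_form g o h
  have hX' := hX p p' hp1 hpt hp
  have hEA : ∀ e ∈ exactForms g o q p k, ∀ a ∈ testExactForms g p' l,
      formPairing g o h hp e a = 0 := fun e he =>
    (mem_closedForms_iff h hp).1 (exactForms_le_closedForms q p k he)
  have hZ' := fun α => (hZ α).trans (mem_closedForms_iff h hp)
  have hW' := fun φ => (hW φ).trans (mem_interiorClosedForms_iff h hp hs hp1' hpt' hs1 hst)
  obtain ⟨Φ, hΦ⟩ := exists_annihilator_quotient_equiv_dual (formPairing g o h hp) K hK hY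
    (fun f => (hX' f).imp fun φ hφ α => (hφ.2 α).symm) _ _ hEA jZ jW hZ' hW' N N' hN hN'
  -- The abstract statement is symmetric: the second isomorphism comes from the flipped pairing with
  -- E and A exchanged.
  obtain ⟨Ψ, hΨ⟩ := exists_annihilator_quotient_equiv_dual (formPairing g o h hp).flip K' hK'
    (fun f => (hX' f).imp fun φ hφ => ⟨hφ.1, by ext α; exact (hφ.2 α).symm⟩)
    (fun f => (hY f).imp fun α hα φ => DFunLike.congr_fun hα.2 φ) _ _
    (fun a ha e he => hEA e he a ha) jW jZ hW' hZ' N' N hN' hN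
  exact ⟨Φ, Ψ, fun z w => ⟨integrable_wedgeDensity g o h hp _ _, hΦ z w, hΨ w z⟩⟩
end Duality

/-! ## The complexes of a tuple of exponents -/
section Tuples
variable {n : ℕ} {M : Type*} [TopologicalSpace M] [ChartedSpace (Model n) M]
  [IsManifold (𝓡 n) ∞ M] [SecondCountableTopology M] [MeasurableSpace M] [BorelSpace M]
  {g : Metric n M} {o : ManifoldOrientation n M}
-- Tuples are truncated at n, so the hypothesis is on truncated indices; it also covers the
-- fictitious index n + 1, which occurs in top degree.
theorem IsDualTuple.entry {π π' : Fin (n + 1) → Exponent} (h : IsDualTuple π π') {i j : ℕ}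
    (hij : min i n + min j n = n) :
    (_root_.entry π' j : ℝ≥0∞)⁻¹ + (_root_.entry π i : ℝ≥0∞)⁻¹ = 1 := by
  have h1 := h ⟨min j n, by omega⟩
  have h2 : (⟨min j n, by omega⟩ : Fin (n + 1)).rev = ⟨min i n, by omega⟩ :=
    Fin.ext (by rw [Fin.val_rev]; simp only; omega)
  rwa [h2] at h1
theorem mem_topologicalClosure_map_inl {X Y : Type*} [SeminormedAddCommGroup X] [NormedSpace ℝ X]
    [SeminormedAddCommGroup Y] [NormedSpace ℝ Y] (S : Submodule ℝ X) (x : X) :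
    (x, (0 : Y)) ∈ (S.map (LinearMap.inl ℝ X Y)).topologicalClosure ↔
      x ∈ S.topologicalClosure := by
  constructor
  · intro h
    refine map_mem_closure continuous_fst h ?_
    rintro _ ⟨y, hy, rfl⟩
    exact hy
  · intro h
    have hc : Continuous fun y : X => (y, (0 : Y)) := (ContinuousLinearMap.inl ℝ X Y).continuous
    exact map_mem_closure (f := fun y : X => (y, (0 : Y))) hc h fun y hy => ⟨y, hy, rfl⟩
/-- The cocycles of degree `k`, as forms. -/
def cocycleForm {π : Fin (n + 1) → Exponent} (C : (k : ℕ) → Submodule ℝ (PairSpace g π k))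
    (k : ℕ) : cocycles C k →ₗᵢ[ℝ] LpForm g (entry π k) k where
  toLinearMap := LinearMap.fst ℝ _ _ ∘ₗ (cocycles C k).subtype
  norm_map' z := by
    have h : z.1.2 = 0 := z.2.2
    change ‖z.1.1‖ = ‖z.1‖
    rw [Prod.norm_def, h, norm_zero, max_eq_left (norm_nonneg _)]
theorem exists_cocycleForm_eq {π : Fin (n + 1) → Exponent}
    (C : (k : ℕ) → Submodule ℝ (PairSpace g π k)) (k : ℕ) (α : LpForm g (entry π k) k) :
    (∃ z, cocycleForm C k z = α) ↔ (α, 0) ∈ C k := by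
  constructor
  · rintro ⟨z, rfl⟩
    have h : z.1.2 = 0 := z.2.2
    have h1 : (cocycleForm C k z, (0 : LpForm g (entry π (k + 1)) (k + 1))) = z.1 :=
      Prod.ext rfl h.symm
    rw [h1]
    exact z.2.1
  · exact fun h => ⟨⟨(α, 0), h, rfl⟩, rfl⟩
-- Coboundaries are the exact forms embedded as pairs (dγ, 0). In degree 0 the truncated index k - 1
-- = 0 is harmless, both spaces being zero.
theorem mem_closure_coboundaries_OmegaPi {π : Fin (n + 1) → Exponent} {k : ℕ}
    (z : cocycles (OmegaPi g o π) k) :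
    z ∈ (coboundaries (OmegaPi g o π) k).topologicalClosure.submoduleOf
        (cocycles (OmegaPi g o π) k) ↔
      cocycleForm (OmegaPi g o π) k z ∈
        (exactForms g o (entry π (k - 1)) (entry π k) k).topologicalClosure := by
  have hz : z.1 = (cocycleForm (OmegaPi g o π) k z, 0) := Prod.ext rfl z.2.2
  have hE : coboundaries (OmegaPi g o π) k =
      (exactForms g o (entry π (k - 1)) (entry π k) k).map (LinearMap.inl ℝ _ _) := by
    cases k with
    | zero => exact Submodule.map_bot _ |>.symm
    | succ k => exact Submodule.map_comp _ _ _
  rw [← mem_topologicalClosure_map_inl (Y := LpForm g (entry π (k + 1)) (k + 1)), ← hE, ← hz]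
  exact Iff.rfl
variable [T2Space M]
-- Here the coboundaries are differentials of limits of test forms, not only of test forms.
-- Convergence of (η, dη) includes that of dη, so the two spaces have the same closure.
theorem mem_closure_coboundaries_OmegaPi₀ {π : Fin (n + 1) → Exponent} {k : ℕ}
    (z : cocycles (OmegaPi₀ g o π) k) :
    z ∈ (coboundaries (OmegaPi₀ g o π) k).topologicalClosure.submoduleOf
        (cocycles (OmegaPi₀ g o π) k) ↔
      cocycleForm (OmegaPi₀ g o π) k z ∈
        (testExactForms g (entry π k) k).topologicalClosure := by
  have hz : z.1 = (cocycleForm (OmegaPi₀ g o π) k z, 0) := Prod.ext rfl z.2.2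
  have hE : (coboundaries (OmegaPi₀ g o π) k).topologicalClosure =
      ((testExactForms g (entry π k) k).map (LinearMap.inl ℝ _ _)).topologicalClosure := by
    cases k with
    | zero => rw [testExactForms, Submodule.map_bot]; rfl
    | succ k =>
      refine le_antisymm (Submodule.topologicalClosure_minimal _ ?_
        (Submodule.isClosed_topologicalClosure _)) (Submodule.topologicalClosure_mono ?_)
      · rintro _ ⟨w, hw, rfl⟩
        refine (mem_topologicalClosure_map_inl _ w.2).2 (map_mem_closure continuous_snd hw.2 ?_)
        exact fun v hv => mem_map_snd_testPairs.2 ⟨v.1.form, hv.1, hv.2⟩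
      · rintro _ ⟨ψ, hψ, rfl⟩
        obtain ⟨η, hη, hd⟩ := mem_map_snd_testPairs.1 hψ
        have hT : (hη.toLp g (entry π k), ψ) ∈ testPairs g (entry π k) (entry π (k + 1)) k :=
          ⟨hη, hd⟩
        exact ⟨(hη.toLp g _, ψ), ⟨testPairs_le_Omega _ _ _ hT,
          Submodule.le_topologicalClosure _ hT⟩, rfl⟩
  rw [← mem_topologicalClosure_map_inl (Y := LpForm g (entry π (k + 1)) (k + 1)), ← hE, ← hz]
  exact Iff.rfl
end Tuples
-- The duality theorem for a pair and for a tuple of exponents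
theorem theorem1p1 {n : ℕ} {M : Type*} [TopologicalSpace M] [T2Space M]
    [SecondCountableTopology M] [ChartedSpace (Model n) M] [IsManifold (𝓡 n) ∞ M]
    [MeasurableSpace M] [BorelSpace M] (g : Metric n M) (o : ManifoldOrientation n M)
    (k l : ℕ) (hkl : k + l = n) :
    (∀ p q p' q' : Exponent, 1 < (p : ℝ≥0∞) → (p : ℝ≥0∞) < ⊤ → 1 < (q : ℝ≥0∞) → (q : ℝ≥0∞) < ⊤ →
      (p' : ℝ≥0∞)⁻¹ + (p : ℝ≥0∞)⁻¹ = 1 → (q' : ℝ≥0∞)⁻¹ + (q : ℝ≥0∞)⁻¹ = 1 →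
      ∃ (Φ : ReducedCohomology g o q p k ≃L[ℝ]
            StrongDual ℝ (InteriorReducedCohomology g o p' q' l))
        (Ψ : InteriorReducedCohomology g o p' q' l ≃L[ℝ]
            StrongDual ℝ (ReducedCohomology g o q p k)),
        ∀ (α : closedForms g o p k) (φ : interiorClosedForms g o p' q' l),
          Integrable (wedgeDensity g o hkl α.1.form φ.1.form) (riemannianMeasure g) ∧
          Φ (Submodule.Quotient.mk α) (Submodule.Quotient.mk φ) =
            wedgeIntegral g o hkl α.1.form φ.1.form ∧
          Ψ (Submodule.Quotient.mk φ) (Submodule.Quotient.mk α) =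
            wedgeIntegral g o hkl α.1.form φ.1.form) ∧
    (∀ π π' : Fin (n + 1) → Exponent, (∀ i, 1 < (π i : ℝ≥0∞) ∧ (π i : ℝ≥0∞) < ⊤) →
      IsDualTuple π π' →
      ∃ (Φ : ComplexReducedCohomology (OmegaPi g o π) k ≃L[ℝ]
            StrongDual ℝ (ComplexReducedCohomology (OmegaPi₀ g o π') l))
        (Ψ : ComplexReducedCohomology (OmegaPi₀ g o π') l ≃L[ℝ]
            StrongDual ℝ (ComplexReducedCohomology (OmegaPi g o π) k)),
        ∀ (β : cocycles (OmegaPi g o π) k) (φ : cocycles (OmegaPi₀ g o π') l),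
          Integrable (wedgeDensity g o hkl β.1.1.form φ.1.1.form) (riemannianMeasure g) ∧
          Φ (Submodule.Quotient.mk β) (Submodule.Quotient.mk φ) =
            wedgeIntegral g o hkl β.1.1.form φ.1.1.form ∧
          Ψ (Submodule.Quotient.mk φ) (Submodule.Quotient.mk β) =
            wedgeIntegral g o hkl β.1.1.form φ.1.1.form) := by
  constructor
  · intro p q p' q' hp1 hpt hq1 hqt hp hq
    exact exists_reduced_duality hkl hp1 hpt hq1 hqt hp hq
      (closedForms g o p k).subtypeₗᵢ (interiorClosedForms g o p' q' l).subtypeₗᵢ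
      (fun α => ⟨fun ⟨z, hz⟩ => hz ▸ z.2, fun h => ⟨⟨α, h⟩, rfl⟩⟩)
      (fun φ => ⟨fun ⟨z, hz⟩ => hz ▸ z.2, fun h => ⟨⟨φ, h⟩, rfl⟩⟩)
      _ _ (fun _ => Iff.rfl) (fun _ => Iff.rfl)
  · intro π π' hπ hdual
    -- The exponents p_{k-1} and π'_{l+1} are conjugate since (k - 1) + (l + 1) = n; for k = 0 the
    -- truncations turn the indices into 0 and n, which still add up to n.
    exact exists_reduced_duality hkl (q := entry π (k - 1)) (s := entry π' (l + 1))
      (hπ _).1 (hπ _).2 (hπ _).1 (hπ _).2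
      (hdual.entry (by omega)) (hdual.entry (by omega))
      (cocycleForm (OmegaPi g o π) k) (cocycleForm (OmegaPi₀ g o π') l)
      (exists_cocycleForm_eq _ k) (exists_cocycleForm_eq _ l)
      _ _ mem_closure_coboundaries_OmegaPi mem_closure_coboundaries_OmegaPi₀
end
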